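/- **Setup.** Let $\mathbb O$ be the real octonions with units $e_0=1,e_1,\dots,e_7$, where $e_\mu^2=-1$, $e_\mu e_\nu=-e_\nu e_\mu$ for $\mu\ne\nu$ in $\{1,\dots,7\}$, and $e_\mu e_{\mu+1}=e_{\mu+3}$ (indices mod $7$) together with the relations obtained by cyclically permuting each triple $(e_\mu,e_{\mu+1},e_{\mu+3})$. For $k\in\{1,2,4,8\}$ put $n_k=3k+2\in\{5,8,14,26\}$. For $x\in\mathbb R^{n_k}$ (with $x^I=0$ for $I>n_k$) let $$X^1=x^1e_0+x^6e_1+x^9e_2+x^{10}e_4+x^{15}e_3+x^{16}e_5+x^{17}e_6+x^{18}e_7,$$ $$X^2=x^2e_0+x^7e_1+x^{11}e_2+x^{12}e_4+x^{19}e_3+x^{20}e_5+x^{21}e_6+x^{22}e_7,$$ $$X^3=x^3e_0+x^8e_1+x^{13}e_2+x^{14}e_4+x^{23}e_3+x^{24}e_5+x^{25}e_6+x^{26}e_7,$$ $$A(x)=\begin{pmatrix}x^5-\sqrt3x^4&\sqrt3X^3&\sqrt3X^2\\ \sqrt3\,\overline{X^3}&x^5+\sqrt3x^4&\sqrt3X^1\\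 \sqrt3\,\overline{X^2}&\sqrt3\,\overline{X^1}&-2x^5\end{pmatrix}.$$ The entries of $A(x)$ lie in $\mathbb R,\mathbb C,\mathbb H,\mathbb O$ for $k=1,2,4,8$ respectively (the quaternion units $\mathbf i,\mathbf j,\mathbf k$ being $e_1,e_2,e_4$). Let $${\det}_1A=a_{11}a_{22}a_{33}-a_{12}a_{21}a_{33}-a_{13}a_{22}a_{31}-a_{11}a_{23}a_{32}+a_{13}(a_{32}a_{21})+(a_{12}a_{23})a_{31},$$ which is real for $A=A(x)$, and let $\Upsilon_{IJK}$ be the totally symmetric tensor on $\mathbb R^{n_k}$ with $\Upsilon_{IJK}x^Ix^Jx^K=\tfrac12\det_1A(x)$. Let $H_k\subset SO(n_k)$ be the stabilizer of $\Upsilon$ in $SO(n_k)$, with Lie algebra $\mathfrak h_k=\{X\in M_{n_k}(\mathbb R): \exp(tX)\in H_k\ \forall t\in\mathbb R\}$; for $k=8$ it is the compact exceptional group $F_4$ in its $26$-dimensional representation (this is taken as the definition of $F_4$, with Lie algebra $\mathfrak f_4=\mathfrak h_8$). Elements $W$ of $\otimes^2\mathbb R^{n_k}$ are identified with their component matrices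 $(W^{IK})$, on which $h\in H_k$ acts by $W\mapsto hWh^{T}$, and $\mathfrak h_k$ is regarded as a subset of $\otimes^2\mathbb R^{n_k}$ in this way. Finally let $\hat\Upsilon$ be the endomorphism of $\otimes^2\mathbb R^{n_k}$ given by $$\hat\Upsilon(W)^{IK}=4\,\Upsilon_{IJM}\Upsilon_{KLM}W^{JL},$$ and let $E_\mu=\{W:\hat\Upsilon(W)=\mu W\}$. **Proposition.** For each $k\in\{1,2,4,8\}$, $$\textstyle\bigotimes^2\mathbb R^{n_k}=E_{4+2n_k}\oplus E_{2+n_k}\oplus E_{2-n_k}\oplus E_{-8}\oplus E_{4},$$ where $E_{4+2n_k},E_{2-n_k},E_4$ consist of symmetric tensors and $E_{2+n_k},E_{-8}$ of skew-symmetric tensors. Each of the five summands is $H_k$-invariant and is an irreducible real representation of $H_k$. Moreover $E_{4+2n_k}=\{\lambda g:\lambda\in\mathbb R\}$, where $g$ is the Euclidean metric (the identity matrix), and $E_{2+n_k}=\mathfrak h_k$. The eigenvalues and dimensions are as follows. 1. $n_k=5$: the eigenvalues $14,7,-3,-8,4$ have eigenspaces of dimensions $1,3,5,7,9$. The group $H_1$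 is the image of $SO(3)$ in its action $A\mapsto gAg^{T}$ on the real symmetric trace-free matrices $A(x)$, $x\in\mathbb R^5$, and $E_7$ is the image of $\mathfrak{so}(3)$ under the differential $A\mapsto ZA-AZ$ of this action. 2. $n_k=8$: the eigenvalues $20,10,-6,-8,4$ have eigenspaces of dimensions $1,8,8,20,27$. The group $H_2$ is the image of $SU(3)$ in its action $A\mapsto gAg^*$ on the complex hermitian trace-free matrices $A(x)$, $x\in\mathbb R^8$, and $E_{10}$ is the image of $\mathfrak{su}(3)$ under the differential of this action. The representations $E_{10}$ and $E_{-6}$ of $H_2$ are equivalent. 3. $n_k=14$: the eigenvalues $32,16,-12,-8,4$ have eigenspaces of dimensions $1,21,14,70,90$. The group $H_4$ is the image of $Sp(3)=\{g\in M_3(\mathbb H): gg^*=g^*g=1\}$ in its action $A\mapsto gAg^*$ on the quaternionic hermitian trace-free matrices $A(x)$, $x\in\mathbb R^{14}$, and $E_{16}$ is the image of $\mathfrak{sp}(3)$ under the differential of this action. 4. $n_k=26$: the eigenvalues $56,28,-24,-8,4$ have eigenspaces of dimensions $1,52,26,273,324$; here $H_8=F_4$ and $E_{28}=\mathfrak f_4$.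 -/

import Mathlib

open scoped Matrix Quaternion

/-- The real octonions, with unit `e₀ = 1` and imaginary units `e₁, …, e₇`; the entry `im i` is the
coefficient of `e_{i+1}`. -/
@[ext]
structure Octonion where
  re : ℝ
  im : Fin 7 → ℝ

namespace Octonion

instance : Zero Octonion := ⟨⟨0, 0⟩⟩
instance : One Octonion := ⟨⟨1, 0⟩⟩
instance : Add Octonion := ⟨fun x y => ⟨x.re + y.re, x.im + y.im⟩⟩
instance : Sub Octonion := ⟨fun x y => ⟨x.re - y.re, x.im - y.im⟩⟩
instance : SMul ℝ Octonion := ⟨fun r x => ⟨r * x.re, r • x.im⟩⟩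
instance : Star Octonion := ⟨fun x => ⟨x.re, -x.im⟩⟩

/-- The product with `e_μ² = -1`, `e_μ e_ν = -e_ν e_μ` and `e_μ e_{μ+1} = e_{μ+3}` (indices modulo
`7`), together with the cyclic permutations of each triple `(e_μ, e_{μ+1}, e_{μ+3})`. The three
triples that contain the unit with index `c` are `(c, c+1, c+3)`, `(c-1, c, c+2)` and
`(c-3, c-2, c)`; the indices below are added in `Fin 7`. -/
instance : Mul Octonion := ⟨fun x y =>
  ⟨x.re * y.re - ∑ i, x.im i * y.im i,
   fun c => x.re * y.im c + x.im c * y.re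
      + (x.im (c + 1) * y.im (c + 3) - x.im (c + 3) * y.im (c + 1))
      + (x.im (c + 2) * y.im (c + 6) - x.im (c + 6) * y.im (c + 2))
      + (x.im (c + 4) * y.im (c + 5) - x.im (c + 5) * y.im (c + 4))⟩⟩

end Octonion

noncomputable section

/-! ### The cubic form -/

/-- The coordinate `x^I` for `I = 1, 2, …` (counted from one); it is `0` for `I > n`. -/
def coordinate {n : ℕ} (x : Fin n → ℝ) (I : ℕ) : ℝ :=
  if h : I - 1 < n then x ⟨I - 1, h⟩ else 0

/-- The trace-free hermitian `3 × 3` matrix with the two real parameters `x⁴`, `x⁵` on the diagonal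
and the off-diagonal entries `√3 X¹`, `√3 X²`, `√3 X³` and their conjugates. -/
def hermitianMatrix {D : Type} [One D] [SMul ℝ D] [Star D] (x₄ x₅ : ℝ) (X₁ X₂ X₃ : D) :
    Matrix (Fin 3) (Fin 3) D :=
  let r : ℝ := Real.sqrt 3
  !![(x₅ - r * x₄) • (1 : D), r • X₃, r • X₂;
     r • star X₃, (x₅ + r * x₄) • (1 : D), r • X₁;
     r • star X₂, r • star X₁, (-2 * x₅) • (1 : D)]

/-- The octonionic matrix `A(x)`. -/
def octonionMatrix {n : ℕ} (x : Fin n → ℝ) : Matrix (Fin 3) (Fin 3) Octonion :=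
  let c := coordinate x
  hermitianMatrix (c 4) (c 5)
    ⟨c 1, ![c 6, c 9, c 15, c 10, c 16, c 17, c 18]⟩
    ⟨c 2, ![c 7, c 11, c 19, c 12, c 20, c 21, c 22]⟩
    ⟨c 3, ![c 8, c 13, c 23, c 14, c 24, c 25, c 26]⟩

/-- The determinant `det₁`, with the indicated order of the factors and brackets in the last two
terms. On hermitian octonionic matrices its value is real. -/
def detOne (A : Matrix (Fin 3) (Fin 3) Octonion) : Octonion :=
  A 0 0 * A 1 1 * A 2 2 - A 0 1 * A 1 0 * A 2 2 - A 0 2 * A 1 1 * A 2 0 - A 0 0 * A 1 2 * A 2 1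
    + A 0 2 * (A 2 1 * A 1 0) + (A 0 1 * A 1 2) * A 2 0

/-- The cubic form `Υ(x, x, x) = ½ det₁ A(x)` on `ℝⁿ`, for `n = 5, 8, 14, 26`. -/
def cubicForm (n : ℕ) (x : Fin n → ℝ) : ℝ := (detOne (octonionMatrix x)).re / 2

/-- The components `Υ_{IJK}` of the symmetric tensor with `∑ Υ_{IJK} x^I x^J x^K` equal to the cubic
form, obtained by polarization (the third-order difference below is the third partial derivative
`∂³/∂x^I∂x^J∂x^K` of the cubic form). -/
def upsilon (n : ℕ) (I J K : Fin n) : ℝ :=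
  let e : Fin n → Fin n → ℝ := fun I => Pi.single I 1
  let F := cubicForm n
  (F (e I + e J + e K) - F (e I + e J) - F (e J + e K) - F (e I + e K)
    + F (e I) + F (e J) + F (e K)) / 6

/-! ### The stabilizer and its action on two-tensors -/

/-- The trilinear form `T(x, y, z) = ∑ T_{IJK} x^I y^J z^K`. -/
def trilinearForm {n : ℕ} (T : Fin n → Fin n → Fin n → ℝ) (x y z : Fin n → ℝ) : ℝ :=
  ∑ I, ∑ J, ∑ K, T I J K * x I * y J * z K

/-- The stabilizer in `SO(n)` of a three-tensor `T`. -/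
def stabilizerSO {n : ℕ} (T : Fin n → Fin n → Fin n → ℝ) :
    Subgroup (Matrix.specialOrthogonalGroup (Fin n) ℝ) where
  carrier := {h | ∀ x y z, trilinearForm T (h.1 *ᵥ x) (h.1 *ᵥ y) (h.1 *ᵥ z) = trilinearForm T x y z}
  one_mem' := by
    intro x y z
    simp
  mul_mem' := by
    intro a b ha hb x y z
    simp only [Submonoid.coe_mul, ← Matrix.mulVec_mulVec]
    rw [ha, hb]
  inv_mem' := by
    intro a ha x y z
    have key : ∀ v, a.1 *ᵥ ((a⁻¹).1 *ᵥ v) = v := by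
      intro v
      rw [Matrix.mulVec_mulVec, ← Submonoid.coe_mul, mul_inv_cancel]
      simp
    rw [← ha, key, key, key]

/-- The group `H_k`: the stabilizer of `Υ` in `SO(n)`, where `n = n_k = 3k + 2`. -/
def groupH (n : ℕ) : Subgroup (Matrix.specialOrthogonalGroup (Fin n) ℝ) :=
  stabilizerSO (upsilon n)

/-- The set of matrices `X` whose one-parameter group `t ↦ exp (tX)` lies in the matrix group `H_k`:
the Lie algebra of `H_k`. -/
def lieAlgebraH (n : ℕ) : Set (Matrix (Fin n) (Fin n) ℝ) :=
  {X | ∀ t : ℝ, ∃ h ∈ groupH n, (h : Matrix (Fin n) (Fin n) ℝ) = NormedSpace.exp (t • X)}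

/-- The representation of a subgroup `H` of `SO(n)` on `⊗²ℝⁿ`. An element of `⊗²ℝⁿ` is given by the
matrix of its components `W^{IK}`, on which `h` acts by `W ↦ h W hᵀ`. -/
def tensorSquareRep {n : ℕ} (H : Subgroup (Matrix.specialOrthogonalGroup (Fin n) ℝ)) :
    Representation ℝ H (Matrix (Fin n) (Fin n) ℝ) where
  toFun h :=
    { toFun := fun W => h.1.1 * W * h.1.1ᵀ
      map_add' := by intro W V; rw [mul_add, add_mul]
      map_smul' := by intro r W; simp }
  map_one' := by
    ext1 W
    simp
  map_mul' := by
    intro a b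
    ext1 W
    simp [Matrix.transpose_mul, mul_assoc]

/-- The endomorphism `W^{IK} ↦ 4 T_{IJM} T_{KLM} W^{JL}` of `⊗²ℝⁿ` (sum over `J, L, M`). -/
def hatEndomorphism {n : ℕ} (T : Fin n → Fin n → Fin n → ℝ) :
    Module.End ℝ (Matrix (Fin n) (Fin n) ℝ) where
  toFun W := Matrix.of fun I K => 4 * ∑ J, ∑ L, ∑ M, T I J M * T K L M * W J L
  map_add' W V := by
    ext I K
    simp [mul_add, Finset.sum_add_distrib]
  map_smul' r W := by
    ext I K
    simp only [Matrix.smul_apply, smul_eq_mul, Matrix.of_apply, RingHom.id_apply, Finset.mul_sum]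
    refine Finset.sum_congr rfl fun J _ => Finset.sum_congr rfl fun L _ =>
      Finset.sum_congr rfl fun M _ => ?_
    ring

/-- The endomorphism `Υ̂`. -/
def hatUpsilon (n : ℕ) : Module.End ℝ (Matrix (Fin n) (Fin n) ℝ) :=
  hatEndomorphism (upsilon n)

theorem hatEndomorphism_eq_sum {n : ℕ} (T : Fin n → Fin n → Fin n → ℝ)
    (W : Matrix (Fin n) (Fin n) ℝ) :
    hatEndomorphism T W = (4 : ℝ) • ∑ M : Fin n,
      (Matrix.of fun I J => T I J M) * W * (Matrix.of fun I J => T I J M)ᵀ := by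
  ext I K
  simp only [hatEndomorphism, LinearMap.coe_mk, AddHom.coe_mk, Matrix.of_apply, Matrix.smul_apply,
    Matrix.sum_apply, Matrix.mul_apply, Matrix.transpose_apply, smul_eq_mul, Finset.sum_mul]
  congr 1
  calc ∑ J, ∑ L, ∑ M, T I J M * T K L M * W J L
      = ∑ L, ∑ J, ∑ M, T I J M * T K L M * W J L := Finset.sum_comm
    _ = ∑ L, ∑ M, ∑ J, T I J M * T K L M * W J L :=
        Finset.sum_congr rfl fun L _ => Finset.sum_comm
    _ = ∑ M, ∑ L, ∑ J, T I J M * T K L M * W J L := Finset.sum_comm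
    _ = _ := Finset.sum_congr rfl fun M _ => Finset.sum_congr rfl fun L _ =>
        Finset.sum_congr rfl fun J _ => by ring

theorem hatEndomorphism_comm {n : ℕ} (T : Fin n → Fin n → Fin n → ℝ) (h : stabilizerSO T)
    (W : Matrix (Fin n) (Fin n) ℝ) :
    hatEndomorphism T (tensorSquareRep (stabilizerSO T) h W) =
      tensorSquareRep (stabilizerSO T) h (hatEndomorphism T W) := by
  obtain ⟨⟨a, ha⟩, hT⟩ := h
  have ha1 : a * aᵀ = 1 := (Matrix.mem_orthogonalGroup_iff _ _).1
    (Matrix.mem_specialOrthogonalGroup_iff.1 ha).1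
  have ha2 : aᵀ * a = 1 := (Matrix.mem_orthogonalGroup_iff' _ _).1
    (Matrix.mem_specialOrthogonalGroup_iff.1 ha).1
  set S : Fin n → Matrix (Fin n) (Fin n) ℝ := fun M => Matrix.of fun I J => T I J M with hS
  have h1 : ∀ K, aᵀ * (∑ C, a C K • S C) * a = S K := by
    intro K
    ext I J
    have := hT (Pi.single I 1) (Pi.single J 1) (Pi.single K 1)
    have hR : trilinearForm T (Pi.single I 1) (Pi.single J 1) (Pi.single K 1) = T I J K := by
      simp [trilinearForm, Pi.single_apply]
    rw [hR] at this
    have hL : trilinearForm T (a *ᵥ Pi.single I 1) (a *ᵥ Pi.single J 1) (a *ᵥ Pi.single K 1)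
        = ∑ A, ∑ B, ∑ C, T A B C * a A I * a B J * a C K := by
      simp [trilinearForm]
    have this := hL.symm.trans this
    change _ = T I J K
    rw [← this, hS]
    simp only [Matrix.mul_apply, Matrix.transpose_apply, Matrix.sum_apply, Matrix.smul_apply,
      Matrix.of_apply, smul_eq_mul, Finset.sum_mul, Finset.mul_sum]
    symm
    rw [Finset.sum_comm]
    refine Finset.sum_congr rfl fun B _ => ?_
    rw [Finset.sum_comm]
    refine Finset.sum_congr rfl fun C _ => Finset.sum_congr rfl fun A _ => ?_
    ring
  have h2 : ∀ K, ∑ C, a C K • S C = a * S K * aᵀ := by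
    intro K
    rw [← h1 K]
    simp only [mul_assoc]
    rw [ha1, mul_one, ← mul_assoc, ha1, one_mul]
  have h3 : ∀ C C' : Fin n, ∑ K, a C K * a C' K = if C = C' then 1 else 0 := by
    intro C C'
    have := congrFun (congrFun ha1 C) C'
    rwa [Matrix.mul_apply, Matrix.one_apply] at this
  rw [hatEndomorphism_eq_sum, hatEndomorphism_eq_sum, map_smul]
  congr 1
  change ∑ M, S M * (a * W * aᵀ) * (S M)ᵀ = a * (∑ M, S M * W * (S M)ᵀ) * aᵀ
  have h4 : ∀ K, a * (S K * W * (S K)ᵀ) * aᵀ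
      = (a * S K * aᵀ) * (a * W * aᵀ) * (a * S K * aᵀ)ᵀ := by
    intro K
    simp only [Matrix.transpose_mul, Matrix.transpose_transpose]
    have e : ∀ X : Matrix (Fin n) (Fin n) ℝ, aᵀ * (a * X) = X := fun X => by
      rw [← mul_assoc, ha2, one_mul]
    simp only [mul_assoc, e]
  rw [Finset.mul_sum, Finset.sum_mul]
  simp only [h4, ← h2]
  simp only [Matrix.transpose_sum, Matrix.transpose_smul, Finset.sum_mul, Finset.mul_sum,
    Matrix.smul_mul, Matrix.mul_smul, smul_smul]
  symm
  rw [Finset.sum_comm]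
  refine Finset.sum_congr rfl fun C _ => ?_
  rw [Finset.sum_comm]
  simp only [← Finset.sum_smul]
  simp [h3]

/-- The eigenspace `{W | Υ̂ W = μ W}`. -/
def eigenspaceUpsilon (n : ℕ) (μ : ℝ) : Submodule ℝ (Matrix (Fin n) (Fin n) ℝ) :=
  (hatUpsilon n).eigenspace μ

/-- The eigenspaces of `Υ̂` are `H_k`-invariant: the eigenspace for `μ` as a subrepresentation of
`⊗²ℝⁿ`. -/
def eigenSubrep (n : ℕ) (μ : ℝ) : Subrepresentation (tensorSquareRep (groupH n)) where
  toSubmodule := eigenspaceUpsilon n μ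
  apply_mem_toSubmodule h W hW := by
    have hW' := Module.End.mem_eigenspace_iff.1 hW
    refine Module.End.mem_eigenspace_iff.2 ?_
    have := hatEndomorphism_comm (upsilon n) h W
    change hatUpsilon n (tensorSquareRep (groupH n) h W) =
      tensorSquareRep (groupH n) h (hatUpsilon n W) at this
    rw [this, hW', map_smul]

/-- The eigenspace for `μ`, as a representation of `H_k`. -/
def eigenRep (n : ℕ) (μ : ℝ) : Representation ℝ (groupH n) (eigenspaceUpsilon n μ) :=
  (eigenSubrep n μ).toRepresentation

/-- The decomposition `⊗²ℝⁿ = ⊙²_{d 0} ⊕ ⋀²_{d 1} ⊕ ⊙²_{d 2} ⊕ ⋀²_{d 3} ⊕ ⊙²_{d 4}` into the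
eigenspaces of `Υ̂` with eigenvalues `ev 0, …, ev 4`. -/
structure TensorSquareDecomposition (n : ℕ) (ev : Fin 5 → ℝ) (d : Fin 5 → ℕ) : Prop where
  isInternal : DirectSum.IsInternal fun i => eigenspaceUpsilon n (ev i)
  isSymm : ∀ i ∈ ({0, 2, 4} : Set (Fin 5)), ∀ S ∈ eigenspaceUpsilon n (ev i), Sᵀ = S
  isSkew : ∀ i ∈ ({1, 3} : Set (Fin 5)), ∀ F ∈ eigenspaceUpsilon n (ev i), Fᵀ = -F
  finrank_eq : ∀ i, Module.finrank ℝ (eigenspaceUpsilon n (ev i)) = d i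
  isIrreducible : ∀ i, (eigenRep n (ev i)).IsIrreducible
  scalar : eigenspaceUpsilon n (ev 0) = Submodule.span ℝ {1}
  lieAlgebra : (eigenspaceUpsilon n (ev 1) : Set (Matrix (Fin n) (Fin n) ℝ)) = lieAlgebraH n

/-! ### The real, complex and quaternionic matrices

Here `ℝ ⊂ ℂ ⊂ ℍ` sit in the octonions with `i = e₁`, `j = e₂`, `k = e₄`. -/

/-- The matrix `A(x)` for `x ∈ ℝ⁵`. -/
def realMatrix (x : Fin 5 → ℝ) : Matrix (Fin 3) (Fin 3) ℝ :=
  let c := coordinate x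
  hermitianMatrix (c 4) (c 5) (c 1) (c 2) (c 3)

/-- The matrix `A(x)` for `x ∈ ℝ⁸`. -/
def complexMatrix (x : Fin 8 → ℝ) : Matrix (Fin 3) (Fin 3) ℂ :=
  let c := coordinate x
  hermitianMatrix (c 4) (c 5) (⟨c 1, c 6⟩ : ℂ) ⟨c 2, c 7⟩ ⟨c 3, c 8⟩

/-- The matrix `A(x)` for `x ∈ ℝ¹⁴`. -/
def quaternionMatrix (x : Fin 14 → ℝ) : Matrix (Fin 3) (Fin 3) ℍ[ℝ] :=
  let c := coordinate x
  hermitianMatrix (c 4) (c 5) (⟨c 1, c 6, c 9, c 10⟩ : ℍ[ℝ]) ⟨c 2, c 7, c 11, c 12⟩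
    ⟨c 3, c 8, c 13, c 14⟩

/-- For a real star algebra `D`, a real linear parametrization `A` of a space of matrices over `D`
by `ℝⁿ`, and a set `G` of matrices, the set of all `h` such that `A (h x) = g A(x) g*` for some
`g ∈ G` and all `x`: the image of `G` under its action by conjugation. -/
def conjugationImage {n : ℕ} {D : Type} [Ring D] [StarRing D]
    (A : (Fin n → ℝ) → Matrix (Fin 3) (Fin 3) D) (G : Set (Matrix (Fin 3) (Fin 3) D)) :
    Set (Matrix (Fin n) (Fin n) ℝ) :=
  {h | ∃ g ∈ G, ∀ x, A (h *ᵥ x) = g * A x * gᴴ}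

/-- The set of all `F` such that `A (F x) = Z A(x) - A(x) Z` for some `Z ∈ L` and all `x`: the image
of a set `L` of anti-hermitian matrices under the differential of the action by conjugation. -/
def commutatorImage {n : ℕ} {D : Type} [Ring D]
    (A : (Fin n → ℝ) → Matrix (Fin 3) (Fin 3) D) (L : Set (Matrix (Fin 3) (Fin 3) D)) :
    Set (Matrix (Fin n) (Fin n) ℝ) :=
  {F | ∃ Z ∈ L, ∀ x, A (F *ᵥ x) = Z * A x - A x * Z}

/-- The elements of `H_k` as a set of matrices. -/
def groupHMatrices (n : ℕ) : Set (Matrix (Fin n) (Fin n) ℝ) :=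
  {h | ∃ h' ∈ groupH n, (h' : Matrix (Fin n) (Fin n) ℝ) = h}

end

/-!
The cubic form makes `ℝⁿ` a commutative algebra with the product `x y = L_x y`, for which the
euclidean scalar product is associative. It is the trace-free part of a Jordan algebra of hermitian
`3 × 3` matrices, and all that matters about it is that `tr L_x = 0` and that `(x x) x = |x|² x`
(`CubicTensor.IsCartan`). These two properties follow, by `Frame.isCartan`, from a Peirce
decomposition `ℝⁿ = ℝ² ⊕ D ⊕ D ⊕ D` into the diagonal and the off-diagonal entries
(`CubicTensor.Frame`), where `D = ℝᵏ` carries the product `(a, b) ↦ (a b)*` and need not be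
associative; `realFrame`, `complexFrame`, `quaternionFrame` and `octonionFrame` are the four cases.

*Eigenspaces.* The endomorphism `Υ̂` takes `x ⊗ y` to `4 L_x L_y`. The linearized cubic identity
expresses `L_x L_y + L_y L_x` by `L_{xy}`, so that on symmetric tensors `Υ̂` is given by the trace
and the contraction `W ↦ ∑ W_{IJ} e_I e_J` (`hat_of_symm`), which yields the eigenspaces for
`4 + 2n`, `2 - n` and `4`: the multiples of `1`, the operators `L_x`, and the common kernel of trace and
contraction. On skew-symmetric tensors `Υ̂ + 8` takes values in the skew-symmetric derivations of
the algebra, because `4 [L_x, L_y] + 8 x ∧ y` is one (`hat_add_smul_mem`), and on the derivations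
`Υ̂` is `n + 2` (`hat_of_mem`). Hence the five eigenspaces span (`iSup_eigenspace`), and the traces
of `1`, of the transposition and of `Υ̂` give the dimensions (`finrank_eigenspace`). The derivations
form the Lie algebra of the stabilizer (`mem_skewDerivations_iff_exp`).

*Irreducibility.* An invariant subspace and its orthogonal complement in an eigenspace are both
invariant under the derivations (`OrthoSplit`). The derivations `Frame.G i a`, which rotate the
diagonal into an off-diagonal space, have the squared weights `1`, `0` and `1/4`, and this forces
certain weight vectors of the eigenspace to lie in one of the two summands, such as `symmWeight i a`
for the eigenvalue `4`, `G i a` for the derivations, `planeArea` for `-8`. On the other hand every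
vector is conjugate under the stabilizer to a diagonal one (`exists_conj_diagonal`, by maximizing a
scalar product over an orbit), and this is used to show that the other summand, being orthogonal to
the conjugates of these weight vectors, is zero (the lemmas `eq_bot_of_split_*`). This argument is
the same for the four algebras and uses no classification of representations.

*The stabilizers.* For `D = ℝ, ℂ, ℍ` the unitary matrices act by automorphisms (`MatrixModel.rho`).
They act with determinant one, by a maximality argument (`det_rho`). Conversely, an automorphism can
be composed with unitary conjugations until it fixes the diagonal, then the three off-diagonal
units; the three maps it induces on `D` are then equal and multiplicative (`eq_of_triality`), so
every automorphism of the cubic form is a unitary conjugation composed with an automorphism of `D`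
applied to the entries (`exists_rho_mul_eq_map`). The automorphism is trivial for `ℝ`, inner for
`ℍ`, and complex conjugation is excluded for `ℂ` by its determinant. The commutators with
antihermitian matrices are a nonzero invariant subspace of the derivations, hence everything
(`adRange_eq`).

*The equivalence for `n = 8`.* Both `x ↦ L_x` and `x ↦ [i A(x), ·]` are equivariant; their images
are `E_{-6}` and `E_{10}` (`nonempty_equiv_eight`).
-/

/-! ### Commutative algebras defined by a cubic form -/

namespace CubicTensor

variable {n : ℕ}

/-- The multiplication operator `L_x`, with entries `∑_K T_{IJK} x^K`. The product of `x` and `y` is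
`mulLeft T x *ᵥ y`. -/
def mulLeft (T : Fin n → Fin n → Fin n → ℝ) : (Fin n → ℝ) →ₗ[ℝ] Matrix (Fin n) (Fin n) ℝ where
  toFun x := Matrix.of fun I J => ∑ K, T I J K * x K
  map_add' x y := by ext; simp [mul_add, Finset.sum_add_distrib]
  map_smul' r x := by
    ext I J
    simp only [Matrix.of_apply, Pi.smul_apply, smul_eq_mul, Matrix.smul_apply, RingHom.id_apply,
      Finset.mul_sum]
    exact Finset.sum_congr rfl fun K _ => by ring

/-- The contraction `W ↦ ∑ W^{IJ} e_I e_J` of a two-tensor with the product of the algebra. -/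
def contract (T : Fin n → Fin n → Fin n → ℝ) :
    Matrix (Fin n) (Fin n) ℝ →ₗ[ℝ] (Fin n → ℝ) where
  toFun W := fun M => ∑ I, ∑ J, T I J M * W I J
  map_add' x y := by ext; simp [mul_add, Finset.sum_add_distrib]
  map_smul' r x := by
    ext I
    simp only [Pi.smul_apply, smul_eq_mul, Matrix.smul_apply, RingHom.id_apply, Finset.mul_sum]
    exact Finset.sum_congr rfl fun K _ => Finset.sum_congr rfl fun _ _ => by ring

/-- A totally symmetric tensor whose algebra has trace-free multiplication operators and satisfies
`(x x) x = |x|² x`. Such an algebra is the trace-free part of a Jordan algebra of degree three. -/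
structure IsCartan (T : Fin n → Fin n → Fin n → ℝ) : Prop where
  symm_left : ∀ I J K, T I J K = T J I K
  symm_right : ∀ I J K, T I J K = T I K J
  trace_mulLeft : ∀ x, (mulLeft T x).trace = 0
  cube : ∀ x, mulLeft T (mulLeft T x *ᵥ x) *ᵥ x = (x ⬝ᵥ x) • x

theorem linearMap_ext_vecMulVec {M : Type*} [AddCommMonoid M] [Module ℝ M]
    {f g : Matrix (Fin n) (Fin n) ℝ →ₗ[ℝ] M}
    (h : ∀ x y, f (Matrix.vecMulVec x y) = g (Matrix.vecMulVec x y)) : f = g := by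
  refine Matrix.ext_linearMap ℝ fun i j => ?_
  ext
  have := h (Pi.single i 1) (Pi.single j 1)
  simpa [← Matrix.single_eq_single_vecMulVec_single] using this

theorem matrix_ext_mulVec {A B : Matrix (Fin n) (Fin n) ℝ} (h : ∀ x, A *ᵥ x = B *ᵥ x) : A = B :=
  Matrix.toLin'.injective (LinearMap.ext fun x => by simpa using h x)

theorem span_range_vecMulVec (p : Submodule ℝ (Matrix (Fin n) (Fin n) ℝ))
    (h : ∀ x y, Matrix.vecMulVec x y ∈ p) : p = ⊤ := by
  rw [← p.ker_mkQ, LinearMap.ker_eq_top]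
  refine linearMap_ext_vecMulVec fun x y => ?_
  simpa using h x y

variable {T : Fin n → Fin n → Fin n → ℝ}

namespace IsCartan

variable (hT : IsCartan T)
include hT

theorem transpose_mulLeft (x : Fin n → ℝ) : (mulLeft T x)ᵀ = mulLeft T x := by
  ext I J
  simp [mulLeft, hT.symm_left I J]

theorem mulLeft_comm (x y : Fin n → ℝ) : mulLeft T x *ᵥ y = mulLeft T y *ᵥ x := by
  ext I
  simp only [mulLeft, Matrix.mulVec, dotProduct, LinearMap.coe_mk, AddHom.coe_mk, Matrix.of_apply,
    Finset.sum_mul]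
  rw [Finset.sum_comm]
  refine Finset.sum_congr rfl fun J _ => Finset.sum_congr rfl fun K _ => ?_
  rw [hT.symm_right]; ring

theorem mulLeft_dotProduct (x y z : Fin n → ℝ) :
    (mulLeft T x *ᵥ y) ⬝ᵥ z = y ⬝ᵥ (mulLeft T x *ᵥ z) := by
  rw [Matrix.dotProduct_mulVec, ← Matrix.mulVec_transpose, hT.transpose_mulLeft]

theorem cube_linearized (x y z : Fin n → ℝ) :
    mulLeft T x *ᵥ (mulLeft T y *ᵥ z) + mulLeft T y *ᵥ (mulLeft T z *ᵥ x)
      + mulLeft T z *ᵥ (mulLeft T x *ᵥ y) =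
      (y ⬝ᵥ z) • x + (z ⬝ᵥ x) • y + (x ⬝ᵥ y) • z := by
  have c := hT.mulLeft_comm
  have h7 := hT.cube (x + y + z)
  have h1 := hT.cube (x + y)
  have h2 := hT.cube (y + z)
  have h3 := hT.cube (x + z)
  have h4 := hT.cube x
  have h5 := hT.cube y
  have h6 := hT.cube z
  simp only [map_add, Matrix.add_mulVec, Matrix.mulVec_add, add_dotProduct, dotProduct_add, c y x,
    c z y, c z x, c (mulLeft T _ *ᵥ _) _, dotProduct_comm y x, dotProduct_comm z y,
    dotProduct_comm z x] at *
  linear_combination (norm := module) (1 / 2 : ℝ) • (h7 - h1 - h2 - h3 + h4 + h5 + h6)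

theorem mulLeft_anticomm (x y : Fin n → ℝ) :
    mulLeft T x * mulLeft T y + mulLeft T y * mulLeft T x + mulLeft T (mulLeft T x *ᵥ y) =
      (x ⬝ᵥ y) • 1 + Matrix.vecMulVec x y + Matrix.vecMulVec y x := by
  refine matrix_ext_mulVec fun z => ?_
  have h := hT.cube_linearized x y z
  have c := hT.mulLeft_comm
  rw [c z x, c z (mulLeft T x *ᵥ y)] at h
  simp only [Matrix.add_mulVec, ← Matrix.mulVec_mulVec, Matrix.smul_mulVec, Matrix.one_mulVec,
    Matrix.vecMulVec_mulVec, op_smul_eq_smul]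
  rw [dotProduct_comm x z]
  linear_combination (norm := module) h

theorem trace_mulLeft_mul (x y : Fin n → ℝ) :
    (mulLeft T x * mulLeft T y).trace = ((n + 2) / 2 : ℝ) * (x ⬝ᵥ y) := by
  have h := congrArg Matrix.trace (hT.mulLeft_anticomm x y)
  simp only [Matrix.trace_add, Matrix.trace_smul, Matrix.trace_one, Fintype.card_fin,
    Matrix.trace_vecMulVec, hT.trace_mulLeft, smul_eq_mul] at h
  rw [Matrix.trace_mul_comm (mulLeft T y), dotProduct_comm y x] at h
  linarith

end IsCartan

/-- The derivations of the algebra that are skew-symmetric for the Euclidean metric. -/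
def skewDerivations (T : Fin n → Fin n → Fin n → ℝ) : Submodule ℝ (Matrix (Fin n) (Fin n) ℝ) where
  carrier := {F | Fᵀ = -F ∧ ∀ x y,
    F *ᵥ (mulLeft T x *ᵥ y) = mulLeft T (F *ᵥ x) *ᵥ y + mulLeft T x *ᵥ (F *ᵥ y)}
  zero_mem' := by simp
  add_mem' := by
    rintro A B ⟨hA, hA'⟩ ⟨hB, hB'⟩
    refine ⟨by rw [Matrix.transpose_add, hA, hB]; abel, fun x y => ?_⟩
    simp only [Matrix.add_mulVec, map_add, Matrix.mulVec_add, hA', hB']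
    abel
  smul_mem' := by
    rintro r A ⟨hA, hA'⟩
    refine ⟨by rw [Matrix.transpose_smul, hA, smul_neg], fun x y => ?_⟩
    simp only [Matrix.smul_mulVec, map_smul, Matrix.mulVec_smul, hA', smul_add]

/-- The skew-symmetric tensor `x ∧ y = x yᵀ - y xᵀ`. -/
def wedge (x y : Fin n → ℝ) : Matrix (Fin n) (Fin n) ℝ :=
  Matrix.vecMulVec x y - Matrix.vecMulVec y x

/-- The operator `[L_x, L_y] + 2 x ∧ y`; it is the restriction to the trace-free elements of the
inner derivation `[L_x, L_y]` of a Jordan algebra. -/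
def innerDer (T : Fin n → Fin n → Fin n → ℝ) (x y : Fin n → ℝ) : Matrix (Fin n) (Fin n) ℝ :=
  mulLeft T x * mulLeft T y - mulLeft T y * mulLeft T x + (2 : ℝ) • wedge x y

theorem wedge_mulVec (x y z : Fin n → ℝ) : wedge x y *ᵥ z = (y ⬝ᵥ z) • x - (x ⬝ᵥ z) • y := by
  simp [wedge, Matrix.sub_mulVec, Matrix.vecMulVec_mulVec]

theorem transpose_wedge (x y : Fin n → ℝ) : (wedge x y)ᵀ = -wedge x y := by
  simp [wedge, Matrix.transpose_vecMulVec]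

theorem innerDer_mulVec (x y z : Fin n → ℝ) : innerDer T x y *ᵥ z =
    mulLeft T x *ᵥ (mulLeft T y *ᵥ z) - mulLeft T y *ᵥ (mulLeft T x *ᵥ z)
      + (2 : ℝ) • ((y ⬝ᵥ z) • x - (x ⬝ᵥ z) • y) := by
  simp [innerDer, Matrix.add_mulVec, Matrix.sub_mulVec, Matrix.smul_mulVec, wedge_mulVec]

theorem mulVec_dotProduct_of_skew {F : Matrix (Fin n) (Fin n) ℝ} (hF : Fᵀ = -F)
    (x y : Fin n → ℝ) : (F *ᵥ x) ⬝ᵥ y = -(x ⬝ᵥ (F *ᵥ y)) := by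
  rw [Matrix.dotProduct_mulVec, ← Matrix.mulVec_transpose, hF, Matrix.neg_mulVec, neg_dotProduct,
    neg_neg]

theorem mulLeft_mul_vecMulVec (a v w : Fin n → ℝ) :
    mulLeft T a * Matrix.vecMulVec v w = Matrix.vecMulVec (mulLeft T a *ᵥ v) w :=
  Matrix.mul_vecMulVec _ _ _

theorem commutator_of_mem {F : Matrix (Fin n) (Fin n) ℝ} (hF : F ∈ skewDerivations T)
    (x : Fin n → ℝ) : F * mulLeft T x - mulLeft T x * F = mulLeft T (F *ᵥ x) := by
  refine matrix_ext_mulVec fun y => ?_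
  rw [Matrix.sub_mulVec, ← Matrix.mulVec_mulVec, ← Matrix.mulVec_mulVec, hF.2, add_sub_cancel_right]

theorem eq_sum_single (x : Fin n → ℝ) : x = ∑ K, x K • (Pi.single K 1 : Fin n → ℝ) := by
  ext I
  simp [Finset.sum_apply, Pi.single_apply]

/-- Transposition as a linear map. -/
def transposeMap (n : ℕ) : Module.End ℝ (Matrix (Fin n) (Fin n) ℝ) where
  toFun W := Wᵀ
  map_add' := Matrix.transpose_add
  map_smul' := Matrix.transpose_smul

@[simp]
theorem transposeMap_apply (W : Matrix (Fin n) (Fin n) ℝ) : transposeMap n W = Wᵀ := rfl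

namespace IsCartan

variable (hT : IsCartan T)
include hT

theorem vecMulVec_mul_mulLeft (a v w : Fin n → ℝ) :
    Matrix.vecMulVec v w * mulLeft T a = Matrix.vecMulVec v (mulLeft T a *ᵥ w) := by
  rw [Matrix.vecMulVec_mul, ← Matrix.mulVec_transpose, hT.transpose_mulLeft]

/-- The derivation property in operator form. It follows from the expression of `L_{yz}` by the
anticommutator of `L_y` and `L_z` and from `[[a, b], c] = {a, {b, c}} - {b, {a, c}}`. -/
theorem innerDer_commutator (x y z : Fin n → ℝ) :
    innerDer T x y * mulLeft T z - mulLeft T z * innerDer T x y =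
      mulLeft T (innerDer T x y *ᵥ z) := by
  have h : ∀ a b, mulLeft T (mulLeft T a *ᵥ b) = (a ⬝ᵥ b) • 1 + Matrix.vecMulVec a b
      + Matrix.vecMulVec b a - (mulLeft T a * mulLeft T b + mulLeft T b * mulLeft T a) :=
    fun a b => eq_sub_iff_add_eq'.2 (hT.mulLeft_anticomm a b)
  have e : x ⬝ᵥ (mulLeft T y *ᵥ z) = y ⬝ᵥ (mulLeft T x *ᵥ z) := by
    rw [← hT.mulLeft_dotProduct, ← hT.mulLeft_dotProduct, hT.mulLeft_comm]
  rw [innerDer_mulVec]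
  simp only [map_add, map_sub, map_smul]
  rw [h x (mulLeft T y *ᵥ z), h y (mulLeft T x *ᵥ z), h y z, h x z, e]
  simp only [innerDer, wedge, mul_add, mul_sub, add_mul, sub_mul, mul_smul_comm, smul_mul_assoc,
    mulLeft_mul_vecMulVec, hT.vecMulVec_mul_mulLeft, mul_one, one_mul, ← mul_assoc]
  rw [hT.mulLeft_comm y x, hT.mulLeft_comm z x, hT.mulLeft_comm z y]
  module

/-- The operators `[L_x, L_y] + 2 x ∧ y` are derivations. -/
theorem innerDer_mem (x y : Fin n → ℝ) : innerDer T x y ∈ skewDerivations T := by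
  refine ⟨?_, fun z w => ?_⟩
  · rw [innerDer, Matrix.transpose_add, Matrix.transpose_sub, Matrix.transpose_mul,
      Matrix.transpose_mul, Matrix.transpose_smul, transpose_wedge, hT.transpose_mulLeft,
      hT.transpose_mulLeft]
    module
  · have h := congrArg (· *ᵥ w) (hT.innerDer_commutator x y z)
    simp only [Matrix.sub_mulVec, ← Matrix.mulVec_mulVec] at h
    rw [← h, sub_add_cancel]

/-! ### The endomorphism defined by the tensor -/

theorem hat_vecMulVec (x y : Fin n → ℝ) :
    hatEndomorphism T (Matrix.vecMulVec x y) = (4 : ℝ) • (mulLeft T x * mulLeft T y) := by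
  ext I K
  simp only [hatEndomorphism, LinearMap.coe_mk, AddHom.coe_mk, Matrix.of_apply, Matrix.smul_apply,
    Matrix.mul_apply, smul_eq_mul, mulLeft, Matrix.vecMulVec_apply, Finset.sum_mul, Finset.mul_sum]
  rw [Finset.sum_comm_cycle]
  refine Finset.sum_congr rfl fun M _ => ?_
  rw [Finset.sum_comm]
  refine Finset.sum_congr rfl fun J _ => Finset.sum_congr rfl fun L _ => ?_
  rw [hT.symm_right I M, hT.symm_left M K, hT.symm_right K M]
  ring

theorem contract_vecMulVec (x y : Fin n → ℝ) :
    contract T (Matrix.vecMulVec x y) = mulLeft T x *ᵥ y := by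
  ext M
  simp only [contract, mulLeft, LinearMap.coe_mk, AddHom.coe_mk, Matrix.mulVec, dotProduct,
    Matrix.of_apply, Matrix.vecMulVec_apply, Finset.sum_mul]
  rw [Finset.sum_comm]
  refine Finset.sum_congr rfl fun J _ => Finset.sum_congr rfl fun L _ => ?_
  rw [hT.symm_right M J, hT.symm_left M L, hT.symm_right L M]
  ring

theorem hat_add_hat_transpose (W : Matrix (Fin n) (Fin n) ℝ) :
    hatEndomorphism T W + hatEndomorphism T Wᵀ =
      (4 * W.trace) • 1 + (4 : ℝ) • (W + Wᵀ) - (4 : ℝ) • mulLeft T (contract T W) := by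
  have := linearMap_ext_vecMulVec
    (f := hatEndomorphism T + (hatEndomorphism T).comp (transposeMap n))
    (g := ((4 : ℝ) • Matrix.traceLinearMap (Fin n) ℝ ℝ).smulRight 1
      + (4 : ℝ) • (LinearMap.id + transposeMap n)
      - (4 : ℝ) • (mulLeft T).comp (contract T)) fun x y => by
    have h := hT.mulLeft_anticomm x y
    simp only [transposeMap_apply, LinearMap.add_apply, LinearMap.sub_apply, LinearMap.comp_apply,
      LinearMap.smul_apply, LinearMap.smulRight_apply, Matrix.traceLinearMap_apply,
      Matrix.transpose_vecMulVec,
      hT.hat_vecMulVec, hT.contract_vecMulVec, Matrix.trace_vecMulVec, LinearMap.id_apply,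
      smul_eq_mul]
    linear_combination (norm := module) (4 : ℝ) • h
  simpa using LinearMap.congr_fun this W

/-- On symmetric tensors the endomorphism is expressed by the trace and the contraction. -/
theorem hat_of_symm {W : Matrix (Fin n) (Fin n) ℝ} (hW : Wᵀ = W) :
    hatEndomorphism T W =
      (2 * W.trace) • 1 + (4 : ℝ) • W - (2 : ℝ) • mulLeft T (contract T W) := by
  have h := hT.hat_add_hat_transpose W
  rw [hW] at h
  linear_combination (norm := module) (1 / 2 : ℝ) • h

theorem hat_wedge (x y : Fin n → ℝ) :
    hatEndomorphism T (wedge x y) = (4 : ℝ) • innerDer T x y - (8 : ℝ) • wedge x y := by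
  rw [wedge, map_sub, hT.hat_vecMulVec, hT.hat_vecMulVec, innerDer, wedge]
  module

/-- On skew-symmetric tensors `Υ̂ + 8` takes values in the derivations. -/
theorem hat_add_smul_mem {W : Matrix (Fin n) (Fin n) ℝ} (hW : Wᵀ = -W) :
    hatEndomorphism T W + (8 : ℝ) • W ∈ skewDerivations T := by
  let f := (hatEndomorphism T + (8 : ℝ) • LinearMap.id).comp (LinearMap.id - transposeMap n)
  have h := span_range_vecMulVec ((skewDerivations T).comap f) fun x y => by
    have := (skewDerivations T).smul_mem 4 (hT.innerDer_mem x y)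
    rw [Submodule.mem_comap]
    convert! this using 1
    have := hT.hat_wedge x y
    rw [wedge] at this
    simp only [f, transposeMap_apply, LinearMap.comp_apply, LinearMap.sub_apply, LinearMap.id_apply,
      Matrix.transpose_vecMulVec,
      LinearMap.add_apply, LinearMap.smul_apply]
    rw [this]
    module
  have hm : W ∈ (skewDerivations T).comap f := h ▸ Submodule.mem_top
  have := (skewDerivations T).smul_mem (1 / 2) (Submodule.mem_comap.1 hm)
  convert! this using 1
  simp only [f, transposeMap_apply, LinearMap.comp_apply, LinearMap.sub_apply, LinearMap.id_apply,
      hW, sub_neg_eq_add,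
      LinearMap.add_apply, LinearMap.smul_apply, map_add]
  module

theorem sum_mulLeft_sq :
    ∑ M, mulLeft T (Pi.single M 1) * mulLeft T (Pi.single M 1) = ((n + 2) / 2 : ℝ) • 1 := by
  ext I K
  have h := hT.trace_mulLeft_mul (Pi.single I 1) (Pi.single K 1)
  have e : ((Pi.single I 1 : Fin n → ℝ) ⬝ᵥ Pi.single K 1) = (1 : Matrix (Fin n) (Fin n) ℝ) I K := by
    simp [Matrix.one_apply, Pi.single_apply, eq_comm]
  rw [e] at h
  rw [Matrix.smul_apply, smul_eq_mul, ← h]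
  simp only [Matrix.sum_apply, Matrix.mul_apply, Matrix.trace, Matrix.diag_apply, mulLeft,
    LinearMap.coe_mk, AddHom.coe_mk, Matrix.of_apply]
  simp only [Pi.single_apply, mul_ite, mul_one, mul_zero, Finset.sum_ite_eq', Finset.mem_univ,
    if_true]
  refine Finset.sum_congr rfl fun M _ => Finset.sum_congr rfl fun J _ => ?_
  rw [hT.symm_right I J M, hT.symm_left I M J, hT.symm_right M I J, hT.symm_right J K M]

theorem hat_eq_sum (W : Matrix (Fin n) (Fin n) ℝ) : hatEndomorphism T W =
    (4 : ℝ) • ∑ K, ∑ M, W K M • (mulLeft T (Pi.single K 1) * mulLeft T (Pi.single M 1)) := by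
  have e : W = ∑ K, ∑ M, W K M • Matrix.vecMulVec (Pi.single K (1 : ℝ)) (Pi.single M 1) := by
    conv_lhs => rw [Matrix.matrix_eq_sum_single W]
    refine Finset.sum_congr rfl fun K _ => Finset.sum_congr rfl fun M _ => ?_
    rw [← Matrix.single_eq_single_vecMulVec_single, Matrix.smul_single, smul_eq_mul, mul_one]
  conv_lhs => rw [e]
  simp only [map_sum, map_smul, hT.hat_vecMulVec, Finset.smul_sum]
  refine Finset.sum_congr rfl fun K _ => Finset.sum_congr rfl fun M _ => smul_comm _ _ _

/-- The derivations are eigenvectors for the eigenvalue `n + 2`. -/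
theorem hat_of_mem {F : Matrix (Fin n) (Fin n) ℝ} (hF : F ∈ skewDerivations T) :
    hatEndomorphism T F = (n + 2 : ℝ) • F := by
  set S : Fin n → Matrix (Fin n) (Fin n) ℝ := fun M => mulLeft T (Pi.single M 1) with hS
  have h1 : hatEndomorphism T F = (4 : ℝ) • ∑ M, S M * F * S M := by
    rw [hatEndomorphism_eq_sum]
    have : ∀ M, (Matrix.of fun I J => T I J M) = S M := by
      intro M
      ext I J
      simp [hS, mulLeft, Pi.single_apply]
    simp only [this]
    congr 1
    refine Finset.sum_congr rfl fun M _ => ?_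
    rw [hT.transpose_mulLeft]
  have h2 : ∀ M, S M * F * S M = F * (S M * S M) - mulLeft T (F *ᵥ Pi.single M 1) * S M := by
    intro M
    rw [← commutator_of_mem hF]
    noncomm_ring
  have h3 : ∑ M, mulLeft T (F *ᵥ Pi.single M 1) * S M = (1 / 4 : ℝ) • hatEndomorphism T F := by
    rw [hT.hat_eq_sum, smul_smul, Finset.sum_comm]
    rw [show (1 / 4 * 4 : ℝ) = 1 by norm_num, one_smul]
    refine Finset.sum_congr rfl fun M _ => ?_
    rw [eq_sum_single (F *ᵥ Pi.single M 1), map_sum, Finset.sum_mul]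
    refine Finset.sum_congr rfl fun K _ => ?_
    rw [map_smul, smul_mul_assoc]
    simp [hS]
  have h4 : hatEndomorphism T F = (4 : ℝ) • (((n + 2) / 2 : ℝ) • F)
      - hatEndomorphism T F := by
    conv_lhs => rw [h1]
    rw [Finset.sum_congr rfl fun M _ => h2 M, Finset.sum_sub_distrib, h3, ← Finset.mul_sum,
      hT.sum_mulLeft_sq]
    rw [mul_smul_comm, mul_one]
    module
  linear_combination (norm := module) (1 / 2 : ℝ) • h4

end IsCartan

end CubicTensor

/-! ### The eigenspaces -/

namespace CubicTensor

variable {n : ℕ} {T : Fin n → Fin n → Fin n → ℝ}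

theorem hat_transpose (W : Matrix (Fin n) (Fin n) ℝ) :
    hatEndomorphism T Wᵀ = (hatEndomorphism T W)ᵀ := by
  simp only [hatEndomorphism_eq_sum, Matrix.transpose_smul, Matrix.transpose_sum,
    Matrix.transpose_mul, Matrix.transpose_transpose, mul_assoc]

/-- The five eigenvalues, as functions of the dimension. -/
def eigenvalue (n : ℕ) : Fin 5 → ℝ := ![4 + 2 * n, n + 2, 2 - n, -8, 4]

theorem eigenvalue_injective (hn : 3 ≤ n) (h10 : n ≠ 10) :
    Function.Injective (eigenvalue n) := by
  have hn' : (3 : ℝ) ≤ n := by exact_mod_cast hn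
  have h10' : (n : ℝ) ≠ 10 := by exact_mod_cast h10
  intro i j h
  by_contra hij
  apply h10'
  fin_cases i <;> fin_cases j <;> first | exact absurd rfl hij | (simp [eigenvalue] at h; linarith)

theorem trace_eq_sum (f : Module.End ℝ (Matrix (Fin n) (Fin n) ℝ)) :
    LinearMap.trace ℝ _ f = ∑ I, ∑ J, f (Matrix.single I J 1) I J := by
  rw [LinearMap.trace_eq_matrix_trace ℝ (Matrix.stdBasis ℝ (Fin n) (Fin n)), Matrix.trace,
    Fintype.sum_prod_type]
  refine Finset.sum_congr rfl fun I _ => Finset.sum_congr rfl fun J _ => ?_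
  rw [Matrix.diag_apply, LinearMap.toMatrix_apply, Matrix.stdBasis_eq_single]
  rfl

theorem trace_transposeMap : LinearMap.trace ℝ _ (transposeMap n) = n := by
  rw [trace_eq_sum]
  have : ∀ I J : Fin n,
      transposeMap n (Matrix.single I J 1) I J = if I = J then (1 : ℝ) else 0 := by
    intro I J
    rw [transposeMap_apply, Matrix.transpose_apply, Matrix.single_apply]
    by_cases h : I = J <;> simp [h]
  simp [this]

namespace IsCartan

variable (hT : IsCartan T)
include hT

theorem contract_one : contract T 1 = 0 := by
  ext M
  have h := hT.trace_mulLeft (Pi.single M 1)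
  simp only [Matrix.trace, Matrix.diag_apply, mulLeft, LinearMap.coe_mk, AddHom.coe_mk,
    Matrix.of_apply, Pi.single_apply, mul_ite, mul_one, mul_zero, Finset.sum_ite_eq',
    Finset.mem_univ, if_true] at h
  simpa [contract, Matrix.one_apply] using h

theorem contract_dotProduct (W : Matrix (Fin n) (Fin n) ℝ) (z : Fin n → ℝ) :
    contract T W ⬝ᵥ z = (W * mulLeft T z).trace := by
  have := linearMap_ext_vecMulVec (f := (dotProductBilin ℝ ℝ).flip z ∘ₗ contract T)
    (g := Matrix.traceLinearMap (Fin n) ℝ ℝ ∘ₗ LinearMap.mulRight ℝ (mulLeft T z)) fun x y => by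
    simp only [LinearMap.comp_apply, hT.contract_vecMulVec, LinearMap.mulRight_apply,
      Matrix.traceLinearMap_apply, hT.vecMulVec_mul_mulLeft, Matrix.trace_vecMulVec,
      LinearMap.flip_apply, dotProductBilin_apply_apply]
    rw [dotProduct_comm, hT.mulLeft_comm z y, ← hT.mulLeft_dotProduct, hT.mulLeft_comm,
      dotProduct_comm, hT.mulLeft_comm y z, ← hT.mulLeft_dotProduct, dotProduct_comm]
  simpa using LinearMap.congr_fun this W

theorem contract_mulLeft (x : Fin n → ℝ) : contract T (mulLeft T x) = ((n + 2) / 2 : ℝ) • x := by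
  refine dotProduct_eq _ _ fun z => ?_
  rw [hT.contract_dotProduct, hT.trace_mulLeft_mul, smul_dotProduct, smul_eq_mul]

theorem mulLeft_injective : Function.Injective (mulLeft T) := by
  intro x y h
  have := congrArg (contract T) h
  rw [hT.contract_mulLeft, hT.contract_mulLeft] at this
  exact smul_right_injective _ (by positivity : ((n + 2) / 2 : ℝ) ≠ 0) this

theorem hat_one : hatEndomorphism T 1 = (4 + 2 * n : ℝ) • 1 := by
  rw [hT.hat_of_symm Matrix.transpose_one, hT.contract_one, map_zero, Matrix.trace_one,
    Fintype.card_fin]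
  module

theorem hat_mulLeft (x : Fin n → ℝ) :
    hatEndomorphism T (mulLeft T x) = (2 - n : ℝ) • mulLeft T x := by
  rw [hT.hat_of_symm (hT.transpose_mulLeft x), hT.trace_mulLeft, hT.contract_mulLeft, map_smul]
  module

theorem transpose_of_hat_eq {μ : ℝ} {W : Matrix (Fin n) (Fin n) ℝ}
    (hW : hatEndomorphism T W = μ • W) (h1 : μ ≠ n + 2) (h2 : μ ≠ -8) : Wᵀ = W := by
  have hA : (W - Wᵀ)ᵀ = -(W - Wᵀ) := by simp
  have h := hT.hat_of_mem (hT.hat_add_smul_mem hA)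
  have h3 : hatEndomorphism T (W - Wᵀ) = μ • (W - Wᵀ) := by
    rw [map_sub, hat_transpose, hW, Matrix.transpose_smul, smul_sub]
  rw [h3, ← add_smul, map_smul, h3, smul_smul, smul_smul, ← sub_eq_zero, ← sub_smul] at h
  have h4 : (μ + 8) * μ - (n + 2) * (μ + 8) ≠ 0 := by
    rw [show (μ + 8) * μ - (n + 2) * (μ + 8) = (μ - (n + 2)) * (μ - -8) by ring]
    exact mul_ne_zero (sub_ne_zero.2 h1) (sub_ne_zero.2 h2)
  exact (sub_eq_zero.1 ((smul_eq_zero.1 h).resolve_left h4)).symm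

/-- The space spanned by the metric and the multiplication operators contains the image of
`Υ̂ - 4` on symmetric tensors; this lists the eigenvectors that it contains. -/
theorem eq_zero_of_smul_one_add_mulLeft {μ c : ℝ} {y : Fin n → ℝ}
    (h : hatEndomorphism T (c • 1 + mulLeft T y) = μ • (c • 1 + mulLeft T y)) :
    (μ = 4 + 2 * n ∨ c • (1 : Matrix (Fin n) (Fin n) ℝ) = 0) ∧ (μ = 2 - n ∨ y = 0) := by
  rw [map_add, map_smul, hT.hat_one, hT.hat_mulLeft] at h
  have h1 := congrArg Matrix.trace h
  have h2 := congrArg (contract T) h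
  simp only [Matrix.trace_add, Matrix.trace_smul, hT.trace_mulLeft, Matrix.trace_one,
    Fintype.card_fin, smul_eq_mul, mul_zero, add_zero] at h1
  simp only [map_add, map_smul, hT.contract_one, hT.contract_mulLeft, smul_zero, zero_add] at h2
  constructor
  · rcases Nat.eq_zero_or_pos n with rfl | hn
    · right; ext i; exact i.elim0
    · have hn' : (n : ℝ) ≠ 0 := by positivity
      have : (μ - (4 + 2 * n)) * c * n = 0 := by linear_combination -h1
      rcases mul_eq_zero.1 ((mul_eq_zero.1 this).resolve_right hn') with h | h
      · left; linarith
      · right; rw [h, zero_smul]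
  · have : ((μ - (2 - n)) * ((n + 2) / 2 : ℝ)) • y = 0 := by
      linear_combination (norm := module) -(1 : ℝ) • h2
    rcases smul_eq_zero.1 this with h | h
    · left
      have := (mul_eq_zero.1 h).resolve_right (by positivity)
      linarith
    · right; exact h

theorem transpose_eq_neg_of_hat_eq {μ : ℝ} {W : Matrix (Fin n) (Fin n) ℝ}
    (hW : hatEndomorphism T W = μ • W) (h1 : μ ≠ 4 + 2 * n) (h2 : μ ≠ 2 - n) (h3 : μ ≠ 4) :
    Wᵀ = -W := by
  have hA : (W + Wᵀ)ᵀ = W + Wᵀ := by simp [add_comm]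
  have h := hT.hat_of_symm hA
  have h4 : hatEndomorphism T (W + Wᵀ) = μ • (W + Wᵀ) := by
    rw [map_add, hat_transpose, hW, Matrix.transpose_smul, smul_add]
  set S := W + Wᵀ
  have h5 : (2 * S.trace) • (1 : Matrix (Fin n) (Fin n) ℝ) + mulLeft T ((-2 : ℝ) • contract T S) =
      (μ - 4) • S := by
    rw [map_smul]
    linear_combination (norm := module) h4 - h
  have h6 := hT.eq_zero_of_smul_one_add_mulLeft (μ := μ) (c := 2 * S.trace)
    (y := (-2 : ℝ) • contract T S) (by rw [h5, map_smul, h4, smul_comm])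
  rw [h6.1.resolve_left h1, h6.2.resolve_left h2, map_zero, add_zero] at h5
  have h7 := (smul_eq_zero.1 h5.symm).resolve_left (sub_ne_zero.2 h3)
  exact (neg_eq_of_add_eq_zero_right h7).symm

theorem eigenspace_scalar (hn : 3 ≤ n) :
    (hatEndomorphism T).eigenspace (4 + 2 * n) = Submodule.span ℝ {1} := by
  have hn' : (3 : ℝ) ≤ n := by exact_mod_cast hn
  ext W
  rw [Module.End.mem_eigenspace_iff, Submodule.mem_span_singleton]
  constructor
  · intro hW
    have hs := hT.transpose_of_hat_eq hW (by linarith) (by linarith)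
    have h := hT.hat_of_symm hs
    have h5 : (2 * W.trace) • (1 : Matrix (Fin n) (Fin n) ℝ) + mulLeft T ((-2 : ℝ) • contract T W) =
        (2 * n : ℝ) • W := by
      rw [map_smul]
      linear_combination (norm := module) hW - h
    have h6 := hT.eq_zero_of_smul_one_add_mulLeft (μ := 4 + 2 * n) (c := 2 * W.trace)
      (y := (-2 : ℝ) • contract T W) (by rw [h5, map_smul, hW, smul_comm])
    rw [h6.2.resolve_left (by linarith), map_zero, add_zero] at h5
    refine ⟨(2 * n : ℝ)⁻¹ * (2 * W.trace), ?_⟩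
    rw [← smul_smul, h5, smul_smul, inv_mul_cancel₀ (by positivity), one_smul]
  · rintro ⟨a, rfl⟩
    rw [map_smul, hT.hat_one, smul_comm]

theorem eigenspace_mulLeft (hn : 3 ≤ n) (h10 : n ≠ 10) :
    (hatEndomorphism T).eigenspace (2 - n) = LinearMap.range (mulLeft T) := by
  have hn' : (3 : ℝ) ≤ n := by exact_mod_cast hn
  have h10' : (n : ℝ) ≠ 10 := by exact_mod_cast h10
  ext W
  rw [Module.End.mem_eigenspace_iff, LinearMap.mem_range]
  constructor
  · intro hW
    have hs := hT.transpose_of_hat_eq hW (by linarith) (fun h => h10' (by linarith))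
    have h := hT.hat_of_symm hs
    have h5 : (2 * W.trace) • (1 : Matrix (Fin n) (Fin n) ℝ) + mulLeft T ((-2 : ℝ) • contract T W) =
        (-(n + 2) : ℝ) • W := by
      rw [map_smul]
      linear_combination (norm := module) hW - h
    have h6 := hT.eq_zero_of_smul_one_add_mulLeft (μ := 2 - n) (c := 2 * W.trace)
      (y := (-2 : ℝ) • contract T W) (by rw [h5, map_smul, hW, smul_comm])
    rw [h6.1.resolve_left (by linarith), zero_add] at h5
    refine ⟨(-(n + 2) : ℝ)⁻¹ • (-2 : ℝ) • contract T W, ?_⟩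
    rw [map_smul, h5, smul_smul, inv_mul_cancel₀ (by linarith), one_smul]
  · rintro ⟨a, rfl⟩
    exact hT.hat_mulLeft a

theorem eigenspace_skewDerivations (hn : 3 ≤ n) :
    (hatEndomorphism T).eigenspace (n + 2) = skewDerivations T := by
  have hn' : (3 : ℝ) ≤ n := by exact_mod_cast hn
  ext W
  rw [Module.End.mem_eigenspace_iff]
  refine ⟨fun hW => ?_, hT.hat_of_mem⟩
  have hs := hT.transpose_eq_neg_of_hat_eq hW (by linarith) (by linarith) (by linarith)
  have h := hT.hat_add_smul_mem hs
  rw [hW, ← add_smul] at h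
  have := (skewDerivations T).smul_mem ((n + 2 + 8 : ℝ)⁻¹) h
  rwa [smul_smul, inv_mul_cancel₀ (by positivity), one_smul] at this

theorem mem_eigenspace_four (hn : 3 ≤ n) {W : Matrix (Fin n) (Fin n) ℝ} :
    W ∈ (hatEndomorphism T).eigenspace 4 ↔ Wᵀ = W ∧ W.trace = 0 ∧ contract T W = 0 := by
  have hn' : (3 : ℝ) ≤ n := by exact_mod_cast hn
  rw [Module.End.mem_eigenspace_iff]
  constructor
  · intro hW
    have hs := hT.transpose_of_hat_eq hW (by linarith) (by linarith)
    have h := hT.hat_of_symm hs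
    rw [hW] at h
    have h1 : (2 * W.trace) • (1 : Matrix (Fin n) (Fin n) ℝ) =
        (2 : ℝ) • mulLeft T (contract T W) := by
      linear_combination (norm := module) -(1 : ℝ) • h
    have h2 := congrArg Matrix.trace h1
    simp only [Matrix.trace_smul, hT.trace_mulLeft, Matrix.trace_one, Fintype.card_fin,
      smul_eq_mul, mul_zero] at h2
    have h3 : W.trace = 0 := by
      have := (mul_eq_zero.1 h2).resolve_right (by positivity)
      linarith
    refine ⟨hs, h3, hT.mulLeft_injective ?_⟩
    rw [h3, mul_zero, zero_smul] at h1
    rw [map_zero]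
    exact (smul_eq_zero.1 h1.symm).resolve_left two_ne_zero
  · rintro ⟨hs, h1, h2⟩
    rw [hT.hat_of_symm hs, h1, h2, map_zero]
    module

theorem iSup_eigenspace (hn : 3 ≤ n) :
    ⨆ i, (hatEndomorphism T).eigenspace (eigenvalue n i) = ⊤ := by
  have hle := le_iSup (fun i => (hatEndomorphism T).eigenspace (eigenvalue n i))
  have hn' : (3 : ℝ) ≤ n := by exact_mod_cast hn
  set p := ⨆ i, (hatEndomorphism T).eigenspace (eigenvalue n i)
  have m0 : (1 : Matrix (Fin n) (Fin n) ℝ) ∈ p :=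
    hle 0 (Module.End.mem_eigenspace_iff.2 hT.hat_one)
  have m1 : ∀ F ∈ skewDerivations T, F ∈ p := fun F hF =>
    hle 1 (Module.End.mem_eigenspace_iff.2 (hT.hat_of_mem hF))
  have m2 : ∀ x, mulLeft T x ∈ p := fun x =>
    hle 2 (Module.End.mem_eigenspace_iff.2 (hT.hat_mulLeft x))
  refine eq_top_iff.2 fun W _ => ?_
  have skew : ∀ W : Matrix (Fin n) (Fin n) ℝ, Wᵀ = -W → W ∈ p := by
    intro W hW
    have hY := hT.hat_add_smul_mem hW
    set Y := hatEndomorphism T W + (8 : ℝ) • W with hYdef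
    clear_value Y
    have h3 : W - (n + 10 : ℝ)⁻¹ • Y ∈ p := hle 3 (Module.End.mem_eigenspace_iff.2 (by
      change _ = (-8 : ℝ) • _
      have hY2 := hT.hat_of_mem hY
      have e : hatEndomorphism T W = Y - (8 : ℝ) • W := by rw [hYdef]; abel
      rw [map_sub, map_smul, hY2, e]
      have : (n + 10 : ℝ) ≠ 0 := by positivity
      match_scalars <;> field_simp; ring))
    have := p.add_mem h3 (p.smul_mem (n + 10 : ℝ)⁻¹ (m1 Y hY))
    rwa [sub_add_cancel] at this
  have symm : ∀ W : Matrix (Fin n) (Fin n) ℝ, Wᵀ = W → W ∈ p := by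
    intro W hW
    -- subtract the multiples of the metric and of `L_x` that carry the trace and the contraction
    have h4 : W - (W.trace / n) • 1 - mulLeft T ((2 / (n + 2) : ℝ) • contract T W) ∈ p :=
      hle 4 ((hT.mem_eigenspace_four hn).2 (by
        refine ⟨?_, ?_, ?_⟩
        · simp only [Matrix.transpose_sub, Matrix.transpose_smul, Matrix.transpose_one, hW,
            hT.transpose_mulLeft]
        · simp only [Matrix.trace_sub, Matrix.trace_smul, Matrix.trace_one, hT.trace_mulLeft,
            Fintype.card_fin, smul_eq_mul]
          field_simp
          ring
        · simp only [map_sub, map_smul, hT.contract_one, hT.contract_mulLeft, smul_smul]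
          rw [show (2 / (n + 2) * ((n + 2) / 2) : ℝ) = 1 by field_simp]
          module))
    have := p.add_mem (p.add_mem h4 (m2 ((2 / (n + 2) : ℝ) • contract T W)))
      (p.smul_mem (W.trace / n) m0)
    rwa [sub_add_cancel, sub_add_cancel] at this
  have h1 := p.smul_mem (1 / 2) (symm (W + Wᵀ) (by simp [add_comm]))
  have h2 := p.smul_mem (1 / 2) (skew (W - Wᵀ) (by simp))
  convert! p.add_mem h1 h2 using 1
  module

theorem isInternal (hn : 3 ≤ n) (h10 : n ≠ 10) :
    DirectSum.IsInternal fun i => (hatEndomorphism T).eigenspace (eigenvalue n i) := by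
  rw [DirectSum.isInternal_submodule_iff_iSupIndep_and_iSup_eq_top]
  exact ⟨(Module.End.eigenspaces_iSupIndep _).comp (eigenvalue_injective hn h10),
    hT.iSup_eigenspace hn⟩

/-- The trace of `Υ̂` is `4 ∑_M (tr L_M)²`. -/
theorem trace_hat : LinearMap.trace ℝ _ (hatEndomorphism T) = 0 := by
  rw [trace_eq_sum]
  have h : ∀ I J : Fin n, hatEndomorphism T (Matrix.single I J 1) I J =
      4 * ∑ M, T I I M * T J J M := by
    intro I J
    rw [Matrix.single_eq_single_vecMulVec_single, hT.hat_vecMulVec, Matrix.smul_apply, smul_eq_mul,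
      Matrix.mul_apply]
    congr 1
    refine Finset.sum_congr rfl fun M _ => ?_
    simp only [mulLeft, LinearMap.coe_mk, AddHom.coe_mk, Matrix.of_apply, Pi.single_apply, mul_ite,
      mul_one, mul_zero, Finset.sum_ite_eq', Finset.mem_univ, if_true]
    rw [hT.symm_right I M, hT.symm_left M J, hT.symm_right J M]
  have h2 : ∀ M, ∑ I, T I I M = 0 := by
    intro M
    have := hT.trace_mulLeft (Pi.single M 1)
    simpa [Matrix.trace, mulLeft, Pi.single_apply] using this
  simp only [h, ← Finset.mul_sum]
  have : ∑ I, ∑ J, ∑ M, T I I M * T J J M = ∑ M, (∑ I, T I I M) * ∑ J, T J J M := by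
    simp only [Finset.sum_mul_sum]
    rw [Finset.sum_comm_cycle]
  rw [this]
  simp [h2]

theorem trace_eq_of_scalar (hn : 3 ≤ n) (h10 : n ≠ 10)
    (f : Module.End ℝ (Matrix (Fin n) (Fin n) ℝ)) (c : Fin 5 → ℝ)
    (hf : ∀ i, ∀ W ∈ (hatEndomorphism T).eigenspace (eigenvalue n i), f W = c i • W) :
    LinearMap.trace ℝ _ f =
      ∑ i, c i * Module.finrank ℝ ((hatEndomorphism T).eigenspace (eigenvalue n i)) := by
  have hm : ∀ i, Set.MapsTo f ((hatEndomorphism T).eigenspace (eigenvalue n i))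
      ((hatEndomorphism T).eigenspace (eigenvalue n i)) := by
    intro i W hW
    rw [hf i W hW]
    exact Submodule.smul_mem _ _ hW
  rw [LinearMap.trace_eq_sum_trace_restrict (hT.isInternal hn h10) hm]
  refine Finset.sum_congr rfl fun i _ => ?_
  have : f.restrict (hm i) = c i • LinearMap.id := by
    ext1 W
    exact Subtype.ext (hf i W.1 W.2)
  rw [this, map_smul, LinearMap.trace_id, smul_eq_mul]

theorem transpose_of_mem (hn : 3 ≤ n) (h10 : n ≠ 10) (i : Fin 5) (W : Matrix (Fin n) (Fin n) ℝ)
    (hW : W ∈ (hatEndomorphism T).eigenspace (eigenvalue n i)) :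
    Wᵀ = (![1, -1, 1, -1, 1] i : ℝ) • W := by
  have hn' : (3 : ℝ) ≤ n := by exact_mod_cast hn
  have h10' : (n : ℝ) ≠ 10 := by exact_mod_cast h10
  rw [Module.End.mem_eigenspace_iff] at hW
  fin_cases i
  · simpa using hT.transpose_of_hat_eq hW (by simp [eigenvalue]; linarith)
      (by simp [eigenvalue]; linarith)
  · simpa using hT.transpose_eq_neg_of_hat_eq hW (by simp [eigenvalue]; linarith)
      (by simp [eigenvalue]; linarith) (by simp [eigenvalue]; linarith)
  · simpa using hT.transpose_of_hat_eq hW (by simp [eigenvalue]; linarith)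
      (by simp [eigenvalue]; exact fun h => h10' (by linarith))
  · simpa using hT.transpose_eq_neg_of_hat_eq hW (by simp [eigenvalue]; linarith)
      (by simp [eigenvalue]; exact fun h => h10' (by linarith)) (by simp [eigenvalue]; linarith)
  · simpa using hT.transpose_of_hat_eq hW (by simp [eigenvalue]; linarith)
      (by norm_num [eigenvalue])

/-- The dimensions are determined by those of `E_{4+2n}` and `E_{2-n}` and by the traces of the
identity, of the transposition and of `Υ̂`. -/
theorem finrank_eigenspace (hn : 3 ≤ n) (h10 : n ≠ 10) (d : Fin 5 → ℕ) (h0 : d 0 = 1)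
    (h1 : (n + 10) * d 1 = 3 * n * (n - 2)) (h2 : d 2 = n)
    (h3 : d 1 + d 3 = n * (n - 1) / 2) (h4 : d 4 + 1 = d 1 + d 3) (i : Fin 5) :
    Module.finrank ℝ ((hatEndomorphism T).eigenspace (eigenvalue n i)) = d i := by
  have hn' : (3 : ℝ) ≤ n := by exact_mod_cast hn
  set r : Fin 5 → ℕ := fun i => Module.finrank ℝ ((hatEndomorphism T).eigenspace (eigenvalue n i))
    with hr
  have t1 := hT.trace_eq_of_scalar hn h10 LinearMap.id (fun _ => 1) (by simp)
  have t2 := hT.trace_eq_of_scalar hn h10 (transposeMap n) _ (hT.transpose_of_mem hn h10)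
  have t3 := hT.trace_eq_of_scalar hn h10 (hatEndomorphism T) (eigenvalue n)
    (fun i W hW => Module.End.mem_eigenspace_iff.1 hW)
  have r0 : r 0 = 1 := by
    change Module.finrank ℝ ((hatEndomorphism T).eigenspace (4 + 2 * n)) = 1
    rw [hT.eigenspace_scalar hn]
    have : Nonempty (Fin n) := ⟨⟨0, by omega⟩⟩
    exact finrank_span_singleton one_ne_zero
  have r2 : r 2 = n := by
    change Module.finrank ℝ ((hatEndomorphism T).eigenspace (2 - n)) = n
    rw [hT.eigenspace_mulLeft hn h10, LinearMap.finrank_range_of_inj hT.mulLeft_injective,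
      Module.finrank_fin_fun]
  rw [trace_transposeMap] at t2
  rw [hT.trace_hat] at t3
  rw [LinearMap.trace_id, Module.finrank_matrix, Module.finrank_self, Fintype.card_fin] at t1
  change _ = ∑ i, (fun _ => (1 : ℝ)) i * (r i : ℝ) at t1
  change _ = ∑ i, (![1, -1, 1, -1, 1] i : ℝ) * (r i : ℝ) at t2
  change _ = ∑ i, eigenvalue n i * (r i : ℝ) at t3
  simp only [Fin.sum_univ_five, r0, r2, eigenvalue] at t1 t2 t3
  simp at t1 t2 t3
  obtain ⟨m, rfl⟩ : ∃ m, n = m + 2 := ⟨n - 2, by omega⟩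
  simp only [Nat.add_sub_cancel] at h1
  have h3' : 2 * (d 1 + d 3) = (m + 2) * (m + 1) := by
    rw [h3]
    exact Nat.mul_div_cancel' (by
      have := Nat.even_mul_succ_self (m + 1)
      rw [mul_comm] at this
      exact this.two_dvd)
  have h1' : ((m + 2 : ℕ) + 10 : ℝ) * d 1 = 3 * (m + 2 : ℕ) * m := by exact_mod_cast h1
  have h3'' : 2 * (d 1 + d 3 : ℝ) = (m + 2) * (m + 1) := by exact_mod_cast h3'
  have h4' : (d 4 + 1 : ℝ) = d 1 + d 3 := by exact_mod_cast h4
  push_cast at *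
  have e1 : (r 1 : ℝ) = d 1 := by
    have : (m + 2 + 10 : ℝ) * (r 1 - d 1) = 0 := by
      linear_combination -t3 + 4 * t2 - 2 * (t1 - t2) - h1'
    have := (mul_eq_zero.1 this).resolve_left (by positivity)
    linarith
  have e3 : (r 3 : ℝ) = d 3 := by nlinarith
  have e4 : (r 4 : ℝ) = d 4 := by nlinarith
  fin_cases i
  · exact r0.trans h0.symm
  · exact_mod_cast e1
  · exact r2.trans h2.symm
  · exact_mod_cast e3
  · exact_mod_cast e4

end IsCartan

end CubicTensor

/-! ### The stabilizer, its Lie algebra and its orbits -/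

namespace CubicTensor

variable {n : ℕ} {T : Fin n → Fin n → Fin n → ℝ}

/-- The matrices of the elements of the stabilizer of `T` in `SO(n)`: the rotations that are
automorphisms of the algebra of `T`. -/
def rotationAutomorphisms (T : Fin n → Fin n → Fin n → ℝ) : Set (Matrix (Fin n) (Fin n) ℝ) :=
  {h | hᵀ * h = 1 ∧ h.det = 1 ∧
    ∀ x y, h *ᵥ (mulLeft T x *ᵥ y) = mulLeft T (h *ᵥ x) *ᵥ (h *ᵥ y)}

theorem mulVec_dotProduct_mulVec {h : Matrix (Fin n) (Fin n) ℝ} (hh : hᵀ * h = 1)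
    (x y : Fin n → ℝ) : (h *ᵥ x) ⬝ᵥ (h *ᵥ y) = x ⬝ᵥ y := by
  rw [Matrix.dotProduct_mulVec, ← Matrix.mulVec_transpose, Matrix.mulVec_mulVec, hh,
    Matrix.one_mulVec]

theorem hasDerivAt_bilin {E F G : Type*} [NormedAddCommGroup E] [NormedSpace ℝ E]
    [FiniteDimensional ℝ E] [NormedAddCommGroup F] [NormedSpace ℝ F] [FiniteDimensional ℝ F]
    [NormedAddCommGroup G] [NormedSpace ℝ G] (B : E →ₗ[ℝ] F →ₗ[ℝ] G) {a : ℝ → E} {b : ℝ → F}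
    {a' : E} {b' : F} {t : ℝ} (ha : HasDerivAt a a' t) (hb : HasDerivAt b b' t) :
    HasDerivAt (fun t => B (a t) (b t)) (B (a t) b' + B a' (b t)) t :=
  B.toContinuousBilinearMap.hasDerivAt_of_bilinear (fun _ => ha) fun _ => hb

section exp

open scoped Matrix.Norms.Operator

theorem hasDerivAt_exp_mulVec (X : Matrix (Fin n) (Fin n) ℝ) (x : Fin n → ℝ) (t : ℝ) :
    HasDerivAt (fun t : ℝ => NormedSpace.exp (t • X) *ᵥ x) (X *ᵥ (NormedSpace.exp (t • X) *ᵥ x))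
      t := by
  have h := hasDerivAt_bilin (Matrix.mulVecBilin ℝ ℝ)
    (hasDerivAt_exp_smul_const' (𝕂 := ℝ) X t) (hasDerivAt_const t x)
  exact h.congr_deriv (by simp [Matrix.mulVec_mulVec]; rfl)

theorem hasDerivAt_exp_conj (X W : Matrix (Fin n) (Fin n) ℝ) :
    HasDerivAt (fun t : ℝ => NormedSpace.exp (t • X) * W * NormedSpace.exp (-(t • X)))
      (X * W - W * X) 0 := by
  have h1 := hasDerivAt_exp_smul_const' (𝕂 := ℝ) X 0
  have h2 := hasDerivAt_exp_smul_const' (𝕂 := ℝ) (-X) 0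
  have h := (h1.mul_const W).mul h2
  simp only [smul_neg] at h
  exact h.congr_deriv (by simp [NormedSpace.exp_zero, sub_eq_add_neg])

theorem exp_neg_mul_exp (X : Matrix (Fin n) (Fin n) ℝ) :
    NormedSpace.exp (-X) * NormedSpace.exp X = 1 := by
  rw [← Matrix.exp_add_of_commute _ _ (Commute.neg_left (Commute.refl X)), neg_add_cancel,
    NormedSpace.exp_zero]

theorem det_exp_of_skew {X : Matrix (Fin n) (Fin n) ℝ} (hX : Xᵀ = -X) :
    (NormedSpace.exp X).det = 1 := by
  have h1 : (NormedSpace.exp X).det * (NormedSpace.exp X).det = 1 := by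
    conv_lhs => enter [1]; rw [← Matrix.det_transpose, ← Matrix.exp_transpose, hX]
    rw [← Matrix.det_mul, exp_neg_mul_exp, Matrix.det_one]
  have h2 : NormedSpace.exp X =
      NormedSpace.exp ((1 / 2 : ℝ) • X) * NormedSpace.exp ((1 / 2 : ℝ) • X) := by
    rw [← Matrix.exp_add_of_commute _ _ (Commute.refl _), ← add_smul]
    norm_num
  have h3 : 0 ≤ (NormedSpace.exp X).det := by
    rw [h2, Matrix.det_mul]
    exact mul_self_nonneg _
  nlinarith

end exp

theorem hasDerivAt_dotProduct {a b : ℝ → Fin n → ℝ} {a' b' : Fin n → ℝ} {t : ℝ}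
    (ha : HasDerivAt a a' t) (hb : HasDerivAt b b' t) :
    HasDerivAt (fun t => a t ⬝ᵥ b t) (a t ⬝ᵥ b' + a' ⬝ᵥ b t) t :=
  hasDerivAt_bilin (dotProductBilin ℝ ℝ) ha hb

/-- The product of the algebra as a bilinear map. -/
def prod (T : Fin n → Fin n → Fin n → ℝ) : (Fin n → ℝ) →ₗ[ℝ] (Fin n → ℝ) →ₗ[ℝ] (Fin n → ℝ) :=
  Matrix.mulVecBilin ℝ ℝ ∘ₗ mulLeft T

theorem hasDerivAt_prod {a b : ℝ → Fin n → ℝ} {a' b' : Fin n → ℝ} {t : ℝ}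
    (ha : HasDerivAt a a' t) (hb : HasDerivAt b b' t) :
    HasDerivAt (fun t => mulLeft T (a t) *ᵥ b t) (mulLeft T (a t) *ᵥ b' + mulLeft T a' *ᵥ b t) t :=
  hasDerivAt_bilin (prod T) ha hb

theorem exp_mem_rotationAutomorphisms {X : Matrix (Fin n) (Fin n) ℝ} (hX : X ∈ skewDerivations T) :
    NormedSpace.exp X ∈ rotationAutomorphisms T := by
  have horth : ∀ Y : Matrix (Fin n) (Fin n) ℝ, Yᵀ = -Y →
      (NormedSpace.exp Y)ᵀ * NormedSpace.exp Y = 1 := by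
    intro Y hY
    rw [← Matrix.exp_transpose, hY, exp_neg_mul_exp]
  refine ⟨horth X hX.1, det_exp_of_skew hX.1, fun x y => ?_⟩
  refine dotProduct_eq _ _ fun z => ?_
  have e : z = NormedSpace.exp X *ᵥ ((NormedSpace.exp X)ᵀ *ᵥ z) := by
    rw [Matrix.mulVec_mulVec, mul_eq_one_comm.1 (horth X hX.1), Matrix.one_mulVec]
  rw [e]
  set w := (NormedSpace.exp X)ᵀ *ᵥ z
  rw [mulVec_dotProduct_mulVec (horth X hX.1)]
  -- the trilinear form is constant along the one-parameter group
  have hd : ∀ t : ℝ, HasDerivAt (fun t : ℝ => (mulLeft T (NormedSpace.exp (t • X) *ᵥ x) *ᵥ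
      (NormedSpace.exp (t • X) *ᵥ y)) ⬝ᵥ (NormedSpace.exp (t • X) *ᵥ w)) 0 t := by
    intro t
    have h := hasDerivAt_dotProduct (hasDerivAt_prod (T := T) (hasDerivAt_exp_mulVec X x t)
      (hasDerivAt_exp_mulVec X y t)) (hasDerivAt_exp_mulVec X w t)
    convert! h using 1
    rw [add_comm (mulLeft T _ *ᵥ _), ← hX.2, mulVec_dotProduct_of_skew hX.1]
    ring
  have hc := is_const_of_deriv_eq_zero (fun t => (hd t).differentiableAt)
    (fun t => (hd t).deriv) 0 1
  simpa [NormedSpace.exp_zero] using hc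

namespace IsCartan

variable (hT : IsCartan T)
include hT

theorem trilinearForm_eq (x y z : Fin n → ℝ) :
    trilinearForm T x y z = (mulLeft T x *ᵥ y) ⬝ᵥ z := by
  rw [hT.mulLeft_dotProduct, hT.mulLeft_comm]
  simp only [trilinearForm, mulLeft, LinearMap.coe_mk, AddHom.coe_mk, Matrix.mulVec, dotProduct,
    Matrix.of_apply, Finset.sum_mul, Finset.mul_sum]
  rw [Finset.sum_comm]
  refine Finset.sum_congr rfl fun J _ => Finset.sum_congr rfl fun I _ =>
    Finset.sum_congr rfl fun K _ => ?_
  rw [hT.symm_left]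
  ring

theorem mem_rotationAutomorphisms {h : Matrix (Fin n) (Fin n) ℝ} :
    h ∈ rotationAutomorphisms T ↔ ∃ h' ∈ stabilizerSO T, (h' : Matrix (Fin n) (Fin n) ℝ) = h := by
  have key : ∀ h : Matrix (Fin n) (Fin n) ℝ, hᵀ * h = 1 → ((∀ x y z,
      trilinearForm T (h *ᵥ x) (h *ᵥ y) (h *ᵥ z) = trilinearForm T x y z) ↔
      ∀ x y, h *ᵥ (mulLeft T x *ᵥ y) = mulLeft T (h *ᵥ x) *ᵥ (h *ᵥ y)) := by
    intro h hh
    simp only [hT.trilinearForm_eq]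
    constructor
    · intro hyp x y
      refine dotProduct_eq _ _ fun z => ?_
      have e : z = h *ᵥ (hᵀ *ᵥ z) := by
        rw [Matrix.mulVec_mulVec, mul_eq_one_comm.1 hh, Matrix.one_mulVec]
      rw [e, hyp, mulVec_dotProduct_mulVec hh]
    · intro hyp x y z
      rw [← hyp, mulVec_dotProduct_mulVec hh]
  constructor
  · rintro ⟨h1, h2, h3⟩
    refine ⟨⟨h, Matrix.mem_specialOrthogonalGroup_iff.2
      ⟨(Matrix.mem_orthogonalGroup_iff' _ _).2 h1, h2⟩⟩, (key h h1).2 h3, rfl⟩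
  · rintro ⟨h', hm, rfl⟩
    have h1 := (Matrix.mem_orthogonalGroup_iff' _ _).1
      (Matrix.mem_specialOrthogonalGroup_iff.1 h'.2).1
    exact ⟨h1, (Matrix.mem_specialOrthogonalGroup_iff.1 h'.2).2, (key _ h1).1 hm⟩

end IsCartan

/-- The skew derivations are the Lie algebra of the stabilizer. -/
theorem mem_skewDerivations_iff_exp {X : Matrix (Fin n) (Fin n) ℝ} :
    X ∈ skewDerivations T ↔ ∀ t : ℝ, NormedSpace.exp (t • X) ∈ rotationAutomorphisms T := by
  refine ⟨fun h t => exp_mem_rotationAutomorphisms ((skewDerivations T).smul_mem t h), fun h => ?_⟩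
  have hX : Xᵀ = -X := by
    refine matrix_ext_mulVec fun x => dotProduct_eq _ _ fun y => ?_
    have hd := hasDerivAt_dotProduct (hasDerivAt_exp_mulVec X x 0) (hasDerivAt_exp_mulVec X y 0)
    have hc : (fun t : ℝ => (NormedSpace.exp (t • X) *ᵥ x) ⬝ᵥ (NormedSpace.exp (t • X) *ᵥ y)) =
        fun _ => x ⬝ᵥ y := funext fun t => mulVec_dotProduct_mulVec (h t).1 x y
    rw [hc] at hd
    have := hd.unique (hasDerivAt_const _ _)
    simp only [zero_smul, NormedSpace.exp_zero, Matrix.one_mulVec] at this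
    rw [Matrix.mulVec_transpose, ← Matrix.dotProduct_mulVec, Matrix.neg_mulVec, neg_dotProduct]
    linarith
  refine ⟨hX, fun x y => ?_⟩
  have h1 := hasDerivAt_prod (T := T) (hasDerivAt_exp_mulVec X x 0) (hasDerivAt_exp_mulVec X y 0)
  have h2 := hasDerivAt_exp_mulVec X (mulLeft T x *ᵥ y) 0
  rw [funext fun t : ℝ => (h t).2.2 x y] at h2
  have := h2.unique h1
  simp only [zero_smul, NormedSpace.exp_zero, Matrix.one_mulVec] at this
  rw [this, add_comm]

/-- A subspace of `⊗²ℝⁿ` that is invariant under the stabilizer is invariant under the derivation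
algebra. -/
theorem commutator_mem {U : Submodule ℝ (Matrix (Fin n) (Fin n) ℝ)}
    (hU : ∀ h ∈ rotationAutomorphisms T, ∀ W ∈ U, h * W * hᵀ ∈ U)
    {F W : Matrix (Fin n) (Fin n) ℝ} (hF : F ∈ skewDerivations T) (hW : W ∈ U) :
    F * W - W * F ∈ U := by
  by_contra hn
  obtain ⟨φ, h1, h2⟩ := Submodule.exists_le_ker_of_notMem hn
  have hd := hasDerivAt_exp_conj F W
  have hφ : HasDerivAt (fun t : ℝ => φ (NormedSpace.exp (t • F) * W * NormedSpace.exp (-(t • F))))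
      (φ (F * W - W * F)) 0 := by
    open scoped Matrix.Norms.Operator in
    exact (LinearMap.toContinuousLinearMap φ).hasFDerivAt.comp_hasDerivAt _ hd
  have hz : (fun t : ℝ => φ (NormedSpace.exp (t • F) * W * NormedSpace.exp (-(t • F)))) =
      fun _ => 0 := by
    funext t
    have h := hU _ (exp_mem_rotationAutomorphisms ((skewDerivations T).smul_mem t hF)) W hW
    rw [← Matrix.exp_transpose, Matrix.transpose_smul, hF.1, smul_neg] at h
    exact h2 h
  rw [hz] at hφ
  exact h1 (hφ.unique (hasDerivAt_const _ _))

theorem isCompact_rotationAutomorphisms : IsCompact (rotationAutomorphisms T) := by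
  have hK : IsCompact (Set.univ.pi fun _ : Fin n => Set.univ.pi fun _ : Fin n =>
      Set.Icc (-1 : ℝ) 1) := isCompact_univ_pi fun _ => isCompact_univ_pi fun _ => isCompact_Icc
  refine IsCompact.of_isClosed_subset hK ?_ ?_
  · have c1 : Continuous fun h : Matrix (Fin n) (Fin n) ℝ => hᵀ * h := by fun_prop
    have c2 : Continuous fun h : Matrix (Fin n) (Fin n) ℝ => h.det := by fun_prop
    have c3 : ∀ x : Fin n → ℝ, Continuous fun h : Matrix (Fin n) (Fin n) ℝ => h *ᵥ x := by
      intro x; fun_prop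
    have c4 : Continuous (mulLeft T) := (mulLeft T).continuous_of_finiteDimensional
    have : rotationAutomorphisms T = {h | hᵀ * h = 1} ∩ ({h | h.det = 1} ∩ ⋂ x, ⋂ y,
        {h | h *ᵥ (mulLeft T x *ᵥ y) = mulLeft T (h *ᵥ x) *ᵥ (h *ᵥ y)}) := by
      ext h
      simp [rotationAutomorphisms]
    rw [this]
    refine (isClosed_eq c1 continuous_const).inter ((isClosed_eq c2 continuous_const).inter
      (isClosed_iInter fun x => isClosed_iInter fun y => isClosed_eq (c3 _) ?_))
    exact (c4.comp (c3 x)).matrix_mulVec (c3 y)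
  · rintro h ⟨h1, -, -⟩ i - j -
    have := congrFun (congrFun h1 j) j
    rw [Matrix.mul_apply, Matrix.one_apply_eq] at this
    simp only [Matrix.transpose_apply] at this
    have h2 : h i j * h i j ≤ 1 := by
      rw [← this]
      exact Finset.single_le_sum (f := fun i => h i j * h i j) (fun i _ => mul_self_nonneg _)
        (Finset.mem_univ i)
    exact abs_le.1 (abs_le_one_iff_mul_self_le_one.2 h2)

theorem one_mem_rotationAutomorphisms :
    (1 : Matrix (Fin n) (Fin n) ℝ) ∈ rotationAutomorphisms T := by
  simp [rotationAutomorphisms]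

theorem mul_mem_rotationAutomorphisms {g h : Matrix (Fin n) (Fin n) ℝ}
    (hg : g ∈ rotationAutomorphisms T) (hh : h ∈ rotationAutomorphisms T) :
    g * h ∈ rotationAutomorphisms T := by
  refine ⟨?_, by rw [Matrix.det_mul, hg.2.1, hh.2.1, one_mul], fun x y => ?_⟩
  · rw [Matrix.transpose_mul, mul_assoc, ← mul_assoc gᵀ, hg.1, one_mul, hh.1]
  · simp only [← Matrix.mulVec_mulVec, hh.2.2, hg.2.2]

theorem transpose_mem_rotationAutomorphisms {h : Matrix (Fin n) (Fin n) ℝ}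
    (hh : h ∈ rotationAutomorphisms T) : hᵀ ∈ rotationAutomorphisms T := by
  have h1 := mul_eq_one_comm.1 hh.1
  refine ⟨by rwa [Matrix.transpose_transpose], by rw [Matrix.det_transpose, hh.2.1],
    fun x y => ?_⟩
  have e : ∀ v, h *ᵥ (hᵀ *ᵥ v) = v := fun v => by
    rw [Matrix.mulVec_mulVec, h1, Matrix.one_mulVec]
  have e' : ∀ v, hᵀ *ᵥ (h *ᵥ v) = v := fun v => by
    rw [Matrix.mulVec_mulVec, hh.1, Matrix.one_mulVec]
  rw [← e' (mulLeft T (hᵀ *ᵥ x) *ᵥ (hᵀ *ᵥ y)), hh.2.2, e, e]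

/-- The map `x ↦ L_x` is equivariant. -/
theorem mulLeft_mulVec_of_mem {h : Matrix (Fin n) (Fin n) ℝ} (hh : h ∈ rotationAutomorphisms T)
    (x : Fin n → ℝ) : mulLeft T (h *ᵥ x) = h * mulLeft T x * hᵀ := by
  refine matrix_ext_mulVec fun z => ?_
  rw [← Matrix.mulVec_mulVec, ← Matrix.mulVec_mulVec, hh.2.2, Matrix.mulVec_mulVec z h,
    mul_eq_one_comm.1 hh.1, Matrix.one_mulVec]

/-- Every orbit of the stabilizer meets the space of vectors that are orthogonal to the tangent
space `𝔥 p` of the orbit of `p`: a point of the orbit that maximizes the scalar product with `p`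
lies in this space. -/
theorem exists_orthogonal_tangent (x p : Fin n → ℝ) :
    ∃ h ∈ rotationAutomorphisms T, ∀ F ∈ skewDerivations T, (h *ᵥ x) ⬝ᵥ (F *ᵥ p) = 0 := by
  have hc : Continuous fun h : Matrix (Fin n) (Fin n) ℝ => (h *ᵥ x) ⬝ᵥ p := by fun_prop
  obtain ⟨h, hh, hmax⟩ := isCompact_rotationAutomorphisms.exists_isMaxOn
    ⟨1, one_mem_rotationAutomorphisms (T := T)⟩ hc.continuousOn
  refine ⟨h, hh, fun F hF => ?_⟩
  have hd := hasDerivAt_dotProduct (hasDerivAt_exp_mulVec F (h *ᵥ x) 0) (hasDerivAt_const 0 p)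
  have hm : IsLocalMax (fun t : ℝ => (NormedSpace.exp (t • F) *ᵥ (h *ᵥ x)) ⬝ᵥ p) 0 := by
    refine Filter.Eventually.of_forall fun t => ?_
    have := hmax (mul_mem_rotationAutomorphisms
      (exp_mem_rotationAutomorphisms ((skewDerivations T).smul_mem t hF)) hh)
    simpa [NormedSpace.exp_zero, Matrix.mulVec_mulVec] using this
  have h0 := hm.hasDerivAt_eq_zero hd
  simp only [zero_smul, NormedSpace.exp_zero, Matrix.one_mulVec, dotProduct_zero, zero_add] at h0
  rw [mulVec_dotProduct_of_skew hF.1] at h0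
  linarith

end CubicTensor

/-! ### Frames: the Peirce decomposition -/

namespace CubicTensor

/-- The product of the two-dimensional algebra of trace-free diagonal matrices. -/
def planeMul (p q : Fin 2 → ℝ) : Fin 2 → ℝ := ![p 0 * q 1 + p 1 * q 0, p 0 * q 0 - p 1 * q 1]

/-- The three unit vectors of the plane with `v v = -v`, which correspond to the primitive
idempotents of the Jordan algebra. -/
noncomputable def idem (i : Fin 3) : Fin 2 → ℝ :=
  (![![√3 / 2, -1 / 2], ![-(√3 / 2), -1 / 2], ![0, 1]] : Fin 3 → Fin 2 → ℝ) i

/-- The unit vector orthogonal to `idem i`; up to scale it is the difference of the two diagonal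
entries with indices other than `i`. -/
noncomputable def root (i : Fin 3) : Fin 2 → ℝ :=
  (![![-1 / 2, -(√3 / 2)], ![-1 / 2, √3 / 2], ![1, 0]] : Fin 3 → Fin 2 → ℝ) i

theorem sqrt_three_sq : √3 * √3 = (3 : ℝ) := Real.mul_self_sqrt (by norm_num)

section plane

theorem idem_dot_idem (i : Fin 3) : idem i ⬝ᵥ idem i = 1 := by
  have := sqrt_three_sq
  fin_cases i <;> simp [idem, dotProduct, Fin.sum_univ_two] <;> linarith

theorem root_dot_root (i : Fin 3) : root i ⬝ᵥ root i = 1 := by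
  have := sqrt_three_sq
  fin_cases i <;> simp [root, dotProduct, Fin.sum_univ_two] <;> linarith

theorem idem_dot_root (i : Fin 3) : idem i ⬝ᵥ root i = 0 := by
  fin_cases i <;> simp [root, idem, dotProduct, Fin.sum_univ_two] <;> ring

theorem idem_succ_dot_root {i j : Fin 3} (h : j = i + 1) : idem j ⬝ᵥ root i = √3 / 2 := by
  have := sqrt_three_sq
  subst h
  fin_cases i <;> (simp [root, idem, dotProduct, Fin.sum_univ_two]; try linarith)

theorem idem_pred_dot_root {i j : Fin 3} (h : j = i + 2) : idem j ⬝ᵥ root i = -(√3 / 2) := by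
  have := sqrt_three_sq
  subst h
  fin_cases i <;> (simp [root, idem, dotProduct, Fin.sum_univ_two]; try linarith)

theorem root_dot_root_of_ne {i j : Fin 3} (h : i ≠ j) : root i ⬝ᵥ root j = -1 / 2 := by
  have := sqrt_three_sq
  fin_cases i <;> fin_cases j <;>
    first
    | exact absurd rfl h
    | (simp [root, dotProduct, Fin.sum_univ_two]; done)
    | (simp [root, dotProduct, Fin.sum_univ_two]; try linarith)

theorem sum_root : root 0 + root 1 + root 2 = 0 := by
  ext i
  fin_cases i <;> simp [root]

theorem planeMul_comm (p q : Fin 2 → ℝ) : planeMul p q = planeMul q p := by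
  ext i
  fin_cases i <;> simp [planeMul] <;> ring

theorem planeMul_idem_root (i : Fin 3) : planeMul (root i) (idem i) = root i := by
  have := sqrt_three_sq
  ext j
  fin_cases i <;> fin_cases j <;> simp [root, idem, planeMul] <;> try linarith

theorem planeMul_idem_idem (i : Fin 3) : planeMul (idem i) (idem i) = -idem i := by
  have := sqrt_three_sq
  ext j
  fin_cases i <;> fin_cases j <;> simp [idem, planeMul] <;> try linarith

theorem planeMul_dot (p q r : Fin 2 → ℝ) : planeMul p q ⬝ᵥ r = q ⬝ᵥ planeMul p r := by
  simp [planeMul, dotProduct, Fin.sum_univ_two]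
  ring

/-- A vector of the plane in the orthonormal basis `idem i`, `root i`. -/
theorem plane_eq (i : Fin 3) (p : Fin 2 → ℝ) :
    p = (idem i ⬝ᵥ p) • idem i + (root i ⬝ᵥ p) • root i := by
  have := sqrt_three_sq
  ext j
  fin_cases i <;> fin_cases j <;>
    simp [idem, root, dotProduct, Fin.sum_univ_two] <;> first
      | linear_combination (-(p 0) / 4) * this
      | linear_combination (-(p 1) / 4) * this

end plane

variable {n k : ℕ} {T : Fin n → Fin n → Fin n → ℝ}

/-- A Peirce decomposition of `ℝⁿ` as `ℝ² ⊕ D ⊕ D ⊕ D` with `D = ℝᵏ`: the diagonal matrices and the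
three off-diagonal entries of trace-free hermitian `3 × 3` matrices. The product `m` of `D` is
`(a, b) ↦ conj (a b)`, for which the scalar product is associative and the norm multiplicative; with
it the formulas are invariant under cyclic permutations of the three entries. -/
structure Frame (T : Fin n → Fin n → Fin n → ℝ) (k : ℕ) where
  m : (Fin k → ℝ) →ₗ[ℝ] (Fin k → ℝ) →ₗ[ℝ] (Fin k → ℝ)
  m_dot : ∀ a b c, m a b ⬝ᵥ c = a ⬝ᵥ m b c
  m_dot_m : ∀ a b, m a b ⬝ᵥ m a b = (a ⬝ᵥ a) * (b ⬝ᵥ b)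
  δ : (Fin 2 → ℝ) →ₗ[ℝ] (Fin n → ℝ)
  ι : Fin 3 → (Fin k → ℝ) →ₗ[ℝ] (Fin n → ℝ)
  δ_dot_δ : ∀ p q, δ p ⬝ᵥ δ q = p ⬝ᵥ q
  ι_dot_ι : ∀ i a b, ι i a ⬝ᵥ ι i b = a ⬝ᵥ b
  ι_dot_ι_of_ne : ∀ i j a b, i ≠ j → ι i a ⬝ᵥ ι j b = 0
  δ_dot_ι : ∀ p i a, δ p ⬝ᵥ ι i a = 0
  exists_eq : ∀ x, ∃ (p : Fin 2 → ℝ) (a : Fin 3 → Fin k → ℝ), x = δ p + ∑ i, ι i (a i)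
  symm_left : ∀ I J K, T I J K = T J I K
  symm_right : ∀ I J K, T I J K = T I K J
  δ_mul_δ : ∀ p q, mulLeft T (δ p) *ᵥ δ q = δ (planeMul p q)
  δ_mul_ι : ∀ p i a, mulLeft T (δ p) *ᵥ ι i a = (idem i ⬝ᵥ p) • ι i a
  ι_mul_ι : ∀ i a b, mulLeft T (ι i a) *ᵥ ι i b = (a ⬝ᵥ b) • δ (idem i)
  ι_mul_ι_succ : ∀ i a b, mulLeft T (ι i a) *ᵥ ι (i + 1) b = (√3 / 2) • ι (i + 2) (m a b)

theorem mulLeft_mulVec_comm (h : ∀ I J K, T I J K = T I K J) (x y : Fin n → ℝ) :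
    mulLeft T x *ᵥ y = mulLeft T y *ᵥ x := by
  ext I
  simp only [mulLeft, Matrix.mulVec, dotProduct, LinearMap.coe_mk, AddHom.coe_mk, Matrix.of_apply,
    Finset.sum_mul]
  rw [Finset.sum_comm]
  refine Finset.sum_congr rfl fun J _ => Finset.sum_congr rfl fun K _ => ?_
  rw [h]; ring

namespace Frame

variable (A : Frame T k)
include A

theorem ι_dot_δ (i : Fin 3) (a : Fin k → ℝ) (p : Fin 2 → ℝ) : A.ι i a ⬝ᵥ A.δ p = 0 := by
  rw [dotProduct_comm, A.δ_dot_ι]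

/-- Linearization of the multiplicativity of the norm. -/
theorem m_dot_m_left (a b c : Fin k → ℝ) : A.m a b ⬝ᵥ A.m a c = (a ⬝ᵥ a) * (b ⬝ᵥ c) := by
  have h1 := A.m_dot_m a (b + c)
  have h2 := A.m_dot_m a b
  have h3 := A.m_dot_m a c
  simp only [map_add, add_dotProduct, dotProduct_add] at h1
  rw [dotProduct_comm (A.m a c), dotProduct_comm c b] at h1
  linarith

theorem m_dot_m_right (a b c : Fin k → ℝ) : A.m a b ⬝ᵥ A.m c b = (b ⬝ᵥ b) * (a ⬝ᵥ c) := by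
  have h1 := A.m_dot_m (a + c) b
  have h2 := A.m_dot_m a b
  have h3 := A.m_dot_m c b
  simp only [map_add, LinearMap.add_apply, add_dotProduct, dotProduct_add] at h1
  rw [dotProduct_comm (A.m c b), dotProduct_comm c a] at h1
  linarith

theorem m_m_left (a b : Fin k → ℝ) : A.m (A.m a b) a = (a ⬝ᵥ a) • b := by
  refine dotProduct_eq _ _ fun c => ?_
  rw [A.m_dot, A.m_dot_m_left, smul_dotProduct, smul_eq_mul]

theorem m_m_right (a b : Fin k → ℝ) : A.m a (A.m b a) = (a ⬝ᵥ a) • b := by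
  refine dotProduct_eq _ _ fun c => ?_
  rw [dotProduct_comm, ← A.m_dot, dotProduct_comm, A.m_dot_m_right, smul_dotProduct, smul_eq_mul,
    dotProduct_comm b c, dotProduct_comm c b]

theorem m_m_add (a b c : Fin k → ℝ) :
    A.m (A.m a b) c + A.m (A.m c b) a = (2 * (a ⬝ᵥ c)) • b := by
  have h := A.m_m_left (a + c) b
  have h1 := A.m_m_left a b
  have h2 := A.m_m_left c b
  simp only [map_add, LinearMap.add_apply, add_dotProduct, dotProduct_add] at h
  rw [dotProduct_comm c a] at h
  linear_combination (norm := module) h - h1 - h2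

theorem mul_comm (x y : Fin n → ℝ) : mulLeft T x *ᵥ y = mulLeft T y *ᵥ x :=
  mulLeft_mulVec_comm A.symm_right x y

theorem ι_mul_δ (i : Fin 3) (a : Fin k → ℝ) (p : Fin 2 → ℝ) :
    mulLeft T (A.ι i a) *ᵥ A.δ p = (idem i ⬝ᵥ p) • A.ι i a := by
  rw [A.mul_comm, A.δ_mul_ι]

theorem ι_mul_succ {i j l : Fin 3} (hj : j = i + 1) (hl : l = i + 2) (a b : Fin k → ℝ) :
    mulLeft T (A.ι i a) *ᵥ A.ι j b = (√3 / 2) • A.ι l (A.m a b) := by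
  subst hj hl
  exact A.ι_mul_ι_succ i a b

theorem ι_mul_pred {i j l : Fin 3} (hj : j = i + 2) (hl : l = i + 1) (a b : Fin k → ℝ) :
    mulLeft T (A.ι i a) *ᵥ A.ι j b = (√3 / 2) • A.ι l (A.m b a) := by
  rw [A.mul_comm]
  exact A.ι_mul_succ (by subst hj; fin_cases i <;> rfl) (by subst hj hl; fin_cases i <;> rfl) b a

theorem matrix_ext {W V : Matrix (Fin n) (Fin n) ℝ} (h1 : ∀ p, W *ᵥ A.δ p = V *ᵥ A.δ p)
    (h2 : ∀ i a, W *ᵥ A.ι i a = V *ᵥ A.ι i a) : W = V := by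
  refine matrix_ext_mulVec fun x => ?_
  obtain ⟨p, a, rfl⟩ := A.exists_eq x
  simp only [Matrix.mulVec_add, Matrix.mulVec_sum, h1, h2]

theorem one_eq_sum : (1 : Matrix (Fin n) (Fin n) ℝ) =
    ∑ j, Matrix.vecMulVec (A.δ (Pi.single j 1)) (A.δ (Pi.single j 1))
      + ∑ i, ∑ c, Matrix.vecMulVec (A.ι i (Pi.single c 1)) (A.ι i (Pi.single c 1)) := by
  refine A.matrix_ext (fun p => ?_) fun i a => ?_
  · simp only [Matrix.one_mulVec, Matrix.add_mulVec, Matrix.sum_mulVec, Matrix.vecMulVec_mulVec,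
      op_smul_eq_smul, A.δ_dot_δ, A.ι_dot_δ, zero_smul, Finset.sum_const_zero, add_zero,
      single_one_dotProduct]
    simp only [← map_smul, ← map_sum]
    rw [← eq_sum_single]
  · have h : ∀ j c, A.ι j (Pi.single c 1) ⬝ᵥ A.ι i a = if j = i then a c else 0 := by
      intro j c
      split_ifs with hj
      · rw [hj, A.ι_dot_ι, single_one_dotProduct]
      · exact A.ι_dot_ι_of_ne _ _ _ _ hj
    simp only [Matrix.one_mulVec, Matrix.add_mulVec, Matrix.sum_mulVec, Matrix.vecMulVec_mulVec,
      op_smul_eq_smul, A.δ_dot_ι, zero_smul, Finset.sum_const_zero, zero_add, h, ite_smul]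
    rw [Finset.sum_eq_single i (fun j _ hj => by simp [hj]) (by simp)]
    simp only [if_true, ← map_smul, ← map_sum]
    rw [← eq_sum_single]

theorem trace_eq (W : Matrix (Fin n) (Fin n) ℝ) : W.trace =
    ∑ j, A.δ (Pi.single j 1) ⬝ᵥ (W *ᵥ A.δ (Pi.single j 1))
      + ∑ i, ∑ c, A.ι i (Pi.single c 1) ⬝ᵥ (W *ᵥ A.ι i (Pi.single c 1)) := by
  have h := congrArg (fun V => (W * V).trace) A.one_eq_sum
  simp only [mul_one, mul_add, Finset.mul_sum, Matrix.mul_vecMulVec, Matrix.trace_add,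
    Matrix.trace_sum, Matrix.trace_vecMulVec] at h
  rw [h]
  simp only [dotProduct_comm]

/-- The product of two elements in terms of their components. -/
theorem mul_eq (p q : Fin 2 → ℝ) (a b : Fin 3 → Fin k → ℝ) :
    mulLeft T (A.δ p + ∑ i, A.ι i (a i)) *ᵥ (A.δ q + ∑ i, A.ι i (b i)) =
      A.δ (planeMul p q + ∑ i, (a i ⬝ᵥ b i) • idem i)
      + ∑ i, A.ι i ((idem i ⬝ᵥ p) • b i + (idem i ⬝ᵥ q) • a i
        + (√3 / 2) • (A.m (a (i + 1)) (b (i + 2)) + A.m (b (i + 1)) (a (i + 2)))) := by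
  have s01 := A.ι_mul_succ (i := 0) (j := 1) (l := 2) rfl rfl
  have s12 := A.ι_mul_succ (i := 1) (j := 2) (l := 0) rfl rfl
  have s20 := A.ι_mul_succ (i := 2) (j := 0) (l := 1) rfl rfl
  have t02 := A.ι_mul_pred (i := 0) (j := 2) (l := 1) rfl rfl
  have t10 := A.ι_mul_pred (i := 1) (j := 0) (l := 2) rfl rfl
  have t21 := A.ι_mul_pred (i := 2) (j := 1) (l := 0) rfl rfl
  simp only [Fin.sum_univ_three, map_add, Matrix.add_mulVec, Matrix.mulVec_add, A.δ_mul_δ,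
    A.δ_mul_ι, A.ι_mul_δ, A.ι_mul_ι, s01, s12, s20, t02, t10, t21, map_smul, Fin.isValue,
    show (0 + 1 : Fin 3) = 1 from rfl, show (0 + 2 : Fin 3) = 2 from rfl,
    show (1 + 1 : Fin 3) = 2 from rfl, show (1 + 2 : Fin 3) = 0 from rfl,
    show (2 + 1 : Fin 3) = 0 from rfl, show (2 + 2 : Fin 3) = 1 from rfl]
  module

theorem cube (x : Fin n → ℝ) : mulLeft T (mulLeft T x *ᵥ x) *ᵥ x = (x ⬝ᵥ x) • x := by
  obtain ⟨p, a, rfl⟩ := A.exists_eq x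
  have hx : (A.δ p + ∑ i, A.ι i (a i)) ⬝ᵥ (A.δ p + ∑ i, A.ι i (a i)) =
      p ⬝ᵥ p + ∑ i, a i ⬝ᵥ a i := by
    have d01 := A.ι_dot_ι_of_ne 0 1
    have d02 := A.ι_dot_ι_of_ne 0 2
    have d10 := A.ι_dot_ι_of_ne 1 0
    have d12 := A.ι_dot_ι_of_ne 1 2
    have d20 := A.ι_dot_ι_of_ne 2 0
    have d21 := A.ι_dot_ι_of_ne 2 1
    simp only [Fin.sum_univ_three, add_dotProduct, dotProduct_add, A.δ_dot_δ, A.ι_dot_ι, A.δ_dot_ι,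
      A.ι_dot_δ]
    rw [d01, d02, d10, d12, d20, d21] <;> first | decide | ring
  have h3 := sqrt_three_sq
  have hm : ∀ i j l : Fin 3, j = i + 1 → l = i + 2 →
      A.m (a i) (a j) ⬝ᵥ a l = A.m (a 0) (a 1) ⬝ᵥ a 2 := by
    rintro i j l rfl rfl
    fin_cases i
    · rfl
    · change A.m (a 1) (a 2) ⬝ᵥ a 0 = _
      rw [dotProduct_comm, ← A.m_dot]
    · change A.m (a 2) (a 0) ⬝ᵥ a 1 = _
      rw [A.m_dot, dotProduct_comm]
  rw [hx, A.mul_eq, A.mul_eq]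
  rw [smul_add, Finset.smul_sum, ← map_smul]
  simp only [← map_smul (A.ι _)]
  congr 1
  · congr 1
    have e : ∀ i, ((idem i ⬝ᵥ p) • a i + (idem i ⬝ᵥ p) • a i + (√3 / 2) •
        (A.m (a (i + 1)) (a (i + 2)) + A.m (a (i + 1)) (a (i + 2)))) ⬝ᵥ a i =
        2 * (idem i ⬝ᵥ p) * (a i ⬝ᵥ a i) + √3 * (A.m (a 0) (a 1) ⬝ᵥ a 2) := by
      intro i
      rw [← hm (i + 1) (i + 2) i (by fin_cases i <;> rfl) (by fin_cases i <;> rfl)]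
      simp only [add_dotProduct, smul_dotProduct, smul_eq_mul]
      ring
    simp only [e]
    generalize A.m (a 0) (a 1) ⬝ᵥ a 2 = t
    simp only [Fin.sum_univ_three]
    generalize a 0 ⬝ᵥ a 0 = a0
    generalize a 1 ⬝ᵥ a 1 = a1
    generalize a 2 ⬝ᵥ a 2 = a2
    ext j
    fin_cases j
    · simp [planeMul, idem, dotProduct, Fin.sum_univ_two]
      linear_combination (p 0 * (a0 + a1) / 2) * h3
    · simp [planeMul, idem, dotProduct, Fin.sum_univ_two]
      ring
  · refine Finset.sum_congr rfl fun i _ => congrArg _ ?_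
    have e1 : i + 1 + 1 = i + 2 := by fin_cases i <;> rfl
    have e2 : i + 1 + 2 = i := by fin_cases i <;> rfl
    have e3 : i + 2 + 1 = i := by fin_cases i <;> rfl
    have e4 : i + 2 + 2 = i + 1 := by fin_cases i <;> rfl
    simp only [e1, e2, e3, e4, map_add, map_smul, LinearMap.add_apply, LinearMap.smul_apply,
      A.m_m_left, A.m_m_right]
    have key : (idem i ⬝ᵥ (planeMul p p + ∑ j, (a j ⬝ᵥ a j) • idem j)) + 2 * (idem i ⬝ᵥ p) ^ 2
        + 3 / 2 * (a (i + 1) ⬝ᵥ a (i + 1)) + 3 / 2 * (a (i + 2) ⬝ᵥ a (i + 2)) =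
        p ⬝ᵥ p + ∑ j, a j ⬝ᵥ a j := by
      obtain ⟨s, hs⟩ : ∃ s : Fin 3 → ℝ, ∀ j, a j ⬝ᵥ a j = s j := ⟨_, fun _ => rfl⟩
      simp only [Fin.sum_univ_three, hs]
      fin_cases i <;> simp [planeMul, idem, dotProduct, Fin.sum_univ_two]
      · linear_combination (p 0 ^ 2 / 2 + s 0 / 4 - s 1 / 4) * h3
      · linear_combination (p 0 ^ 2 / 2 + s 1 / 4 - s 0 / 4) * h3
      · ring
    have key2 : idem i ⬝ᵥ p + idem (i + 1) ⬝ᵥ p + idem (i + 2) ⬝ᵥ p = 0 := by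
      fin_cases i <;> simp [idem, dotProduct, Fin.sum_univ_two] <;> ring
    have key3 : idem (i + 1) ⬝ᵥ p = -(idem i ⬝ᵥ p) - idem (i + 2) ⬝ᵥ p := by linarith
    rw [← key, key3]
    match_scalars <;> first
      | ring1
      | linear_combination ((a (i + 1) ⬝ᵥ a (i + 1) + a (i + 2) ⬝ᵥ a (i + 2)) / 2) * h3

theorem isCartan : IsCartan T where
  symm_left := A.symm_left
  symm_right := A.symm_right
  cube := A.cube
  trace_mulLeft x := by
    obtain ⟨p, a, rfl⟩ := A.exists_eq x
    have h : ∀ i j (b c : Fin k → ℝ), A.ι j c ⬝ᵥ (mulLeft T (A.ι i b) *ᵥ A.ι j c) = 0 := by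
      intro i j b c
      by_cases hij : j = i
      · rw [hij, A.ι_mul_ι, dotProduct_smul, A.ι_dot_δ, smul_zero]
      · have : j = i + 1 ∨ j = i + 2 := by
          revert hij; revert i j; decide
        rcases this with hj | hj
        · rw [A.ι_mul_succ hj rfl, dotProduct_smul, A.ι_dot_ι_of_ne, smul_zero]
          subst hj; fin_cases i <;> decide
        · rw [A.ι_mul_pred hj rfl, dotProduct_smul, A.ι_dot_ι_of_ne, smul_zero]
          subst hj; fin_cases i <;> decide
    simp only [map_add, map_sum, Matrix.trace_add, Matrix.trace_sum]
    have h1 : ∀ i b, (mulLeft T (A.ι i b)).trace = 0 := by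
      intro i b
      rw [A.trace_eq]
      simp only [h, A.ι_mul_δ, dotProduct_smul, A.δ_dot_ι, smul_zero, Finset.sum_const_zero,
        add_zero]
    simp only [h1, Finset.sum_const_zero, add_zero]
    rw [A.trace_eq]
    simp only [A.δ_mul_δ, A.δ_dot_δ, A.δ_mul_ι, dotProduct_smul, A.ι_dot_ι,
      single_one_dotProduct, Pi.single_eq_same]
    simp [Fin.sum_univ_two, Fin.sum_univ_three, planeMul, idem, dotProduct]
    ring

end Frame

end CubicTensor

/-! ### The derivations that rotate the diagonal -/

namespace CubicTensor

variable {n k : ℕ} {T : Fin n → Fin n → Fin n → ℝ}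

theorem root_add_root_add_root {i j l : Fin 3} (hj : j = i + 1) (hl : l = i + 2) :
    root i + root j + root l = 0 := by
  subst hj hl
  have := sum_root
  fin_cases i
  · exact this
  · change root 1 + root 2 + root 0 = 0
    rw [← this]; abel
  · change root 2 + root 0 + root 1 = 0
    rw [← this]; abel

namespace Frame

/-- The derivation that maps a diagonal element `p` to the off-diagonal element `ι i a` times the
value at `p` of the root with index `i`. -/
noncomputable def G (A : Frame T k) (i : Fin 3) (a : Fin k → ℝ) : Matrix (Fin n) (Fin n) ℝ :=
  (-(1 / 3) : ℝ) • innerDer T (A.δ (root i)) (A.ι i a)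

variable (A : Frame T k)
include A

theorem G_mem (i : Fin 3) (a : Fin k → ℝ) : A.G i a ∈ skewDerivations T :=
  (skewDerivations T).smul_mem _ (A.isCartan.innerDer_mem _ _)

theorem G_δ (i : Fin 3) (a : Fin k → ℝ) (p : Fin 2 → ℝ) :
    A.G i a *ᵥ A.δ p = (root i ⬝ᵥ p) • A.ι i a := by
  have h : idem i ⬝ᵥ planeMul (root i) p = root i ⬝ᵥ p := by
    rw [dotProduct_comm, planeMul_dot, planeMul_idem_root, dotProduct_comm]
  rw [G, Matrix.smul_mulVec, innerDer_mulVec, A.ι_mul_δ, A.δ_mul_δ, A.ι_mul_δ, h,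
    Matrix.mulVec_smul, A.δ_mul_ι, idem_dot_root, A.ι_dot_δ, A.δ_dot_δ]
  module

theorem G_ι_self (i : Fin 3) (a b : Fin k → ℝ) :
    A.G i a *ᵥ A.ι i b = -(a ⬝ᵥ b) • A.δ (root i) := by
  rw [G, Matrix.smul_mulVec, innerDer_mulVec, A.ι_mul_ι, A.δ_mul_ι, Matrix.mulVec_smul, A.δ_mul_δ,
    planeMul_idem_root, idem_dot_root, A.δ_dot_ι, A.ι_dot_ι]
  simp only [zero_smul, Matrix.mulVec_zero]
  module

theorem G_ι_succ {i j l : Fin 3} (hj : j = i + 1) (hl : l = i + 2) (a b : Fin k → ℝ) :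
    A.G i a *ᵥ A.ι j b = (1 / 2 : ℝ) • A.ι l (A.m a b) := by
  have h3 := sqrt_three_sq
  have hne : i ≠ j := by subst hj; fin_cases i <;> decide
  rw [G, Matrix.smul_mulVec, innerDer_mulVec, A.ι_mul_succ hj hl, A.δ_mul_ι, Matrix.mulVec_smul,
    Matrix.mulVec_smul, A.ι_mul_succ hj hl, A.δ_mul_ι, A.δ_dot_ι, A.ι_dot_ι_of_ne _ _ _ _ hne,
    idem_succ_dot_root hj, idem_pred_dot_root hl]
  match_scalars <;> first | ring1 | linear_combination (1 / 6) * h3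

theorem G_ι_pred {i j l : Fin 3} (hj : j = i + 2) (hl : l = i + 1) (a b : Fin k → ℝ) :
    A.G i a *ᵥ A.ι j b = (-(1 / 2) : ℝ) • A.ι l (A.m b a) := by
  have h3 := sqrt_three_sq
  have hne : i ≠ j := by subst hj; fin_cases i <;> decide
  rw [G, Matrix.smul_mulVec, innerDer_mulVec, A.ι_mul_pred hj hl, A.δ_mul_ι, Matrix.mulVec_smul,
    Matrix.mulVec_smul, A.ι_mul_pred hj hl, A.δ_mul_ι, A.δ_dot_ι, A.ι_dot_ι_of_ne _ _ _ _ hne,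
    idem_succ_dot_root hl, idem_pred_dot_root hj]
  match_scalars <;> first | ring1 | linear_combination -(1 / 6) * h3

/-! The operator `G i a`, for a unit vector `a`, has the squared weights `1`, `0` and `1/4`. -/

theorem G_G_root (i : Fin 3) {a : Fin k → ℝ} (ha : a ⬝ᵥ a = 1) :
    A.G i a *ᵥ (A.G i a *ᵥ A.δ (root i)) = -(1 : ℝ) • A.δ (root i) := by
  rw [G_δ, Matrix.mulVec_smul, G_ι_self, root_dot_root, ha]
  module

theorem G_G_idem (i : Fin 3) (a : Fin k → ℝ) :
    A.G i a *ᵥ (A.G i a *ᵥ A.δ (idem i)) = -(0 : ℝ) • A.δ (idem i) := by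
  rw [G_δ, dotProduct_comm, idem_dot_root]
  simp

theorem G_G_self (i : Fin 3) {a : Fin k → ℝ} (ha : a ⬝ᵥ a = 1) :
    A.G i a *ᵥ (A.G i a *ᵥ A.ι i a) = -(1 : ℝ) • A.ι i a := by
  rw [G_ι_self, Matrix.mulVec_smul, G_δ, root_dot_root, ha]
  module

theorem G_G_orthogonal (i : Fin 3) {a b : Fin k → ℝ} (hab : a ⬝ᵥ b = 0) :
    A.G i a *ᵥ (A.G i a *ᵥ A.ι i b) = -(0 : ℝ) • A.ι i b := by
  rw [G_ι_self, hab]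
  simp

theorem G_G_of_ne {i j : Fin 3} (hij : j ≠ i) {a : Fin k → ℝ} (ha : a ⬝ᵥ a = 1) (b : Fin k → ℝ) :
    A.G i a *ᵥ (A.G i a *ᵥ A.ι j b) = -(1 / 4 : ℝ) • A.ι j b := by
  have : j = i + 1 ∨ j = i + 2 := by revert hij; revert i j; decide
  rcases this with hj | hj
  · rw [A.G_ι_succ hj rfl, Matrix.mulVec_smul, A.G_ι_pred rfl hj, A.m_m_left, ha, one_smul]
    module
  · rw [A.G_ι_pred hj rfl, Matrix.mulVec_smul, A.G_ι_succ rfl hj, A.m_m_right, ha, one_smul]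
    module

theorem m_m_add' (a b c : Fin k → ℝ) :
    A.m a (A.m b c) + A.m c (A.m b a) = (2 * (a ⬝ᵥ c)) • b := by
  have h := A.m_m_right (a + c) b
  have h1 := A.m_m_right a b
  have h2 := A.m_m_right c b
  simp only [map_add, LinearMap.add_apply, add_dotProduct, dotProduct_add] at h
  rw [dotProduct_comm c a] at h
  linear_combination (norm := module) h - h1 - h2

/-- The bracket of two of the rotations with different indices is a multiple of the third. -/
theorem commutator_G {i j l : Fin 3} (hj : j = i + 1) (hl : l = i + 2) (a b : Fin k → ℝ) :
    A.G j b * A.G i a - A.G i a * A.G j b = (1 / 2 : ℝ) • A.G l (A.m a b) := by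
  have hij : i ≠ j := by subst hj; fin_cases i <;> decide
  have jl : l = j + 1 := by subst hj hl; fin_cases i <;> rfl
  have ji : i = j + 2 := by subst hj; fin_cases i <;> rfl
  have li : i = l + 1 := by subst hl; fin_cases i <;> rfl
  have lj : j = l + 2 := by subst hj hl; fin_cases i <;> rfl
  refine A.matrix_ext (fun p => ?_) fun s c => ?_
  · have hs : root i ⬝ᵥ p + root j ⬝ᵥ p + root l ⬝ᵥ p = 0 := by
      rw [← add_dotProduct, ← add_dotProduct, root_add_root_add_root hj hl, zero_dotProduct]
    have hs' : root l ⬝ᵥ p = -(root i ⬝ᵥ p) - root j ⬝ᵥ p := by linarith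
    rw [Matrix.sub_mulVec, ← Matrix.mulVec_mulVec, ← Matrix.mulVec_mulVec, Matrix.smul_mulVec, G_δ,
      G_δ, G_δ, Matrix.mulVec_smul, Matrix.mulVec_smul, A.G_ι_pred ji jl, A.G_ι_succ hj hl, hs']
    module
  · have hs : s = i ∨ s = j ∨ s = l := by
      subst hj hl; clear hij jl ji li lj; revert s; revert i; decide
    rw [Matrix.sub_mulVec, ← Matrix.mulVec_mulVec, ← Matrix.mulVec_mulVec, Matrix.smul_mulVec]
    rcases hs with rfl | rfl | rfl
    · rw [G_ι_self, Matrix.mulVec_smul, G_δ, A.G_ι_pred ji jl, Matrix.mulVec_smul,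
        A.G_ι_pred hl hj, A.G_ι_succ li lj, root_dot_root_of_ne hij.symm]
      have h2 := congrArg (A.ι j) (A.m_m_add a b c)
      simp only [map_add, map_smul] at h2
      linear_combination (norm := module) (-(1 / 4) : ℝ) • h2
    · rw [A.G_ι_succ hj hl, Matrix.mulVec_smul, A.G_ι_succ jl ji, G_ι_self, Matrix.mulVec_smul, G_δ,
        root_dot_root_of_ne hij, A.G_ι_pred lj li]
      have h2 := congrArg (A.ι i) (A.m_m_add' b a c)
      simp only [map_add, map_smul] at h2
      linear_combination (norm := module) (1 / 4 : ℝ) • h2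
    · rw [A.G_ι_pred hl hj, Matrix.mulVec_smul, G_ι_self, A.G_ι_succ jl ji, Matrix.mulVec_smul,
        G_ι_self, G_ι_self]
      have h2 : root s = -root i - root j := by
        rw [← sub_eq_zero, ← root_add_root_add_root hj hl]; abel
      have h3 : a ⬝ᵥ A.m b c = A.m a b ⬝ᵥ c := (A.m_dot a b c).symm
      have h4 : b ⬝ᵥ A.m c a = A.m a b ⬝ᵥ c := by rw [← A.m_dot, dotProduct_comm, A.m_dot]
      rw [h2, h3, h4]
      simp only [map_sub, map_neg]
      module

end Frame

/-! ### Complementary invariant subspaces -/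

theorem trace_transpose_mul_self_eq_zero {W : Matrix (Fin n) (Fin n) ℝ}
    (h : (Wᵀ * W).trace = 0) : W = 0 := by
  have := Matrix.trace_conjTranspose_mul_self_eq_zero_iff.1
    (show (Wᴴ * W).trace = 0 by rwa [Matrix.conjTranspose_eq_transpose_of_trivial])
  exact this

/-- The subspace `U` of `⊗²ℝⁿ` is invariant under the rotations that preserve `T`. -/
def Invariant (T : Fin n → Fin n → Fin n → ℝ) (U : Submodule ℝ (Matrix (Fin n) (Fin n) ℝ)) : Prop :=
  ∀ h ∈ rotationAutomorphisms T, ∀ W ∈ U, h * W * hᵀ ∈ U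

/-- A decomposition of a space `E` of two-tensors into two orthogonal invariant subspaces. -/
structure OrthoSplit (T : Fin n → Fin n → Fin n → ℝ)
    (E U V : Submodule ℝ (Matrix (Fin n) (Fin n) ℝ)) : Prop where
  invariant_left : Invariant T U
  invariant_right : Invariant T V
  ortho : ∀ W ∈ U, ∀ Z ∈ V, (Wᵀ * Z).trace = 0
  sup_eq : U ⊔ V = E

namespace OrthoSplit

variable {E U V : Submodule ℝ (Matrix (Fin n) (Fin n) ℝ)} (s : OrthoSplit T E U V)
include s

theorem symm : OrthoSplit T E V U :=
  ⟨s.2, s.1, fun W hW Z hZ => by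
    rw [← Matrix.trace_transpose, Matrix.transpose_mul, Matrix.transpose_transpose]
    exact s.3 Z hZ W hW, by rw [sup_comm]; exact s.4⟩

theorem eq_zero {W : Matrix (Fin n) (Fin n) ℝ} (h1 : W ∈ U) (h2 : W ∈ V) : W = 0 :=
  trace_transpose_mul_self_eq_zero (s.ortho W h1 W h2)

theorem left_le : U ≤ E := s.sup_eq ▸ le_sup_left

theorem right_le : V ≤ E := s.sup_eq ▸ le_sup_right

theorem exists_add {W : Matrix (Fin n) (Fin n) ℝ} (hW : W ∈ E) :
    ∃ u ∈ U, ∃ v ∈ V, u + v = W := by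
  rw [← s.sup_eq] at hW
  exact Submodule.mem_sup.1 hW

/-- A linear relation satisfied by an element is inherited by its two components, if the relation
preserves both subspaces. -/
theorem component_eq {f g : Matrix (Fin n) (Fin n) ℝ → Matrix (Fin n) (Fin n) ℝ}
    {u v : Matrix (Fin n) (Fin n) ℝ}
    (hf : ∀ x y, f (x + y) = f x + f y) (hg : ∀ x y, g (x + y) = g x + g y)
    (fU : f u ∈ U) (fV : f v ∈ V) (gU : g u ∈ U) (gV : g v ∈ V) (h : f (u + v) = g (u + v)) :
    f u = g u := by
  rw [hf, hg] at h
  have e : f u - g u = g v - f v := by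
    rw [sub_eq_sub_iff_add_eq_add, h, add_comm]
  exact sub_eq_zero.1 (s.eq_zero (U.sub_mem fU gU) (e ▸ V.sub_mem gV fV))

theorem bracket_left {F W : Matrix (Fin n) (Fin n) ℝ} (hF : F ∈ skewDerivations T) (hW : W ∈ U) :
    F * W - W * F ∈ U := commutator_mem s.invariant_left hF hW

/-- A component of an eigenvector of `[F, [F, ·]]` is again an eigenvector. -/
theorem component_bracket_bracket {F u v : Matrix (Fin n) (Fin n) ℝ} {c : ℝ}
    (hF : F ∈ skewDerivations T) (hu : u ∈ U) (hv : v ∈ V)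
    (h : F * (F * (u + v) - (u + v) * F) - (F * (u + v) - (u + v) * F) * F = c • (u + v)) :
    F * (F * u - u * F) - (F * u - u * F) * F = c • u :=
  s.component_eq (f := fun W => F * (F * W - W * F) - (F * W - W * F) * F) (g := fun W => c • W)
    (fun x y => by noncomm_ring) (fun x y => smul_add _ _ _)
    (s.bracket_left hF (s.bracket_left hF hu))
    (s.symm.bracket_left hF (s.symm.bracket_left hF hv)) (U.smul_mem _ hu) (V.smul_mem _ hv) h

theorem component_bracket {F u v : Matrix (Fin n) (Fin n) ℝ}
    (hF : F ∈ skewDerivations T) (hu : u ∈ U) (hv : v ∈ V)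
    (h : F * (u + v) - (u + v) * F = 0) : F * u - u * F = 0 :=
  s.component_eq (f := fun W => F * W - W * F) (g := fun W => 0)
    (fun x y => by noncomm_ring) (fun x y => (add_zero _).symm)
    (s.bracket_left hF hu) (s.symm.bracket_left hF hv) U.zero_mem V.zero_mem h

end OrthoSplit

theorem invariant_orthogonal {E U : Submodule ℝ (Matrix (Fin n) (Fin n) ℝ)} (hE : Invariant T E)
    (hU : Invariant T U) (hle : U ≤ E) : ∃ V, OrthoSplit T E U V := by
  let B : LinearMap.BilinForm ℝ (Matrix (Fin n) (Fin n) ℝ) :=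
    LinearMap.mk₂ ℝ (fun W Z => (Wᵀ * Z).trace)
      (fun _ _ _ => by simp [add_mul]) (fun _ _ _ => by simp)
      (fun _ _ _ => by simp [mul_add]) (fun _ _ _ => by simp)
  have hB : ∀ W Z, B W Z = (Wᵀ * Z).trace := fun _ _ => rfl
  have hs : ∀ W Z, B W Z = B Z W := fun W Z => by
    rw [hB, hB, ← Matrix.trace_transpose, Matrix.transpose_mul, Matrix.transpose_transpose]
  have hsymm : B.IsSymm := ⟨hs⟩
  have hnd : (B.restrict U).Nondegenerate := by
    have key : ∀ W : U, (∀ Z : U, (B.restrict U) W Z = 0) → W = 0 := fun W h =>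
      Subtype.ext (trace_transpose_mul_self_eq_zero (h W))
    exact ⟨key, fun W h => key W fun Z => (hs _ _).trans (h Z)⟩
  have hc := LinearMap.BilinForm.isCompl_orthogonal_of_restrict_nondegenerate hsymm.isRefl hnd
  refine ⟨B.orthogonal U ⊓ E, hU, ?_, ?_, ?_⟩
  · rintro h hh W ⟨h1, h2⟩
    refine ⟨?_, hE h hh W h2⟩
    rw [SetLike.mem_coe, LinearMap.BilinForm.mem_orthogonal_iff] at h1 ⊢
    intro Z hZ
    have := h1 _ (hU _ (transpose_mem_rotationAutomorphisms hh) Z hZ)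
    change B _ _ = 0 at this
    change B _ _ = 0
    rw [hB] at this ⊢
    rw [← this, Matrix.transpose_transpose, Matrix.transpose_mul, Matrix.transpose_mul,
      Matrix.trace_mul_comm, mul_assoc, mul_assoc, Matrix.trace_mul_comm, mul_assoc, mul_assoc,
      mul_assoc, Matrix.trace_mul_comm W]
    simp only [mul_assoc, Matrix.transpose_transpose]
  · rintro W hW Z ⟨h1, -⟩
    exact h1 W hW
  · rw [← sup_inf_assoc_of_le _ hle, hc.sup_eq_top, top_inf_eq]

end CubicTensor

/-! ### Weights and irreducibility -/

namespace CubicTensor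

variable {n k : ℕ} {T : Fin n → Fin n → Fin n → ℝ}

theorem dotProduct_mulVec_of_skew {F : Matrix (Fin n) (Fin n) ℝ} (hF : Fᵀ = -F)
    (x y : Fin n → ℝ) : x ⬝ᵥ (F *ᵥ y) = -((F *ᵥ x) ⬝ᵥ y) := by
  rw [mulVec_dotProduct_of_skew hF, neg_neg]

theorem dotProduct_mulVec_of_symm {F : Matrix (Fin n) (Fin n) ℝ} (hF : Fᵀ = F)
    (x y : Fin n → ℝ) : x ⬝ᵥ (F *ᵥ y) = (F *ᵥ x) ⬝ᵥ y := by
  rw [Matrix.dotProduct_mulVec, ← Matrix.mulVec_transpose, hF]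

section weights

variable {G u : Matrix (Fin n) (Fin n) ℝ} {a b c : ℝ} {x y : Fin n → ℝ}

theorem two_mul_dotProduct_of_weights (hG : Gᵀ = -G)
    (hu : G * (G * u - u * G) - (G * u - u * G) * G = -c • u)
    (hx : G *ᵥ (G *ᵥ x) = -a • x) (hy : G *ᵥ (G *ᵥ y) = -b • y) :
    2 * ((G *ᵥ x) ⬝ᵥ (u *ᵥ (G *ᵥ y))) = (a + b - c) * (x ⬝ᵥ (u *ᵥ y)) := by
  have h := congrArg (fun M => x ⬝ᵥ (M *ᵥ y)) hu
  simp only [mul_sub, sub_mul, Matrix.sub_mulVec, ← Matrix.mulVec_mulVec, dotProduct_sub,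
    Matrix.smul_mulVec, dotProduct_smul, hy, Matrix.mulVec_smul] at h
  rw [dotProduct_mulVec_of_skew hG, dotProduct_mulVec_of_skew hG, hx,
    dotProduct_mulVec_of_skew hG] at h
  simp only [smul_dotProduct, smul_eq_mul] at h
  linarith

/-- If `[G, [G, u]] = -c u`, then `u` pairs two vectors on which `G²` acts by `-a` and `-b`
trivially unless `√c = |√a ± √b|`. -/
theorem dotProduct_eq_zero_of_weights (hG : Gᵀ = -G)
    (hu : G * (G * u - u * G) - (G * u - u * G) * G = -c • u)
    (hx : G *ᵥ (G *ᵥ x) = -a • x) (hy : G *ᵥ (G *ᵥ y) = -b • y)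
    (h : (a + b - c) ^ 2 ≠ 4 * (a * b)) : x ⬝ᵥ (u *ᵥ y) = 0 := by
  have h1 := two_mul_dotProduct_of_weights hG hu hx hy
  have h2 := two_mul_dotProduct_of_weights hG hu (x := G *ᵥ x) (y := G *ᵥ y) (a := a) (b := b)
    (by rw [hx, Matrix.mulVec_smul]) (by rw [hy, Matrix.mulVec_smul])
  simp only [hx, hy, Matrix.mulVec_smul, dotProduct_smul, smul_dotProduct, smul_eq_mul] at h2
  have h3 : ((a + b - c) ^ 2 - 4 * (a * b)) * (x ⬝ᵥ (u *ᵥ y)) = 0 := by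
    linear_combination (-(a + b - c)) * h1 - 2 * h2
  exact (mul_eq_zero.1 h3).resolve_left (sub_ne_zero.2 h)

end weights

theorem bracket_vecMulVec {F : Matrix (Fin n) (Fin n) ℝ} (hF : Fᵀ = -F) (x y : Fin n → ℝ) :
    F * Matrix.vecMulVec x y - Matrix.vecMulVec x y * F =
      Matrix.vecMulVec (F *ᵥ x) y + Matrix.vecMulVec x (F *ᵥ y) := by
  rw [Matrix.mul_vecMulVec, Matrix.vecMulVec_mul, ← Matrix.mulVec_transpose, hF, Matrix.neg_mulVec,
    Matrix.vecMulVec_neg, sub_neg_eq_add]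

theorem bracket_wedge {F : Matrix (Fin n) (Fin n) ℝ} (hF : Fᵀ = -F) (x y : Fin n → ℝ) :
    F * wedge x y - wedge x y * F = wedge (F *ᵥ x) y + wedge x (F *ᵥ y) := by
  have h1 := bracket_vecMulVec hF x y
  have h2 := bracket_vecMulVec hF y x
  simp only [wedge, mul_sub, sub_mul]
  linear_combination (norm := module) h1 - h2

theorem trace_transpose_mul_vecMulVec (W : Matrix (Fin n) (Fin n) ℝ) (x y : Fin n → ℝ) :
    (Wᵀ * Matrix.vecMulVec x y).trace = x ⬝ᵥ (W *ᵥ y) := by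
  rw [Matrix.mul_vecMulVec, Matrix.trace_vecMulVec, Matrix.mulVec_transpose,
    Matrix.dotProduct_mulVec]

theorem trace_transpose_mul_wedge {W : Matrix (Fin n) (Fin n) ℝ} (hW : Wᵀ = -W)
    (x y : Fin n → ℝ) : (Wᵀ * wedge x y).trace = 2 * (x ⬝ᵥ (W *ᵥ y)) := by
  rw [wedge, mul_sub, Matrix.trace_sub, trace_transpose_mul_vecMulVec,
    trace_transpose_mul_vecMulVec, dotProduct_mulVec_of_skew hW y, dotProduct_comm]
  ring

theorem trace_transpose_mul_bracket {F : Matrix (Fin n) (Fin n) ℝ} (hF : Fᵀ = -F)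
    (W Z : Matrix (Fin n) (Fin n) ℝ) :
    (Wᵀ * (F * Z - Z * F)).trace = -((F * W - W * F)ᵀ * Z).trace := by
  simp only [Matrix.transpose_sub, Matrix.transpose_mul, hF, mul_sub, sub_mul, Matrix.trace_sub,
    mul_neg, neg_mul, Matrix.trace_neg]
  rw [← mul_assoc, ← mul_assoc, Matrix.trace_mul_comm _ F, ← mul_assoc]
  ring

namespace Invariant

variable {U : Submodule ℝ (Matrix (Fin n) (Fin n) ℝ)}

theorem bracket (hU : Invariant T U) {F W : Matrix (Fin n) (Fin n) ℝ} (hF : F ∈ skewDerivations T)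
    (hW : W ∈ U) : F * W - W * F ∈ U := commutator_mem hU hF hW

end Invariant

namespace OrthoSplit

variable {U V : Submodule ℝ (Matrix (Fin n) (Fin n) ℝ)}

theorem mem_or_mem {u v w : Matrix (Fin n) (Fin n) ℝ} (hu : u ∈ U) (hv : v ∈ V) (h : u + v = w)
    {c : ℝ} (hc : u = c • w) : w ∈ U ∨ w ∈ V := by
  by_cases h0 : c = 0
  · rw [h0, zero_smul] at hc
    rw [← h, hc, zero_add]
    exact Or.inr hv
  · refine Or.inl ?_
    have := U.smul_mem c⁻¹ hu
    rwa [hc, smul_smul, inv_mul_cancel₀ h0, one_smul] at this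

end OrthoSplit

theorem exists_unit (hk : 0 < k) : ∃ a : Fin k → ℝ, a ⬝ᵥ a = 1 :=
  ⟨Pi.single ⟨0, hk⟩ 1, by simp⟩

/-- At least two of the three roots do not vanish on a diagonal element, so two nonzero diagonal
elements have a common one. -/
theorem exists_root_ne_zero {p q : Fin 2 → ℝ} (hp : p ≠ 0) (hq : q ≠ 0) :
    ∃ i, root i ⬝ᵥ p ≠ 0 ∧ root i ⬝ᵥ q ≠ 0 := by
  by_contra! hne
  have key : ∀ {p : Fin 2 → ℝ} (i j : Fin 3), i ≠ j → root i ⬝ᵥ p = 0 → root j ⬝ᵥ p = 0 →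
      p = 0 := by
    intro p i j hij hi hj
    have h3 := sqrt_three_sq
    have h0 : √3 ≠ 0 := by positivity
    fin_cases i <;> fin_cases j <;>
      simp [root, dotProduct, Fin.sum_univ_two] at hi hj hij <;> ext l <;> fin_cases l <;>
      simp <;> first
        | linarith
        | (apply mul_left_cancel₀ h0; linarith)
  by_cases h0 : root 0 ⬝ᵥ p = 0
  · have h1 := hne 1 fun h => hp (key 0 1 (by decide) h0 h)
    have h2 := hne 2 fun h => hp (key 0 2 (by decide) h0 h)
    exact hq (key 1 2 (by decide) h1 h2)
  · have h0' := hne 0 h0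
    by_cases h1 : root 1 ⬝ᵥ p = 0
    · exact hq (key 0 2 (by decide) h0' (hne 2 fun h => hp (key 1 2 (by decide) h1 h)))
    · exact hq (key 0 1 (by decide) h0' (hne 1 h1))

namespace Frame

/-- `A.IsWeight i a r x` says that `x` belongs to a certain spanning set, and that the square of
`G i a` acts on it by `-r` if `a` is a unit vector. -/
inductive IsWeight (A : Frame T k) (i : Fin 3) (a : Fin k → ℝ) : ℝ → (Fin n → ℝ) → Prop
  | root : IsWeight A i a 1 (A.δ (root i))
  | self : IsWeight A i a 1 (A.ι i a)
  | idem : IsWeight A i a 0 (A.δ (idem i))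
  | orth (b : Fin k → ℝ) (h : a ⬝ᵥ b = 0) : IsWeight A i a 0 (A.ι i b)
  | off (j : Fin 3) (h : j ≠ i) (b : Fin k → ℝ) : IsWeight A i a (1 / 4) (A.ι j b)

variable (A : Frame T k)
include A

theorem G_skew (i : Fin 3) (a : Fin k → ℝ) : (A.G i a)ᵀ = -A.G i a := (A.G_mem i a).1

variable {A} in
theorem IsWeight.G_G {i : Fin 3} {a : Fin k → ℝ} (ha : a ⬝ᵥ a = 1) {r : ℝ} {x : Fin n → ℝ}
    (hx : A.IsWeight i a r x) : A.G i a *ᵥ (A.G i a *ᵥ x) = -r • x := by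
  cases hx with
  | root => exact A.G_G_root i ha
  | self => exact A.G_G_self i ha
  | idem => exact A.G_G_idem i a
  | orth b h => exact A.G_G_orthogonal i h
  | off j h b => exact A.G_G_of_ne h ha b

theorem eq_zero_of_isWeight {i : Fin 3} {a : Fin k → ℝ} (ha : a ⬝ᵥ a = 1) {x : Fin n → ℝ}
    (h : ∀ r y, A.IsWeight i a r y → y ⬝ᵥ x = 0) : x = 0 := by
  refine dotProduct_eq_zero _ fun y => ?_
  rw [dotProduct_comm]
  obtain ⟨p, b, rfl⟩ := A.exists_eq y
  have h1 : A.δ p ⬝ᵥ x = 0 := by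
    rw [plane_eq i p, map_add, map_smul, map_smul, add_dotProduct, smul_dotProduct, smul_dotProduct,
      h _ _ .root, h _ _ .idem]
    simp
  have h2 : ∀ j c, A.ι j c ⬝ᵥ x = 0 := by
    intro j c
    by_cases hj : j = i
    · rw [hj, show c = (a ⬝ᵥ c) • a + (c - (a ⬝ᵥ c) • a) by abel, map_add, map_smul, add_dotProduct,
        smul_dotProduct, h _ _ .self, h _ _ (.orth _ _)]
      · simp
      · rw [dotProduct_sub, dotProduct_smul, ha]; simp
    · exact h _ _ (.off j hj c)
  rw [add_dotProduct, h1, sum_dotProduct]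
  simp [h2]

theorem matrix_eq_zero_of_isWeight {i : Fin 3} {a : Fin k → ℝ} (ha : a ⬝ᵥ a = 1)
    {W : Matrix (Fin n) (Fin n) ℝ}
    (h : ∀ r t x y, A.IsWeight i a r x → A.IsWeight i a t y → x ⬝ᵥ (W *ᵥ y) = 0) : W = 0 := by
  have h1 : ∀ t y, A.IsWeight i a t y → W *ᵥ y = 0 := fun t y hy =>
    A.eq_zero_of_isWeight ha fun r x hx => h r t x y hx hy
  have h2 : Wᵀ = 0 := by
    refine matrix_ext_mulVec fun z =>
      (A.eq_zero_of_isWeight (i := i) ha fun t y hy => ?_).trans (Matrix.zero_mulVec z).symm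
    rw [Matrix.mulVec_transpose, dotProduct_comm, ← Matrix.dotProduct_mulVec, h1 t y hy,
      dotProduct_zero]
  simpa using congrArg Matrix.transpose h2

theorem dotProduct_eq_zero_of_isWeight {i : Fin 3} {a : Fin k → ℝ} (ha : a ⬝ᵥ a = 1)
    {W : Matrix (Fin n) (Fin n) ℝ} {c r t : ℝ}
    (hW : A.G i a * (A.G i a * W - W * A.G i a) - (A.G i a * W - W * A.G i a) * A.G i a = -c • W)
    {x y : Fin n → ℝ} (hx : A.IsWeight i a r x) (hy : A.IsWeight i a t y)
    (h : (r + t - c) ^ 2 ≠ 4 * (r * t)) : x ⬝ᵥ (W *ᵥ y) = 0 :=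
  dotProduct_eq_zero_of_weights (A.G_skew i a) hW (hx.G_G ha) (hy.G_G ha) h

theorem ι_injective (i : Fin 3) : Function.Injective (A.ι i) := by
  refine (injective_iff_map_eq_zero _).2 fun a h => ?_
  have := A.ι_dot_ι i a a
  rw [h, zero_dotProduct] at this
  exact dotProduct_self_eq_zero.1 this.symm

/-- Every vector is conjugate to a diagonal one. -/
theorem exists_conj_diagonal (x : Fin n → ℝ) :
    ∃ h ∈ rotationAutomorphisms T, ∃ p, h *ᵥ x = A.δ p := by
  -- None of the three roots vanishes on the diagonal element `(1, 3)`.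
  obtain ⟨h, hh, hF⟩ := exists_orthogonal_tangent (T := T) x (A.δ ![1, 3])
  refine ⟨h, hh, ?_⟩
  obtain ⟨p, a, hp⟩ := A.exists_eq (h *ᵥ x)
  refine ⟨p, ?_⟩
  have hr : ∀ i, root i ⬝ᵥ ![1, 3] ≠ 0 := by
    have h3 := sqrt_three_sq
    intro i hi
    fin_cases i <;> simp [root, dotProduct, Fin.sum_univ_two] at hi <;> nlinarith
  have ha : ∀ i, a i = 0 := by
    intro i
    have h1 := hF _ (A.G_mem i (a i))
    rw [A.G_δ, dotProduct_smul, hp, add_dotProduct, A.δ_dot_ι, sum_dotProduct,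
      Finset.sum_eq_single i (fun j _ hj => A.ι_dot_ι_of_ne _ _ _ _ hj) (by simp), A.ι_dot_ι,
      zero_add, smul_eq_mul] at h1
    exact dotProduct_self_eq_zero.1 ((mul_eq_zero.1 h1).resolve_left (hr i))
  rw [hp]
  simp [ha]

/-- The representation on `ℝⁿ` is irreducible: the diagonal elements contained in two invariant
subspaces are mapped to the same line by one of the operators `G i a`. -/
theorem eq_bot_of_split_mulLeft (hk : 0 < k) {U V : Submodule ℝ (Matrix (Fin n) (Fin n) ℝ)}
    (s : OrthoSplit T (LinearMap.range (mulLeft T)) U V) : U = ⊥ ∨ V = ⊥ := by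
  have hT := A.isCartan
  have key : ∀ {U V}, OrthoSplit T (LinearMap.range (mulLeft T)) U V → U ≠ ⊥ →
      ∃ p ≠ 0, mulLeft T (A.δ p) ∈ U := by
    intro U V s hU
    obtain ⟨W, hW, h0⟩ := Submodule.exists_mem_ne_zero_of_ne_bot hU
    obtain ⟨x, rfl⟩ := s.left_le hW
    obtain ⟨h, hh, p, hp⟩ := A.exists_conj_diagonal x
    refine ⟨p, ?_, ?_⟩
    · rintro rfl
      rw [map_zero] at hp
      have : x = 0 := by
        rw [← Matrix.one_mulVec x, ← hh.1, ← Matrix.mulVec_mulVec, hp, Matrix.mulVec_zero]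
      exact h0 (by rw [this, map_zero])
    · rw [← hp, mulLeft_mulVec_of_mem hh]
      exact s.invariant_left h hh _ hW
  by_contra! hne
  obtain ⟨p, hp, hpU⟩ := key s hne.1
  obtain ⟨q, hq, hqV⟩ := key s.symm hne.2
  obtain ⟨i, hpi, hqi⟩ := exists_root_ne_zero hp hq
  obtain ⟨a, ha⟩ := exists_unit hk
  have hG := A.G_mem i a
  have mem : ∀ {U p}, Invariant T U → root i ⬝ᵥ p ≠ 0 → mulLeft T (A.δ p) ∈ U →
      mulLeft T (A.ι i a) ∈ U := by
    intro U p hU h0 hp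
    have := U.smul_mem (root i ⬝ᵥ p)⁻¹ (hU.bracket hG hp)
    rwa [commutator_of_mem hG, A.G_δ, map_smul, smul_smul, inv_mul_cancel₀ h0, one_smul] at this
  have h0 := s.eq_zero (mem s.invariant_left hpi hpU) (mem s.invariant_right hqi hqV)
  have h1 : A.ι i a = 0 := hT.mulLeft_injective (by rw [h0, map_zero])
  have h2 := A.ι_dot_ι i a a
  rw [h1, ha, zero_dotProduct] at h2
  exact zero_ne_one h2

end Frame

end CubicTensor

/-! ### Irreducibility of the symmetric tensors with vanishing trace and contraction -/

namespace CubicTensor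

variable {n k : ℕ} {T : Fin n → Fin n → Fin n → ℝ}

theorem eq_zero_of_symm_of_dotProduct {W : Matrix (Fin n) (Fin n) ℝ} (hW : Wᵀ = W)
    (h : ∀ x, x ⬝ᵥ (W *ᵥ x) = 0) : W = 0 := by
  refine matrix_ext_mulVec fun y => ?_
  rw [Matrix.zero_mulVec]
  refine dotProduct_eq_zero _ fun x => ?_
  have h1 := h (x + y)
  rw [Matrix.mulVec_add, add_dotProduct, dotProduct_add, dotProduct_add, h, h,
    dotProduct_mulVec_of_symm hW y x, dotProduct_comm x] at h1
  linarith

theorem conj_dotProduct {h W : Matrix (Fin n) (Fin n) ℝ} (hh : hᵀ * h = 1) (x y : Fin n → ℝ) :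
    (h *ᵥ x) ⬝ᵥ ((h * W * hᵀ) *ᵥ (h *ᵥ y)) = x ⬝ᵥ (W *ᵥ y) := by
  rw [Matrix.mulVec_mulVec, mul_assoc, hh, mul_one, ← Matrix.mulVec_mulVec,
    mulVec_dotProduct_mulVec hh]

theorem planeMul_root_root (i : Fin 3) : planeMul (root i) (root i) = idem i := by
  have := sqrt_three_sq
  ext j
  fin_cases i <;> fin_cases j <;> simp [root, idem, planeMul] <;> try linarith

theorem exists_idem_ne {i j : Fin 3} (h : i ≠ j) : ∃ p, idem i ⬝ᵥ p ≠ idem j ⬝ᵥ p := by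
  by_contra! hp
  have h1 := hp (root i)
  have h2 := hp (root j)
  rw [idem_dot_root] at h1
  have h0 : √3 ≠ 0 := by positivity
  have : j = i + 1 ∨ j = i + 2 := by clear hp h1 h2; revert h; revert i j; decide
  rcases this with hj | hj
  · rw [idem_succ_dot_root hj] at h1
    exact h0 (by linarith)
  · rw [idem_pred_dot_root hj] at h1
    exact h0 (by linarith)

theorem trace_transpose_mul_comm (W Z : Matrix (Fin n) (Fin n) ℝ) :
    (Wᵀ * Z).trace = (Zᵀ * W).trace := by
  rw [← Matrix.trace_transpose, Matrix.transpose_mul, Matrix.transpose_transpose]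

theorem trace_transpose_mul_bracket_self {F : Matrix (Fin n) (Fin n) ℝ} (hF : Fᵀ = -F)
    (W : Matrix (Fin n) (Fin n) ℝ) : (Wᵀ * (F * W - W * F)).trace = 0 := by
  have h1 := trace_transpose_mul_bracket hF W W
  have h2 := trace_transpose_mul_comm (F * W - W * F) W
  linarith

namespace Frame

/-- The difference of the squares of two orthogonal unit vectors rotated into each other by
`G i a`. -/
noncomputable def symmWeight (A : Frame T k) (i : Fin 3) (a : Fin k → ℝ) :
    Matrix (Fin n) (Fin n) ℝ :=
  Matrix.vecMulVec (A.δ (root i)) (A.δ (root i)) - Matrix.vecMulVec (A.ι i a) (A.ι i a)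

variable (A : Frame T k)
include A

theorem symmWeight_mem (hn : 3 ≤ n) (i : Fin 3) {a : Fin k → ℝ} (ha : a ⬝ᵥ a = 1) :
    A.symmWeight i a ∈ (hatEndomorphism T).eigenspace 4 := by
  have hT := A.isCartan
  rw [hT.mem_eigenspace_four hn]
  refine ⟨?_, ?_, ?_⟩
  · simp [symmWeight, Matrix.transpose_vecMulVec]
  · rw [symmWeight, Matrix.trace_sub, Matrix.trace_vecMulVec, Matrix.trace_vecMulVec, A.δ_dot_δ,
      root_dot_root, A.ι_dot_ι, ha, sub_self]
  · rw [symmWeight, map_sub, hT.contract_vecMulVec, hT.contract_vecMulVec, A.δ_mul_δ,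
      planeMul_root_root, A.ι_mul_ι, ha, one_smul, sub_self]

theorem bracket_symmWeight (i : Fin 3) {a : Fin k → ℝ} (ha : a ⬝ᵥ a = 1) :
    A.G i a * A.symmWeight i a - A.symmWeight i a * A.G i a =
      (2 : ℝ) • (Matrix.vecMulVec (A.ι i a) (A.δ (root i))
        + Matrix.vecMulVec (A.δ (root i)) (A.ι i a)) := by
  have h1 := bracket_vecMulVec (A.G_skew i a) (A.δ (root i)) (A.δ (root i))
  have h2 := bracket_vecMulVec (A.G_skew i a) (A.ι i a) (A.ι i a)
  rw [G_δ, root_dot_root, one_smul] at h1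
  rw [G_ι_self, ha, neg_smul, one_smul, Matrix.neg_vecMulVec, Matrix.vecMulVec_neg] at h2
  simp only [symmWeight, mul_sub, sub_mul]
  linear_combination (norm := module) h1 - h2

theorem bracket_bracket_symmWeight (i : Fin 3) {a : Fin k → ℝ} (ha : a ⬝ᵥ a = 1) :
    A.G i a * (A.G i a * A.symmWeight i a - A.symmWeight i a * A.G i a)
      - (A.G i a * A.symmWeight i a - A.symmWeight i a * A.G i a) * A.G i a =
      -(4 : ℝ) • A.symmWeight i a := by
  rw [A.bracket_symmWeight i ha]
  have h1 := bracket_vecMulVec (A.G_skew i a) (A.ι i a) (A.δ (root i))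
  have h2 := bracket_vecMulVec (A.G_skew i a) (A.δ (root i)) (A.ι i a)
  rw [G_δ, G_ι_self, ha, neg_smul, one_smul, root_dot_root, one_smul, Matrix.neg_vecMulVec] at h1
  rw [G_δ, G_ι_self, ha, neg_smul, one_smul, root_dot_root, one_smul, Matrix.vecMulVec_neg] at h2
  simp only [Matrix.mul_smul, Matrix.smul_mul, mul_add, add_mul, symmWeight]
  linear_combination (norm := module) (2 : ℝ) • (h1 + h2)

theorem trace_transpose_mul_symmWeight (W : Matrix (Fin n) (Fin n) ℝ) (i : Fin 3) (a : Fin k → ℝ) :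
    (Wᵀ * A.symmWeight i a).trace =
      A.δ (root i) ⬝ᵥ (W *ᵥ A.δ (root i)) - A.ι i a ⬝ᵥ (W *ᵥ A.ι i a) := by
  rw [symmWeight, mul_sub, Matrix.trace_sub, trace_transpose_mul_vecMulVec,
    trace_transpose_mul_vecMulVec]

theorem symmWeight_not_orthogonal (i j : Fin 3) (a b : Fin k → ℝ) :
    ((A.symmWeight i a)ᵀ * A.symmWeight j b).trace ≠ 0 := by
  have h : 0 < root i ⬝ᵥ root j * root i ⬝ᵥ root j := by
    by_cases hij : i = j
    · rw [hij, root_dot_root]; norm_num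
    · rw [root_dot_root_of_ne hij]; norm_num
  rw [trace_transpose_mul_symmWeight]
  simp only [symmWeight, Matrix.sub_mulVec, Matrix.vecMulVec_mulVec, op_smul_eq_smul, A.δ_dot_δ,
    A.ι_dot_δ, A.δ_dot_ι, zero_smul, sub_zero, zero_sub, dotProduct_smul, dotProduct_neg,
    smul_eq_mul]
  rw [dotProduct_comm (root j), dotProduct_comm (A.ι j b)]
  have := mul_self_nonneg (A.ι i a ⬝ᵥ A.ι j b)
  linarith

/-- Each `symmWeight i a` lies in one of the two summands: its components have the weight `2` for
`G i a` as well, which determines them up to a factor. -/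
theorem symmWeight_mem_or_mem (hn : 3 ≤ n) {U V : Submodule ℝ (Matrix (Fin n) (Fin n) ℝ)}
    (s : OrthoSplit T ((hatEndomorphism T).eigenspace 4) U V) (i : Fin 3) {a : Fin k → ℝ}
    (ha : a ⬝ᵥ a = 1) : A.symmWeight i a ∈ U ∨ A.symmWeight i a ∈ V := by
  have hT := A.isCartan
  obtain ⟨u, hu, v, hv, huv⟩ := s.exists_add (A.symmWeight_mem hn i ha)
  have hw := A.bracket_bracket_symmWeight i ha
  rw [← huv] at hw
  have hu2 := s.component_bracket_bracket (A.G_mem i a) hu hv hw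
  have hsymm := ((hT.mem_eigenspace_four hn).1 (s.left_le hu)).1
  -- The component is orthogonal to the bracket, since `G i a` acts by a skew-symmetric operator.
  have h0 : A.δ (root i) ⬝ᵥ (u *ᵥ A.ι i a) = 0 := by
    have h1 := trace_transpose_mul_bracket_self (A.G_skew i a) u
    have h2 : (uᵀ * (A.G i a * v - v * A.G i a)).trace = 0 :=
      s.ortho _ hu _ (s.symm.bracket_left (A.G_mem i a) hv)
    have h3 := congrArg (fun M => (uᵀ * M).trace) (A.bracket_symmWeight i ha)
    rw [← huv] at h3
    simp only [mul_add, add_mul, mul_sub, Matrix.trace_sub, Matrix.trace_add, Matrix.mul_smul,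
      Matrix.trace_smul, trace_transpose_mul_vecMulVec, smul_eq_mul] at h1 h2 h3
    rw [dotProduct_mulVec_of_symm hsymm (A.ι i a), dotProduct_comm (u *ᵥ A.ι i a)] at h3
    linarith
  refine OrthoSplit.mem_or_mem hu hv huv (c := A.δ (root i) ⬝ᵥ (u *ᵥ A.δ (root i))) ?_
  rw [← sub_eq_zero]
  set c := A.δ (root i) ⬝ᵥ (u *ᵥ A.δ (root i)) with hc
  have h1 := two_mul_dotProduct_of_weights (A.G_skew i a) hu2 (A.G_G_root i ha) (A.G_G_root i ha)
  rw [G_δ, root_dot_root, one_smul, ← hc] at h1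
  have hW : ∀ x y, x ⬝ᵥ (A.symmWeight i a *ᵥ y) =
      (A.δ (root i) ⬝ᵥ y) * (x ⬝ᵥ A.δ (root i)) - (A.ι i a ⬝ᵥ y) * (x ⬝ᵥ A.ι i a) := by
    intro x y
    simp [symmWeight, Matrix.sub_mulVec, Matrix.vecMulVec_mulVec, dotProduct_smul]
  have hw2 := A.bracket_bracket_symmWeight i ha
  have hW2 : A.G i a * (A.G i a * (u - c • A.symmWeight i a)
      - (u - c • A.symmWeight i a) * A.G i a)
      - (A.G i a * (u - c • A.symmWeight i a) - (u - c • A.symmWeight i a) * A.G i a) * A.G i a =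
      -(4 : ℝ) • (u - c • A.symmWeight i a) := by
    simp only [mul_sub, sub_mul, Matrix.mul_smul, Matrix.smul_mul] at hu2 hw2 ⊢
    linear_combination (norm := module) hu2 - c • hw2
  refine A.matrix_eq_zero_of_isWeight (i := i) ha fun r t x y hx hy => ?_
  have h2 := A.dotProduct_eq_zero_of_isWeight ha hW2 hx hy
  cases hx <;> cases hy <;> try (apply h2; norm_num; done)
  · rw [Matrix.sub_mulVec, Matrix.smul_mulVec, dotProduct_sub, dotProduct_smul, hW, A.δ_dot_δ,
      root_dot_root, A.ι_dot_δ, ← hc]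
    simp
  · rw [Matrix.sub_mulVec, Matrix.smul_mulVec, dotProduct_sub, dotProduct_smul, hW, A.δ_dot_ι,
      h0]
    simp
  · rw [Matrix.sub_mulVec, Matrix.smul_mulVec, dotProduct_sub, dotProduct_smul, hW, A.ι_dot_δ,
      dotProduct_mulVec_of_symm hsymm, dotProduct_comm, h0]
    simp
  · rw [Matrix.sub_mulVec, Matrix.smul_mulVec, dotProduct_sub, dotProduct_smul, hW, A.ι_dot_δ,
      A.ι_dot_ι, ha, A.δ_dot_ι, smul_eq_mul]
    linarith

/-- If a trace-free symmetric tensor with vanishing contraction is orthogonal to the tensors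
`symmWeight i a`, its quadratic form vanishes on the diagonal. -/
theorem δ_dot_mulVec_δ_eq_zero (hk : 0 < k) (hn : 3 ≤ n) {W : Matrix (Fin n) (Fin n) ℝ}
    (hW : W ∈ (hatEndomorphism T).eigenspace 4)
    (h : ∀ i a, a ⬝ᵥ a = 1 → (Wᵀ * A.symmWeight i a).trace = 0) (p : Fin 2 → ℝ) :
    A.δ p ⬝ᵥ (W *ᵥ A.δ p) = 0 := by
  have hT := A.isCartan
  obtain ⟨hs, htr, hc⟩ := (hT.mem_eigenspace_four hn).1 hW
  have h3 := sqrt_three_sq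
  set α : Fin 3 → ℝ := fun i => A.δ (root i) ⬝ᵥ (W *ᵥ A.δ (root i)) with hα
  have hι : ∀ i a, a ⬝ᵥ a = 1 → A.ι i a ⬝ᵥ (W *ᵥ A.ι i a) = α i := by
    intro i a ha
    have := h i a ha
    rw [trace_transpose_mul_symmWeight] at this
    linarith
  have hι' : ∀ i c, A.ι i (Pi.single c 1) ⬝ᵥ (W *ᵥ A.ι i (Pi.single c 1)) = α i := fun i c =>
    hι i _ (by simp)
  -- The quadratic form of `W` on the diagonal is given by three coefficients, which vanish by the
  -- three linear equations that express that the trace and the contraction are zero.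
  set w : Fin 2 → Fin 2 → ℝ := fun i j => A.δ (Pi.single i 1) ⬝ᵥ (W *ᵥ A.δ (Pi.single j 1)) with hw
  have hw' : ∀ p q, A.δ p ⬝ᵥ (W *ᵥ A.δ q) =
      p 0 * q 0 * w 0 0 + (p 0 * q 1 + p 1 * q 0) * w 0 1 + p 1 * q 1 * w 1 1 := by
    intro p q
    have h10 : w 1 0 = w 0 1 := by
      simp only [hw]
      rw [dotProduct_mulVec_of_symm hs, dotProduct_comm]
    conv_lhs => rw [eq_sum_single p, eq_sum_single q]
    simp only [Fin.sum_univ_two, map_add, map_smul, Matrix.mulVec_add, Matrix.mulVec_smul,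
      add_dotProduct, dotProduct_add, smul_dotProduct, dotProduct_smul, smul_eq_mul]
    change q 0 * (p 0 * w 0 0 + p 1 * w 1 0) + q 1 * (p 0 * w 0 1 + p 1 * w 1 1) = _
    rw [h10]
    ring
  have hα' : ∀ i, α i = root i 0 * root i 0 * w 0 0 + 2 * (root i 0 * root i 1) * w 0 1
      + root i 1 * root i 1 * w 1 1 := by
    intro i
    rw [hα]
    dsimp only
    rw [hw']
    ring
  have h0 := hα' 0
  have h1 := hα' 1
  have h2 := hα' 2
  simp [root] at h0 h1 h2
  have hk' : (0 : ℝ) < k := by exact_mod_cast hk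
  have tr0 : w 0 0 + w 1 1 + k * (α 0 + α 1 + α 2) = 0 := by
    rw [A.trace_eq] at htr
    simp only [hι', Fin.sum_univ_two, Fin.sum_univ_three, Finset.sum_const, Finset.card_univ,
      Fintype.card_fin, nsmul_eq_mul] at htr
    linear_combination htr
  have tr1 : ∀ q, A.δ ![1, 0] ⬝ᵥ (W *ᵥ A.δ (planeMul q ![1, 0]))
      + A.δ ![0, 1] ⬝ᵥ (W *ᵥ A.δ (planeMul q ![0, 1]))
      + k * (idem 0 ⬝ᵥ q * α 0 + idem 1 ⬝ᵥ q * α 1 + idem 2 ⬝ᵥ q * α 2) = 0 := by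
    intro q
    have h := hT.contract_dotProduct W (A.δ q)
    rw [hc, zero_dotProduct, A.trace_eq] at h
    simp only [← Matrix.mulVec_mulVec, A.δ_mul_δ, A.δ_mul_ι, Matrix.mulVec_smul, dotProduct_smul,
      hι', Fin.sum_univ_two, Fin.sum_univ_three, Finset.sum_const, Finset.card_univ,
      Fintype.card_fin, nsmul_eq_mul, smul_eq_mul] at h
    have e0 : (Pi.single 0 1 : Fin 2 → ℝ) = ![1, 0] := by ext i; fin_cases i <;> rfl
    have e1 : (Pi.single 1 1 : Fin 2 → ℝ) = ![0, 1] := by ext i; fin_cases i <;> rfl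
    rw [e0, e1] at h
    linear_combination -h
  have t0 := tr1 ![1, 0]
  have t1 := tr1 ![0, 1]
  rw [hw', hw'] at t0 t1
  simp [planeMul, idem, dotProduct, Fin.sum_univ_two] at t0 t1
  simp only [h0, h1, h2] at tr0 t0 t1
  have z01 : w 0 1 = 0 := by
    have : (2 + 3 / 2 * k : ℝ) * w 0 1 = 0 := by
      linear_combination t0 - k / 2 * w 0 1 * h3
    exact (mul_eq_zero.1 this).resolve_left (by positivity)
  have zp : w 0 0 + w 1 1 = 0 := by
    have : (1 + 3 / 2 * k : ℝ) * (w 0 0 + w 1 1) = 0 := by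
      linear_combination tr0 - k / 2 * w 1 1 * h3
    exact (mul_eq_zero.1 this).resolve_left (by positivity)
  have zm : w 0 0 - w 1 1 = 0 := by
    have : (1 + 3 / 4 * k : ℝ) * (w 0 0 - w 1 1) = 0 := by
      linear_combination t1 + k / 4 * w 1 1 * h3
    exact (mul_eq_zero.1 this).resolve_left (by positivity)
  rw [hw', z01, show w 0 0 = 0 by linarith, show w 1 1 = 0 by linarith]
  ring

/-- The eigenspace for `4` is irreducible: the tensors `symmWeight i a` are never orthogonal to each
other, so that they all lie in the same summand, and the quadratic forms of the elements of the
other one vanish on the diagonal, to which every vector is conjugate. -/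
theorem eq_bot_of_split_four (hk : 0 < k) (hn : 3 ≤ n)
    {U V : Submodule ℝ (Matrix (Fin n) (Fin n) ℝ)}
    (s : OrthoSplit T ((hatEndomorphism T).eigenspace 4) U V) : U = ⊥ ∨ V = ⊥ := by
  have key : ∀ {U V}, OrthoSplit T ((hatEndomorphism T).eigenspace 4) U V →
      (∀ i a, a ⬝ᵥ a = 1 → A.symmWeight i a ∈ U) → V = ⊥ := by
    intro U V s hU
    rw [Submodule.eq_bot_iff]
    intro W hW
    have hs := ((A.isCartan.mem_eigenspace_four hn).1 (s.right_le hW)).1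
    refine eq_zero_of_symm_of_dotProduct hs fun x => ?_
    obtain ⟨h, hh, p, hp⟩ := A.exists_conj_diagonal x
    have hW' := s.invariant_right h hh W hW
    rw [← conj_dotProduct hh.1, hp]
    exact A.δ_dot_mulVec_δ_eq_zero hk hn (s.right_le hW')
      (fun i a ha => s.symm.ortho _ hW' _ (hU i a ha)) p
  obtain ⟨a, ha⟩ := exists_unit hk
  rcases A.symmWeight_mem_or_mem hn s 0 ha with h | h
  · refine Or.inr (key s fun i b hb =>
      (A.symmWeight_mem_or_mem hn s i hb).resolve_right fun h' => ?_)
    exact A.symmWeight_not_orthogonal 0 i a b (s.ortho _ h _ h')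
  · refine Or.inl (key s.symm fun i b hb =>
      (A.symmWeight_mem_or_mem hn s i hb).resolve_left fun h' => ?_)
    exact A.symmWeight_not_orthogonal 0 i a b (s.symm.ortho _ h _ h')

/-! ### Derivations and the diagonal -/

/-- A derivation maps the diagonal element `idem i` to elements without component of index `i`. -/
theorem ι_dot_mulVec_idem {F : Matrix (Fin n) (Fin n) ℝ} (hF : F ∈ skewDerivations T) (i : Fin 3)
    (b : Fin k → ℝ) : A.ι i b ⬝ᵥ (F *ᵥ A.δ (idem i)) = 0 := by
  have h := congrArg (A.ι i b ⬝ᵥ ·) (hF.2 (A.δ (idem i)) (A.δ (idem i)))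
  rw [A.mul_comm (F *ᵥ _), A.δ_mul_δ, planeMul_idem_idem, map_neg, Matrix.mulVec_neg,
    dotProduct_neg, dotProduct_add,
    dotProduct_mulVec_of_symm (A.isCartan.transpose_mulLeft _), A.δ_mul_ι, idem_dot_idem, one_smul] at h
  linarith

/-- A derivation that annihilates the diagonal elements preserves the three off-diagonal spaces. -/
theorem ι_dot_mulVec_ι_of_ne {F : Matrix (Fin n) (Fin n) ℝ} (hF : F ∈ skewDerivations T)
    (hδ : ∀ p, F *ᵥ A.δ p = 0) {i j : Fin 3} (hij : i ≠ j) (b c : Fin k → ℝ) :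
    A.ι i b ⬝ᵥ (F *ᵥ A.ι j c) = 0 := by
  obtain ⟨p, hp⟩ := exists_idem_ne hij
  have h := congrArg (A.ι i b ⬝ᵥ ·) (hF.2 (A.δ p) (A.ι j c))
  rw [hδ, map_zero, Matrix.zero_mulVec, zero_add, A.δ_mul_ι,
    dotProduct_mulVec_of_symm (A.isCartan.transpose_mulLeft _), A.δ_mul_ι, Matrix.mulVec_smul,
    dotProduct_smul, smul_dotProduct, smul_eq_mul, smul_eq_mul, ← sub_eq_zero, ← sub_mul] at h
  exact (mul_eq_zero.1 h).resolve_left (sub_ne_zero.2 hp.symm)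

end Frame

end CubicTensor

/-! ### Irreducibility of the derivations -/

namespace CubicTensor

variable {n k : ℕ} {T : Fin n → Fin n → Fin n → ℝ}

theorem dotProduct_mulVec_self_of_skew {F : Matrix (Fin n) (Fin n) ℝ} (hF : Fᵀ = -F)
    (x : Fin n → ℝ) : x ⬝ᵥ (F *ᵥ x) = 0 := by
  have h := dotProduct_mulVec_of_skew hF x x
  rw [dotProduct_comm (F *ᵥ x)] at h
  linarith

namespace Frame

variable (A : Frame T k)
include A

theorem eq_zero_of_dotProduct {x : Fin n → ℝ} (h1 : ∀ p, A.δ p ⬝ᵥ x = 0)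
    (h2 : ∀ i a, A.ι i a ⬝ᵥ x = 0) : x = 0 := by
  refine dotProduct_eq_zero _ fun y => ?_
  obtain ⟨p, b, rfl⟩ := A.exists_eq y
  rw [dotProduct_comm, add_dotProduct, h1, sum_dotProduct]
  simp [h2]

theorem δ_dotProduct_eq_zero {x : Fin n → ℝ} (i : Fin 3) (h1 : A.δ (root i) ⬝ᵥ x = 0)
    (h2 : A.δ (idem i) ⬝ᵥ x = 0) (p : Fin 2 → ℝ) : A.δ p ⬝ᵥ x = 0 := by
  rw [plane_eq i p, map_add, map_smul, map_smul, add_dotProduct, smul_dotProduct, smul_dotProduct,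
    h1, h2]
  simp

theorem ι_dotProduct_eq_zero {x : Fin n → ℝ} (i : Fin 3) {a : Fin k → ℝ} (ha : a ⬝ᵥ a = 1)
    (h1 : A.ι i a ⬝ᵥ x = 0) (h2 : ∀ b, a ⬝ᵥ b = 0 → A.ι i b ⬝ᵥ x = 0) (b : Fin k → ℝ) :
    A.ι i b ⬝ᵥ x = 0 := by
  rw [show b = (a ⬝ᵥ b) • a + (b - (a ⬝ᵥ b) • a) by abel, map_add, map_smul, add_dotProduct,
    smul_dotProduct, h1, h2 _ (by rw [dotProduct_sub, dotProduct_smul, ha]; simp)]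
  simp

theorem G_ne_zero (i : Fin 3) {a : Fin k → ℝ} (ha : a ⬝ᵥ a = 1) : A.G i a ≠ 0 := by
  intro h
  have h1 := A.G_δ i a (root i)
  rw [h, Matrix.zero_mulVec, root_dot_root, one_smul] at h1
  have h2 := A.ι_dot_ι i a a
  rw [← h1, zero_dotProduct, ha] at h2
  exact zero_ne_one h2

theorem bracket_bracket_G {i j : Fin 3} (hij : j ≠ i) (a : Fin k → ℝ) {b : Fin k → ℝ}
    (hb : b ⬝ᵥ b = 1) :
    A.G j b * (A.G j b * A.G i a - A.G i a * A.G j b)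
      - (A.G j b * A.G i a - A.G i a * A.G j b) * A.G j b = -(1 / 4 : ℝ) • A.G i a := by
  have : j = i + 1 ∨ j = i + 2 := by revert hij; revert i j; decide
  rcases this with hj | hj
  · obtain ⟨l, hl⟩ : ∃ l, l = i + 2 := ⟨_, rfl⟩
    have jl : l = j + 1 := by subst hj hl; fin_cases i <;> rfl
    have ji : i = j + 2 := by subst hj; fin_cases i <;> rfl
    have h := A.commutator_G jl ji b (A.m a b)
    rw [A.m_m_right, hb, one_smul] at h
    rw [A.commutator_G hj hl, Matrix.mul_smul, Matrix.smul_mul]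
    linear_combination (norm := module) (-(1 / 2) : ℝ) • h
  · obtain ⟨l, hl⟩ : ∃ l, l = i + 1 := ⟨_, rfl⟩
    have ji : i = j + 1 := by subst hj; fin_cases i <;> rfl
    have jl : l = j + 2 := by subst hj hl; fin_cases i <;> rfl
    have lj : j = l + 1 := by subst hj hl; fin_cases i <;> rfl
    have li : i = l + 2 := by subst hl; fin_cases i <;> rfl
    have h1 := A.commutator_G ji jl b a
    have h := A.commutator_G lj li (A.m b a) b
    rw [A.m_m_left, hb, one_smul] at h
    rw [← neg_sub (A.G i a * A.G j b), h1, mul_neg, neg_mul, Matrix.mul_smul, Matrix.smul_mul]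
    linear_combination (norm := module) (-(1 / 2) : ℝ) • h

/-- A derivation with the same brackets with the rotations as `G i a` is a multiple of it. -/
theorem eq_smul_G {F : Matrix (Fin n) (Fin n) ℝ} (hF : F ∈ skewDerivations T) (i : Fin 3)
    {a : Fin k → ℝ} (ha : a ⬝ᵥ a = 1) (h0 : A.G i a * F - F * A.G i a = 0)
    (h : ∀ j b, j ≠ i → b ⬝ᵥ b = 1 → A.G j b * (A.G j b * F - F * A.G j b)
      - (A.G j b * F - F * A.G j b) * A.G j b = -(1 / 4 : ℝ) • F) :
    F = (A.ι i a ⬝ᵥ (F *ᵥ A.δ (root i))) • A.G i a := by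
  set c := A.ι i a ⬝ᵥ (F *ᵥ A.δ (root i)) with hc
  rw [← sub_eq_zero]
  obtain ⟨D, hD⟩ : ∃ D, D = F - c • A.G i a := ⟨_, rfl⟩
  have hDer : D ∈ skewDerivations T :=
    hD ▸ (skewDerivations T).sub_mem hF ((skewDerivations T).smul_mem _ (A.G_mem i a))
  have hs := hDer.1
  have hD0 : A.G i a * (A.G i a * D - D * A.G i a) - (A.G i a * D - D * A.G i a) * A.G i a =
      -(0 : ℝ) • D := by
    have : A.G i a * D - D * A.G i a = 0 := by
      rw [hD, mul_sub, sub_mul, Matrix.mul_smul, Matrix.smul_mul]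
      linear_combination (norm := module) h0
    rw [this]
    simp
  have hD4 : ∀ j b, j ≠ i → b ⬝ᵥ b = 1 → A.G j b * (A.G j b * D - D * A.G j b)
      - (A.G j b * D - D * A.G j b) * A.G j b = -(1 / 4 : ℝ) • D := by
    intro j b hj hb
    have h1 := h j b hj hb
    have h2 := A.bracket_bracket_G hj a hb
    simp only [hD, mul_sub, sub_mul, Matrix.mul_smul, Matrix.smul_mul] at h1 h2 ⊢
    linear_combination (norm := module) h1 - c • h2
  have w : ∀ {r t x y}, A.IsWeight i a r x → A.IsWeight i a t y → r ≠ t → x ⬝ᵥ (D *ᵥ y) = 0 := by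
    intro r t x y hx hy hrt
    refine A.dotProduct_eq_zero_of_isWeight ha hD0 hx hy fun e => hrt ?_
    have : (r - t) ^ 2 = 0 := by linear_combination e
    linarith [pow_eq_zero_iff (two_ne_zero) |>.1 this]
  have hroot : A.ι i a ⬝ᵥ (D *ᵥ A.δ (root i)) = 0 := by
    rw [hD, Matrix.sub_mulVec, Matrix.smul_mulVec, G_δ, root_dot_root, one_smul, dotProduct_sub,
      dotProduct_smul, A.ι_dot_ι, ha, ← hc]
    simp
  have hδ : ∀ p, D *ᵥ A.δ p = 0 := by
    have h1 : D *ᵥ A.δ (root i) = 0 := by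
      refine A.eq_zero_of_isWeight (i := i) ha fun r y hy => ?_
      cases hy with
      | root => exact dotProduct_mulVec_self_of_skew hs _
      | self => exact hroot
      | idem => exact w .idem .root (by norm_num)
      | orth b hb => exact w (.orth b hb) .root (by norm_num)
      | off j hj b => exact w (.off j hj b) .root (by norm_num)
    have h2 : D *ᵥ A.δ (idem i) = 0 := by
      refine A.eq_zero_of_isWeight (i := i) ha fun r y hy => ?_
      cases hy with
      | root => exact w .root .idem (by norm_num)
      | self => exact A.ι_dot_mulVec_idem hDer i a
      | idem => exact dotProduct_mulVec_self_of_skew hs _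
      | orth b hb => exact A.ι_dot_mulVec_idem hDer i b
      | off j hj b => exact w (.off j hj b) .idem (by norm_num)
    intro p
    rw [plane_eq i p, map_add, map_smul, map_smul, Matrix.mulVec_add, Matrix.mulVec_smul,
      Matrix.mulVec_smul, h1, h2]
    simp
  rw [← hD]
  refine A.matrix_ext (fun p => by rw [hδ, Matrix.zero_mulVec]) fun l b => ?_
  rw [Matrix.zero_mulVec]
  refine A.eq_zero_of_dotProduct (fun p => ?_) fun j e => ?_
  · rw [dotProduct_mulVec_of_skew hs, hδ, zero_dotProduct, neg_zero]
  · by_cases hjl : j = l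
    · subst hjl
      obtain ⟨m, hm, hmi⟩ : ∃ m : Fin 3, j ≠ m ∧ m ≠ i := by
        clear * -; revert i j; decide
      exact A.dotProduct_eq_zero_of_isWeight ha (hD4 m a hmi ha) (.off j hm e) (.off j hm b)
        (by norm_num)
    · exact A.ι_dot_mulVec_ι_of_ne hDer hδ hjl e b

/-- Each `G i a` lies in one of the two summands. -/
theorem G_mem_or_mem {U V : Submodule ℝ (Matrix (Fin n) (Fin n) ℝ)}
    (s : OrthoSplit T (skewDerivations T) U V) (i : Fin 3) {a : Fin k → ℝ}
    (ha : a ⬝ᵥ a = 1) : A.G i a ∈ U ∨ A.G i a ∈ V := by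
  obtain ⟨u, hu, v, hv, huv⟩ := s.exists_add (A.G_mem i a)
  refine OrthoSplit.mem_or_mem hu hv huv (A.eq_smul_G (s.left_le hu) i ha ?_ fun j b hj hb => ?_)
  · exact s.component_bracket (A.G_mem i a) hu hv (by rw [huv, sub_self])
  · exact s.component_bracket_bracket (A.G_mem j b) hu hv
      (by rw [huv]; exact A.bracket_bracket_G hj a hb)

/-- The bracket of two of the rotations with different indices does not vanish, so they lie in the
same summand. -/
theorem G_mem_of_ne {U V : Submodule ℝ (Matrix (Fin n) (Fin n) ℝ)}
    (s : OrthoSplit T (skewDerivations T) U V) {i j : Fin 3} (hij : j ≠ i) {a b : Fin k → ℝ}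
    (ha : a ⬝ᵥ a = 1) (hb : b ⬝ᵥ b = 1) (h : A.G i a ∈ U) : A.G j b ∈ U := by
  refine (A.G_mem_or_mem s j hb).resolve_right fun h' => ?_
  have h1 := s.bracket_left (A.G_mem j b) h
  have h2 := V.neg_mem (s.symm.bracket_left (A.G_mem i a) h')
  rw [neg_sub] at h2
  have h3 := s.eq_zero h1 h2
  have h4 := A.bracket_bracket_G hij a hb
  rw [h3, mul_zero, zero_mul, sub_zero] at h4
  have := smul_eq_zero.1 h4.symm
  exact this.elim (by norm_num) (A.G_ne_zero i ha)

/-- A derivation that commutes with the rotations `G i a` is zero. -/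
theorem eq_zero_of_commute (hk : 0 < k) {F : Matrix (Fin n) (Fin n) ℝ} (hF : F ∈ skewDerivations T)
    (h : ∀ i a, a ⬝ᵥ a = 1 → A.G i a * F - F * A.G i a = 0) : F = 0 := by
  have w : ∀ {i a r t x y}, a ⬝ᵥ a = 1 → A.IsWeight i a r x → A.IsWeight i a t y → r ≠ t →
      x ⬝ᵥ (F *ᵥ y) = 0 := by
    intro i a r t x y ha hx hy hrt
    refine A.dotProduct_eq_zero_of_isWeight ha (c := 0) (by rw [h i a ha]; simp) hx hy
      fun e => hrt ?_
    have : (r - t) ^ 2 = 0 := by linear_combination e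
    linarith [pow_eq_zero_iff (two_ne_zero) |>.1 this]
  obtain ⟨a, ha⟩ := exists_unit hk
  have hδ : ∀ p, F *ᵥ A.δ p = 0 := by
    have key : ∀ i, F *ᵥ A.δ (root i) = 0 := by
      intro i
      refine A.eq_zero_of_dotProduct (A.δ_dotProduct_eq_zero i ?_ ?_) fun j b => ?_
      · exact dotProduct_mulVec_self_of_skew hF.1 _
      · exact w ha (.idem (i := i)) .root (by norm_num)
      · obtain ⟨l, hl⟩ : ∃ l, j ≠ l := ⟨j + 1, by revert j; decide⟩
        rw [plane_eq l (root i), map_add, map_smul, map_smul, Matrix.mulVec_add, Matrix.mulVec_smul,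
          Matrix.mulVec_smul, dotProduct_add, dotProduct_smul, dotProduct_smul,
          w ha (.off j hl b) .idem (by norm_num), w ha (.off j hl b) .root (by norm_num)]
        simp
    intro p
    have h0 := key 0
    have h2 := key 2
    have e : p = (-(2 / √3) * p 1) • root 0 + (p 0 - 1 / √3 * p 1) • root 2 := by
      have : √3 ≠ 0 := by positivity
      ext j
      fin_cases j <;> simp [root] <;> field_simp <;> ring
    rw [e, map_add, map_smul, map_smul, Matrix.mulVec_add, Matrix.mulVec_smul, Matrix.mulVec_smul,
      h0, h2]
    simp
  have hι : ∀ i b, b ⬝ᵥ b = 1 → F *ᵥ A.ι i b = 0 := by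
    intro i b hb
    have h1 := congrArg (· *ᵥ A.δ (root i)) (h i b hb)
    simp only [Matrix.sub_mulVec, ← Matrix.mulVec_mulVec, hδ, G_δ, root_dot_root, one_smul,
      Matrix.mulVec_zero, Matrix.zero_mulVec] at h1
    simpa using h1
  refine A.matrix_ext (fun p => by rw [hδ, Matrix.zero_mulVec]) fun i b => ?_
  rw [eq_sum_single b, map_sum, Matrix.mulVec_sum, Matrix.mulVec_sum]
  simp only [map_smul, Matrix.mulVec_smul, Matrix.zero_mulVec]
  refine Finset.sum_congr rfl fun c _ => ?_
  rw [hι _ _ (by simp)]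

/-- The derivations are irreducible: the rotations `G i a` all lie in the same summand, and the
elements of the other one commute with them. -/
theorem eq_bot_of_split_skewDerivations (hk : 0 < k)
    {U V : Submodule ℝ (Matrix (Fin n) (Fin n) ℝ)} (s : OrthoSplit T (skewDerivations T) U V) :
    U = ⊥ ∨ V = ⊥ := by
  obtain ⟨a, ha⟩ := exists_unit hk
  have key : ∀ {U V}, OrthoSplit T (skewDerivations T) U V → A.G 0 a ∈ U → V = ⊥ := by
    intro U V s hU
    rw [Submodule.eq_bot_iff]
    intro F hF
    have hmem : ∀ i b, b ⬝ᵥ b = 1 → A.G i b ∈ U := by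
      intro i b hb
      obtain ⟨j, hj0, hji⟩ : ∃ j : Fin 3, j ≠ 0 ∧ i ≠ j := by clear * -; revert i; decide
      exact A.G_mem_of_ne s hji ha hb (A.G_mem_of_ne s hj0 ha ha hU)
    refine A.eq_zero_of_commute hk (s.right_le hF) fun i b hb => ?_
    refine s.eq_zero ?_ (s.symm.bracket_left (A.G_mem i b) hF)
    rw [← neg_sub]
    exact U.neg_mem (s.bracket_left (s.right_le hF) (hmem i b hb))
  rcases A.G_mem_or_mem s 0 ha with h | h
  · exact Or.inr (key s h)
  · exact Or.inl (key s.symm h)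

end Frame

end CubicTensor

/-! ### Irreducibility of the complement of the derivations in the skew-symmetric tensors -/

namespace CubicTensor

variable {n k : ℕ} {T : Fin n → Fin n → Fin n → ℝ}

namespace Frame

/-- The area element of the plane of diagonal elements. -/
def planeArea (A : Frame T k) : Matrix (Fin n) (Fin n) ℝ := wedge (A.δ ![1, 0]) (A.δ ![0, 1])

variable (A : Frame T k)
include A

theorem wedge_δ_δ (p q : Fin 2 → ℝ) :
    wedge (A.δ p) (A.δ q) = (p 0 * q 1 - p 1 * q 0) • A.planeArea := by
  have hp : ∀ p : Fin 2 → ℝ, A.δ p = p 0 • A.δ ![1, 0] + p 1 • A.δ ![0, 1] := by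
    intro p
    rw [← map_smul, ← map_smul, ← map_add]
    congr 1
    ext i
    fin_cases i <;> simp
  rw [hp p, hp q]
  simp only [planeArea, wedge, Matrix.add_vecMulVec, Matrix.vecMulVec_add, Matrix.smul_vecMulVec,
    Matrix.vecMulVec_smul]
  module

theorem innerDer_δ_δ (p q : Fin 2 → ℝ) : innerDer T (A.δ p) (A.δ q) = 0 := by
  refine A.matrix_ext (fun r => ?_) fun i a => ?_
  · rw [innerDer_mulVec, A.δ_mul_δ, A.δ_mul_δ, A.δ_mul_δ, A.δ_mul_δ, A.δ_dot_δ, A.δ_dot_δ,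
      Matrix.zero_mulVec, ← map_sub, ← map_smul, ← map_smul, ← map_sub, ← map_smul, ← map_add,
      ← map_zero A.δ]
    congr 1
    ext j
    fin_cases j <;> simp [planeMul, dotProduct, Fin.sum_univ_two] <;> ring
  · rw [innerDer_mulVec, A.δ_mul_ι, A.δ_mul_ι, Matrix.mulVec_smul, Matrix.mulVec_smul, A.δ_mul_ι,
      A.δ_mul_ι, A.δ_dot_ι, A.δ_dot_ι, Matrix.zero_mulVec]
    module

theorem planeArea_mem : A.planeArea ∈ (hatEndomorphism T).eigenspace (-8) := by
  rw [Module.End.mem_eigenspace_iff, planeArea, A.isCartan.hat_wedge, A.innerDer_δ_δ]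
  module

theorem bracket_planeArea (i : Fin 3) (a : Fin k → ℝ) :
    A.G i a * A.planeArea - A.planeArea * A.G i a = wedge (A.ι i a) (A.δ (idem i)) := by
  have h3 := sqrt_three_sq
  have h : idem i = (root i ⬝ᵥ ![1, 0]) • ![0, 1] - (root i ⬝ᵥ ![0, 1]) • ![1, 0] := by
    ext j
    fin_cases i <;> fin_cases j <;> simp [idem, root, dotProduct, Fin.sum_univ_two]
  rw [planeArea, bracket_wedge (A.G_skew i a), G_δ, G_δ, h, map_sub, map_smul, map_smul]
  simp only [wedge, Matrix.sub_vecMulVec, Matrix.vecMulVec_sub, Matrix.smul_vecMulVec,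
    Matrix.vecMulVec_smul]
  module

theorem bracket_bracket_planeArea (i : Fin 3) {a : Fin k → ℝ} (ha : a ⬝ᵥ a = 1) :
    A.G i a * (A.G i a * A.planeArea - A.planeArea * A.G i a)
      - (A.G i a * A.planeArea - A.planeArea * A.G i a) * A.G i a = -(1 : ℝ) • A.planeArea := by
  have h3 := sqrt_three_sq
  have h : root i 0 * idem i 1 - root i 1 * idem i 0 = 1 := by
    fin_cases i <;> simp [idem, root] <;> linarith
  have h0 : root i ⬝ᵥ idem i = 0 := by rw [dotProduct_comm, idem_dot_root]
  rw [A.bracket_planeArea, bracket_wedge (A.G_skew i a), G_ι_self, G_δ, h0, ha, neg_smul,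
    ← smul_neg, one_smul, ← map_neg, A.wedge_δ_δ]
  have e : wedge (A.ι i a) ((0 : ℝ) • A.ι i a) = 0 := by simp [wedge]
  rw [e, add_zero]
  congr 1
  simp only [Pi.neg_apply]
  linarith

section squareOne

variable {u : Matrix (Fin n) (Fin n) ℝ} (hs : uᵀ = -u)
  (h : ∀ i a, a ⬝ᵥ a = 1 → A.G i a * (A.G i a * u - u * A.G i a)
    - (A.G i a * u - u * A.G i a) * A.G i a = -(1 : ℝ) • u)
include hs h

omit hs in
theorem δ_dot_mulVec_ι_of_bracket (hk : 0 < k) (p : Fin 2 → ℝ) (j : Fin 3) (b : Fin k → ℝ) :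
    A.δ p ⬝ᵥ (u *ᵥ A.ι j b) = 0 := by
  obtain ⟨a, ha⟩ := exists_unit hk
  have key : ∀ l, j ≠ l → A.δ (idem l) ⬝ᵥ (u *ᵥ A.ι j b) = 0 ∧ A.δ (root l) ⬝ᵥ (u *ᵥ A.ι j b) = 0 :=
    fun l hl => ⟨A.dotProduct_eq_zero_of_isWeight ha (h l a ha) .idem (.off j hl b) (by norm_num),
      A.dotProduct_eq_zero_of_isWeight ha (h l a ha) .root (.off j hl b) (by norm_num)⟩
  have hj : j ≠ j + 1 := by clear * -; revert j; decide
  exact A.δ_dotProduct_eq_zero (j + 1) (key _ hj).2 (key _ hj).1 p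

omit hs in
theorem ι_dot_mulVec_ι_of_bracket (hk : 0 < k) {i j : Fin 3} (hij : j ≠ i) (b c : Fin k → ℝ) :
    A.ι i b ⬝ᵥ (u *ᵥ A.ι j c) = 0 := by
  obtain ⟨a, ha⟩ := exists_unit hk
  refine A.ι_dotProduct_eq_zero i ha ?_ (fun b hb => ?_) b
  · exact A.dotProduct_eq_zero_of_isWeight ha (h i a ha) .self (.off j hij c) (by norm_num)
  · exact A.dotProduct_eq_zero_of_isWeight ha (h i a ha) (.orth b hb) (.off j hij c) (by norm_num)

omit hs in
/-- The forms that `u` induces on the three off-diagonal spaces determine each other. -/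
theorem ι_dot_mulVec_ι_succ {i j l : Fin 3} (hj : j = i + 1) (hl : l = i + 2) {a : Fin k → ℝ}
    (ha : a ⬝ᵥ a = 1) (b c : Fin k → ℝ) :
    A.ι j b ⬝ᵥ (u *ᵥ A.ι j c) = -(A.ι l (A.m a b) ⬝ᵥ (u *ᵥ A.ι l (A.m a c))) := by
  have hji : j ≠ i := by subst hj; clear * -; revert i; decide
  have h1 := two_mul_dotProduct_of_weights (A.G_skew i a) (h i a ha) (A.G_G_of_ne hji ha b)
    (A.G_G_of_ne hji ha c)
  rw [A.G_ι_succ hj hl, A.G_ι_succ hj hl, Matrix.mulVec_smul, dotProduct_smul, smul_dotProduct,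
    smul_eq_mul, smul_eq_mul] at h1
  linarith

/-- If `u` vanishes on one off-diagonal space, it is a multiple of the area element. -/
theorem eq_smul_planeArea (hk : 0 < k)
    (h2 : ∀ d c, d ⬝ᵥ d = 1 → c ⬝ᵥ c = 1 → d ⬝ᵥ c = 0 → A.ι 2 d ⬝ᵥ (u *ᵥ A.ι 2 c) = 0) :
    u = (A.δ ![1, 0] ⬝ᵥ (u *ᵥ A.δ ![0, 1])) • A.planeArea := by
  obtain ⟨a, ha⟩ := exists_unit hk
  have hn : ∀ x : Fin k → ℝ, ∃ (r : ℝ) (d : Fin k → ℝ), d ⬝ᵥ d = 1 ∧ x = r • d := by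
    intro x
    by_cases h0 : x ⬝ᵥ x = 0
    · exact ⟨0, a, ha, by rw [dotProduct_self_eq_zero.1 h0, zero_smul]⟩
    · have hpos : 0 < x ⬝ᵥ x := lt_of_le_of_ne
        (Finset.sum_nonneg fun i _ => mul_self_nonneg _) (Ne.symm h0)
      have hr : √(x ⬝ᵥ x) ≠ 0 := (Real.sqrt_pos.2 hpos).ne'
      refine ⟨√(x ⬝ᵥ x), (√(x ⬝ᵥ x))⁻¹ • x, ?_, ?_⟩
      · rw [smul_dotProduct, dotProduct_smul, smul_eq_mul, smul_eq_mul]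
        field_simp
        rw [Real.sq_sqrt hpos.le]
      · rw [smul_smul, mul_inv_cancel₀ hr, one_smul]
  have e2 : ∀ b c, A.ι 2 b ⬝ᵥ (u *ᵥ A.ι 2 c) = 0 := by
    intro b c
    obtain ⟨r, c, hc, rfl⟩ := hn c
    rw [map_smul, Matrix.mulVec_smul, dotProduct_smul,
      A.ι_dotProduct_eq_zero 2 hc (dotProduct_mulVec_self_of_skew hs _) (fun b hb => ?_) b,
      smul_zero]
    obtain ⟨t, d, hd, rfl⟩ := hn b
    rw [map_smul, smul_dotProduct]
    by_cases ht : t = 0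
    · rw [ht, zero_smul]
    · rw [dotProduct_smul, smul_eq_mul] at hb
      rw [h2 d c hd hc (by rw [dotProduct_comm]; exact (mul_eq_zero.1 hb).resolve_left ht),
        smul_zero]
  have e1 : ∀ b c, A.ι 1 b ⬝ᵥ (u *ᵥ A.ι 1 c) = 0 := by
    intro b c
    rw [A.ι_dot_mulVec_ι_succ h (i := 0) (j := 1) (l := 2) rfl rfl ha, e2, neg_zero]
  have e0 : ∀ b c, A.ι 0 b ⬝ᵥ (u *ᵥ A.ι 0 c) = 0 := by
    intro b c
    rw [A.ι_dot_mulVec_ι_succ h (i := 2) (j := 0) (l := 1) rfl rfl ha, e1, neg_zero]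
  have e : ∀ i b c, A.ι i b ⬝ᵥ (u *ᵥ A.ι i c) = 0 := by
    intro i
    fin_cases i
    exacts [e0, e1, e2]
  have hδ := A.δ_dot_mulVec_ι_of_bracket h hk
  have hω : ∀ x y, x ⬝ᵥ (A.planeArea *ᵥ y) = (A.δ ![0, 1] ⬝ᵥ y) * (x ⬝ᵥ A.δ ![1, 0])
      - (A.δ ![1, 0] ⬝ᵥ y) * (x ⬝ᵥ A.δ ![0, 1]) := by
    intro x y
    rw [planeArea, wedge_mulVec, dotProduct_sub, dotProduct_smul, dotProduct_smul, smul_eq_mul,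
      smul_eq_mul]
  set c := A.δ ![1, 0] ⬝ᵥ (u *ᵥ A.δ ![0, 1]) with hc
  rw [← sub_eq_zero]
  refine A.matrix_ext (fun q => ?_) fun j b => ?_ <;>
    rw [Matrix.zero_mulVec] <;>
    refine A.eq_zero_of_dotProduct (fun p => ?_) fun i b' => ?_ <;>
    rw [Matrix.sub_mulVec, Matrix.smul_mulVec, dotProduct_sub, dotProduct_smul, hω, smul_eq_mul]
  · have hp : ∀ p : Fin 2 → ℝ, A.δ p = p 0 • A.δ ![1, 0] + p 1 • A.δ ![0, 1] := by
      intro p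
      rw [← map_smul, ← map_smul, ← map_add]
      congr 1
      ext i
      fin_cases i <;> simp
    rw [hp p, hp q]
    simp only [Matrix.mulVec_add, Matrix.mulVec_smul, add_dotProduct, dotProduct_add,
      smul_dotProduct, dotProduct_smul, smul_eq_mul, dotProduct_mulVec_self_of_skew hs, ← hc,
      A.δ_dot_δ]
    rw [dotProduct_mulVec_of_skew hs (A.δ ![0, 1]), dotProduct_comm (u *ᵥ _), ← hc]
    simp [dotProduct, Fin.sum_univ_two]
    ring
  · rw [dotProduct_mulVec_of_skew hs, dotProduct_comm, hδ, A.ι_dot_δ, A.ι_dot_δ]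
    simp
  · rw [hδ, A.δ_dot_ι, A.δ_dot_ι]
    simp
  · rw [A.δ_dot_ι, A.δ_dot_ι]
    by_cases hij : j = i
    · subst hij; rw [e]; simp
    · rw [A.ι_dot_mulVec_ι_of_bracket h hk hij]; simp

end squareOne

/-- The rotations with the three indices, applied in either order, map the area element to the same
tensor, which is a sum of area elements of planes in the off-diagonal spaces. -/
theorem bracket_three_planeArea {a b c : Fin k → ℝ} (habc : a ⬝ᵥ A.m b c = 0)
    (f : Fin 3 → Matrix (Fin n) (Fin n) ℝ → Matrix (Fin n) (Fin n) ℝ)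
    (hf : ∀ i W, f i W = A.G i (![a, b, c] i) * W - W * A.G i (![a, b, c] i)) :
    f 0 (f 1 (f 2 A.planeArea)) = (-(√3 / 4)) • (wedge (A.ι 0 (A.m b c)) (A.ι 0 a)
      + wedge (A.ι 1 (A.m c a)) (A.ι 1 b) + wedge (A.ι 2 (A.m a b)) (A.ι 2 c)) ∧
    f 2 (f 1 (f 0 A.planeArea)) = (-(√3 / 4)) • (wedge (A.ι 0 (A.m b c)) (A.ι 0 a)
      + wedge (A.ι 1 (A.m c a)) (A.ι 1 b) + wedge (A.ι 2 (A.m a b)) (A.ι 2 c)) := by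
  have hc : c ⬝ᵥ A.m a b = 0 := by rw [dotProduct_comm, A.m_dot, habc]
  have f0 : ∀ x y, f 0 (wedge x y) = wedge (A.G 0 a *ᵥ x) y + wedge x (A.G 0 a *ᵥ y) := by
    intro x y; rw [hf]; exact bracket_wedge (A.G_skew _ _) _ _
  have f1 : ∀ x y, f 1 (wedge x y) = wedge (A.G 1 b *ᵥ x) y + wedge x (A.G 1 b *ᵥ y) := by
    intro x y; rw [hf]; exact bracket_wedge (A.G_skew _ _) _ _
  have f2 : ∀ x y, f 2 (wedge x y) = wedge (A.G 2 c *ᵥ x) y + wedge x (A.G 2 c *ᵥ y) := by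
    intro x y; rw [hf]; exact bracket_wedge (A.G_skew _ _) _ _
  have p0 : f 0 A.planeArea = wedge (A.ι 0 a) (A.δ (idem 0)) := by
    rw [hf]; exact A.bracket_planeArea 0 a
  have p2 : f 2 A.planeArea = wedge (A.ι 2 c) (A.δ (idem 2)) := by
    rw [hf]; exact A.bracket_planeArea 2 c
  have fadd : ∀ i W Z, f i (W + Z) = f i W + f i Z := by
    intro i W Z; rw [hf, hf, hf]; noncomm_ring
  have d12 : root 1 ⬝ᵥ idem 2 = √3 / 2 := by rw [dotProduct_comm]; exact idem_succ_dot_root rfl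
  have d10 : root 1 ⬝ᵥ idem 0 = -(√3 / 2) := by rw [dotProduct_comm]; exact idem_pred_dot_root rfl
  have d02 : root 0 ⬝ᵥ idem 2 = -(√3 / 2) := by rw [dotProduct_comm]; exact idem_pred_dot_root rfl
  have d20 : root 2 ⬝ᵥ idem 0 = √3 / 2 := by rw [dotProduct_comm]; exact idem_succ_dot_root rfl
  have s01 := A.G_ι_succ (i := 0) (j := 1) (l := 2) rfl rfl
  have s12 := A.G_ι_succ (i := 1) (j := 2) (l := 0) rfl rfl
  have s20 := A.G_ι_succ (i := 2) (j := 0) (l := 1) rfl rfl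
  have t02 := A.G_ι_pred (i := 0) (j := 2) (l := 1) rfl rfl
  have t10 := A.G_ι_pred (i := 1) (j := 0) (l := 2) rfl rfl
  have t21 := A.G_ι_pred (i := 2) (j := 1) (l := 0) rfl rfl
  constructor
  · rw [p2, f1, s12, G_δ, d12, fadd, f0, f0]
    simp only [Matrix.mulVec_smul, G_ι_self, habc, G_δ, d02, t02, s01, wedge,
      Matrix.smul_vecMulVec, Matrix.vecMulVec_smul]
    module
  · rw [p0, f1, t10, G_δ, d10, fadd, f2, f2]
    simp only [Matrix.mulVec_smul, G_ι_self, hc, G_δ, d20, s20, t21, wedge,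
      Matrix.smul_vecMulVec, Matrix.vecMulVec_smul]
    module

/-- The area element of the diagonal lies in one of the two summands. By its weights, its component
`u` is a multiple of the area element up to three forms on the off-diagonal spaces, which determine
each other; they vanish because `u` is orthogonal to its image under a product of three brackets. -/
theorem planeArea_mem_or_mem (hk : 0 < k)
    {U V : Submodule ℝ (Matrix (Fin n) (Fin n) ℝ)}
    (s : OrthoSplit T ((hatEndomorphism T).eigenspace (-8)) U V) (hskew : ∀ W ∈ U, Wᵀ = -W) :
    A.planeArea ∈ U ∨ A.planeArea ∈ V := by
  obtain ⟨u, hu, v, hv, huv⟩ := s.exists_add A.planeArea_mem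
  have hs := hskew u hu
  have hb : ∀ i a, a ⬝ᵥ a = 1 → A.G i a * (A.G i a * u - u * A.G i a)
      - (A.G i a * u - u * A.G i a) * A.G i a = -(1 : ℝ) • u := fun i a ha =>
    s.component_bracket_bracket (A.G_mem i a) hu hv
      (by rw [huv]; exact A.bracket_bracket_planeArea i ha)
  refine OrthoSplit.mem_or_mem hu hv huv (A.eq_smul_planeArea hs hb hk fun d c hd hc hdc => ?_)
  set a := A.m c d with ha
  have haa : a ⬝ᵥ a = 1 := by rw [ha, A.m_dot_m, hc, hd, one_mul]
  have hac : A.m a c = d := by rw [ha, A.m_m_left, hc, one_smul]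
  have habc : a ⬝ᵥ A.m c c = 0 := by
    rw [ha, A.m_dot_m_left, hdc, mul_zero]
  obtain ⟨f, hf⟩ : ∃ f : Fin 3 → Matrix (Fin n) (Fin n) ℝ → Matrix (Fin n) (Fin n) ℝ,
      ∀ i W, f i W = A.G i (![a, c, c] i) * W - W * A.G i (![a, c, c] i) := ⟨_, fun _ _ => rfl⟩
  obtain ⟨h1, h2⟩ := A.bracket_three_planeArea habc f hf
  have fadd : ∀ i W Z, f i (W + Z) = f i W + f i Z := by
    intro i W Z; rw [hf, hf, hf]; noncomm_ring
  have fU : ∀ i, ∀ W ∈ U, f i W ∈ U := fun i W hW => by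
    rw [hf]; exact s.bracket_left (A.G_mem _ _) hW
  have fV : ∀ i, ∀ W ∈ V, f i W ∈ V := fun i W hW => by
    rw [hf]; exact s.symm.bracket_left (A.G_mem _ _) hW
  have ftr : ∀ i W Z, (Wᵀ * f i Z).trace = -((f i W)ᵀ * Z).trace := fun i W Z => by
    rw [hf, hf]; exact trace_transpose_mul_bracket (A.G_skew _ _) W Z
  -- On `u` the product of the three brackets is minus its own transpose.
  have e1 : f 0 (f 1 (f 2 u)) = f 2 (f 1 (f 0 u)) :=
    s.component_eq (f := fun W => f 0 (f 1 (f 2 W))) (g := fun W => f 2 (f 1 (f 0 W)))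
      (fun x y => by simp only [fadd]) (fun x y => by simp only [fadd])
      (fU _ _ (fU _ _ (fU _ _ hu))) (fV _ _ (fV _ _ (fV _ _ hv)))
      (fU _ _ (fU _ _ (fU _ _ hu))) (fV _ _ (fV _ _ (fV _ _ hv))) (by rw [huv, h1, h2])
  have e2 : (uᵀ * f 0 (f 1 (f 2 u))).trace = 0 := by
    have h3 : (uᵀ * f 0 (f 1 (f 2 u))).trace = -((f 2 (f 1 (f 0 u)))ᵀ * u).trace := by
      rw [ftr, ftr, ftr, neg_neg]
    rw [← e1] at h3
    have h4 := trace_transpose_mul_comm u (f 0 (f 1 (f 2 u)))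
    linarith
  have e3 : (uᵀ * f 0 (f 1 (f 2 v))).trace = 0 := s.ortho _ hu _ (fV _ _ (fV _ _ (fV _ _ hv)))
  have e4 : (uᵀ * f 0 (f 1 (f 2 A.planeArea))).trace = 0 := by
    rw [← huv, fadd, fadd, fadd, mul_add, Matrix.trace_add, e2, e3, add_zero]
  rw [h1, Matrix.mul_smul, Matrix.trace_smul, mul_add, mul_add, Matrix.trace_add, Matrix.trace_add,
    trace_transpose_mul_wedge hs, trace_transpose_mul_wedge hs, trace_transpose_mul_wedge hs, hac,
    smul_eq_mul] at e4
  have e5 := (mul_eq_zero.1 e4).resolve_left (by simp)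
  have r1 := A.ι_dot_mulVec_ι_succ hb (i := 0) (j := 1) (l := 2) rfl rfl haa (A.m c a) c
  have r0 := A.ι_dot_mulVec_ι_succ hb (i := 2) (j := 0) (l := 1) rfl rfl hc (A.m c c) a
  rw [A.m_m_right, haa, one_smul, hac] at r1
  rw [A.m_m_right, hc, one_smul] at r0
  have sk : ∀ x y, x ⬝ᵥ (u *ᵥ y) = -(y ⬝ᵥ (u *ᵥ x)) := fun x y => by
    rw [dotProduct_mulVec_of_skew hs, dotProduct_comm]
  have s1 := sk (A.ι 1 c) (A.ι 1 (A.m c a))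
  have s2 := sk (A.ι 2 c) (A.ι 2 d)
  linarith

/-- A skew-symmetric tensor `W` with `x · W (x x) = 0` for all `x` is a derivation. -/
theorem mem_skewDerivations_of_dotProduct {W : Matrix (Fin n) (Fin n) ℝ} (hW : Wᵀ = -W)
    (h : ∀ x, x ⬝ᵥ (W *ᵥ (mulLeft T x *ᵥ x)) = 0) : W ∈ skewDerivations T := by
  have hp : ∀ x y z, x ⬝ᵥ (W *ᵥ (mulLeft T y *ᵥ z)) + y ⬝ᵥ (W *ᵥ (mulLeft T z *ᵥ x))
      + z ⬝ᵥ (W *ᵥ (mulLeft T x *ᵥ y)) = 0 := by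
    intro x y z
    have h1 := h (x + y + z)
    have h2 := h (x + y)
    have h3 := h (y + z)
    have h4 := h (x + z)
    simp only [map_add, Matrix.add_mulVec, Matrix.mulVec_add, add_dotProduct, dotProduct_add, h,
      A.mul_comm y x, A.mul_comm z x, A.mul_comm z y] at h1 h2 h3 h4 ⊢
    linarith
  refine ⟨hW, fun x y => dotProduct_eq _ _ fun z => ?_⟩
  have hL := A.isCartan.transpose_mulLeft
  rw [add_dotProduct, A.mul_comm (W *ᵥ x) y, dotProduct_comm, dotProduct_comm _ z,
    dotProduct_comm _ z, dotProduct_mulVec_of_symm (hL y), dotProduct_mulVec_of_symm (hL x),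
    dotProduct_mulVec_of_skew hW _ x, dotProduct_mulVec_of_skew hW _ y]
  have := hp x y z
  rw [dotProduct_comm (W *ᵥ _), dotProduct_comm (W *ᵥ _), A.mul_comm x z]
  linarith

/-- The eigenspace for `-8` is irreducible: it consists of skew-symmetric tensors orthogonal to the
derivations, and a tensor `W` in it that is orthogonal to all conjugates of the area element
satisfies `x · W (x x) = 0`, since `x` and `x x` are simultaneously conjugate to diagonal elements;
hence `W` is a derivation. -/
theorem eq_bot_of_split_neg_eight (hk : 0 < k)
    (hskew : ∀ W ∈ (hatEndomorphism T).eigenspace (-8), Wᵀ = -W)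
    {U V : Submodule ℝ (Matrix (Fin n) (Fin n) ℝ)}
    (s : OrthoSplit T ((hatEndomorphism T).eigenspace (-8)) U V) : U = ⊥ ∨ V = ⊥ := by
  have key : ∀ {U V}, OrthoSplit T ((hatEndomorphism T).eigenspace (-8)) U V →
      A.planeArea ∈ U → V = ⊥ := by
    intro U V s hU
    rw [Submodule.eq_bot_iff]
    intro W hW
    have hs := hskew W (s.right_le hW)
    have hD : W ∈ skewDerivations T := by
      refine A.mem_skewDerivations_of_dotProduct hs fun x => ?_
      obtain ⟨h, hh, p, hp⟩ := A.exists_conj_diagonal x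
      have hW' := s.invariant_right h hh W hW
      have hs' := hskew _ (s.right_le hW')
      rw [← conj_dotProduct hh.1, hh.2.2, hp, A.δ_mul_δ]
      have h1 := trace_transpose_mul_wedge hs' (A.δ p) (A.δ (planeMul p p))
      rw [A.wedge_δ_δ, Matrix.mul_smul, Matrix.trace_smul, s.symm.ortho _ hW' _ hU, smul_zero] at h1
      linarith
    have h1 := A.isCartan.hat_of_mem hD
    rw [Module.End.mem_eigenspace_iff.1 (s.right_le hW), ← sub_eq_zero, ← sub_smul] at h1
    refine (smul_eq_zero.1 h1).resolve_left ?_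
    have : (0 : ℝ) ≤ n := Nat.cast_nonneg n
    intro h
    linarith
  rcases A.planeArea_mem_or_mem hk s fun W hW => hskew W (s.left_le hW) with h | h
  · exact Or.inr (key s h)
  · exact Or.inl (key s.symm h)

end Frame

end CubicTensor

/-! ### The decomposition of the two-tensors -/

namespace CubicTensor

variable {n k : ℕ}

theorem invariant_eigenspace {T : Fin n → Fin n → Fin n → ℝ} (hT : IsCartan T) (μ : ℝ) :
    Invariant T ((hatEndomorphism T).eigenspace μ) := by
  intro h hh W hW
  obtain ⟨g, hg, rfl⟩ := hT.mem_rotationAutomorphisms.1 hh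
  have h1 := hatEndomorphism_comm T ⟨g, hg⟩ W
  rw [Module.End.mem_eigenspace_iff] at hW ⊢
  rw [hW, map_smul] at h1
  exact h1

/-- Irreducibility of an eigenspace follows if it has no decomposition into orthogonal invariant
subspaces. -/
theorem isIrreducible_of_split (hT : IsCartan (upsilon n)) {μ : ℝ}
    (h0 : eigenspaceUpsilon n μ ≠ ⊥)
    (h : ∀ U V, OrthoSplit (upsilon n) (eigenspaceUpsilon n μ) U V → U = ⊥ ∨ V = ⊥) :
    (eigenRep n μ).IsIrreducible := by
  have hE : Invariant (upsilon n) (eigenspaceUpsilon n μ) := invariant_eigenspace hT μ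
  have hinj := (eigenspaceUpsilon n μ).injective_subtype
  refine { exists_pair_ne := ⟨⊥, ⊤, fun e => h0 ?_⟩, eq_bot_or_eq_top := fun σ => ?_ }
  · have e' := congrArg Subrepresentation.toSubmodule e
    rw [Submodule.eq_bot_iff]
    intro W hW
    have : (⟨W, hW⟩ : eigenspaceUpsilon n μ) ∈
        (⊥ : Subrepresentation (eigenRep n μ)).toSubmodule := by
      rw [e']
      exact Submodule.mem_top
    exact congrArg Subtype.val ((Submodule.mem_bot ℝ).1 this)
  · set U := σ.toSubmodule.map (eigenspaceUpsilon n μ).subtype with hUdef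
    have hU : Invariant (upsilon n) U := by
      rintro g hg _ ⟨W, hW, rfl⟩
      obtain ⟨g, hg', rfl⟩ := hT.mem_rotationAutomorphisms.1 hg
      exact ⟨_, σ.apply_mem_toSubmodule ⟨g, hg'⟩ hW, rfl⟩
    obtain ⟨V, hV⟩ := invariant_orthogonal hE hU (Submodule.map_subtype_le _ _)
    rcases h U V hV with h1 | h1
    · refine Or.inl (Subrepresentation.toSubmodule_injective ?_)
      exact Submodule.map_injective_of_injective hinj (h1.trans (Submodule.map_bot _).symm)
    · refine Or.inr (Subrepresentation.toSubmodule_injective ?_)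
      have h2 := hV.sup_eq
      rw [h1, sup_bot_eq, hUdef] at h2
      refine Submodule.map_injective_of_injective hinj (h2.trans ?_)
      exact (Submodule.map_subtype_top _).symm

theorem skewDerivations_eq_lieAlgebraH (hT : IsCartan (upsilon n)) :
    (skewDerivations (upsilon n) : Set (Matrix (Fin n) (Fin n) ℝ)) = lieAlgebraH n := by
  ext F
  rw [SetLike.mem_coe, mem_skewDerivations_iff_exp]
  exact forall_congr' fun t => hT.mem_rotationAutomorphisms

/-- The decomposition of the two-tensors for a cubic form with a Peirce decomposition. -/
theorem Frame.tensorSquareDecomposition (A : Frame (upsilon n) k) (hk : 0 < k) (hn : 3 ≤ n)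
    (h10 : n ≠ 10) (d : Fin 5 → ℕ) (h0 : d 0 = 1)
    (h1 : (n + 10) * d 1 = 3 * n * (n - 2)) (h2 : d 2 = n)
    (h3 : d 1 + d 3 = n * (n - 1) / 2) (h4 : d 4 + 1 = d 1 + d 3) (hd : ∀ i, d i ≠ 0) :
    TensorSquareDecomposition n (eigenvalue n) d := by
  have hT := A.isCartan
  have hfin := hT.finrank_eigenspace hn h10 d h0 h1 h2 h3 h4
  refine ⟨hT.isInternal hn h10, ?_, ?_, hfin, fun i => isIrreducible_of_split hT ?_ ?_,
    hT.eigenspace_scalar hn, ?_⟩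
  · rintro i (rfl | rfl | rfl) S hS <;> simpa using hT.transpose_of_mem hn h10 _ S hS
  · rintro i (rfl | rfl) S hS <;> simpa using hT.transpose_of_mem hn h10 _ S hS
  · intro h
    refine hd i ((hfin i).symm.trans ?_)
    change Module.finrank ℝ (eigenspaceUpsilon n (eigenvalue n i)) = 0
    rw [h, finrank_bot]
  · intro U V s
    change OrthoSplit _ ((hatEndomorphism (upsilon n)).eigenspace (eigenvalue n i)) U V at s
    have hskew := hT.transpose_of_mem hn h10 3
    fin_cases i
    · change OrthoSplit _ ((hatEndomorphism (upsilon n)).eigenspace (4 + 2 * n)) U V at s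
      rw [hT.eigenspace_scalar hn] at s
      by_cases hU : U = ⊥
      · exact Or.inl hU
      · obtain ⟨W, hW, hW0⟩ := Submodule.exists_mem_ne_zero_of_ne_bot hU
        obtain ⟨c, rfl⟩ := Submodule.mem_span_singleton.1 (s.left_le hW)
        refine Or.inr ((Submodule.eq_bot_iff _).2 fun Z hZ => s.eq_zero ?_ hZ)
        obtain ⟨b, rfl⟩ := Submodule.mem_span_singleton.1 (s.right_le hZ)
        have hc : c ≠ 0 := fun h => hW0 (by rw [h, zero_smul])
        have := U.smul_mem (b * c⁻¹) hW
        rwa [smul_smul, mul_assoc, inv_mul_cancel₀ hc, mul_one] at this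
    · change OrthoSplit _ ((hatEndomorphism (upsilon n)).eigenspace (n + 2)) U V at s
      rw [hT.eigenspace_skewDerivations hn] at s
      exact A.eq_bot_of_split_skewDerivations hk s
    · change OrthoSplit _ ((hatEndomorphism (upsilon n)).eigenspace (2 - n)) U V at s
      rw [hT.eigenspace_mulLeft hn h10] at s
      exact A.eq_bot_of_split_mulLeft hk s
    · refine A.eq_bot_of_split_neg_eight hk (fun W hW => ?_) s
      simpa using hskew W hW
    · exact A.eq_bot_of_split_four hk hn s
  · rw [← skewDerivations_eq_lieAlgebraH hT, ← hT.eigenspace_skewDerivations hn]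
    rfl

end CubicTensor

/-! ### Construction of Peirce decompositions from a cubic form -/

namespace CubicTensor

variable {n k : ℕ}

/-- The coordinates of `ℝⁿ` that correspond to the diagonal and to the three off-diagonal entries of
a matrix: the maps `π`, `α i` to these entries and the dual maps `δ`, `ι i`. -/
structure MatrixCoordinates (n k : ℕ) where
  δ : (Fin 2 → ℝ) →ₗ[ℝ] (Fin n → ℝ)
  ι : Fin 3 → (Fin k → ℝ) →ₗ[ℝ] (Fin n → ℝ)
  π : (Fin n → ℝ) →ₗ[ℝ] (Fin 2 → ℝ)
  α : Fin 3 → (Fin n → ℝ) →ₗ[ℝ] (Fin k → ℝ)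
  π_δ : ∀ p, π (δ p) = p
  α_δ : ∀ i p, α i (δ p) = 0
  π_ι : ∀ i a, π (ι i a) = 0
  α_ι : ∀ j i a, α j (ι i a) = if j = i then a else 0
  eq_add : ∀ x, x = δ (π x) + ∑ i, ι i (α i x)
  δ_dot : ∀ p x, δ p ⬝ᵥ x = p ⬝ᵥ π x
  ι_dot : ∀ i a x, ι i a ⬝ᵥ x = a ⬝ᵥ α i x

/-- The coordinates given by a numbering `e` of the entries and signs `σ`. -/
def MatrixCoordinates.ofEquiv (e : Fin 2 ⊕ Fin 3 × Fin k ≃ Fin n) (σ : Fin 3 → Fin k → ℝ)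
    (hσ : ∀ i c, σ i c * σ i c = 1) : MatrixCoordinates n k where
  δ :=
    { toFun := fun p I => Sum.elim p 0 (e.symm I)
      map_add' := fun p q => by
        ext I
        dsimp only [Pi.add_apply]
        cases e.symm I <;> simp
      map_smul' := fun r p => by
        ext I
        dsimp only [Pi.smul_apply]
        cases e.symm I <;> simp }
  ι := fun i =>
    { toFun := fun a I => Sum.elim 0 (fun l => if l.1 = i then σ l.1 l.2 * a l.2 else 0) (e.symm I)
      map_add' := fun p q => by
        ext I
        dsimp only [Pi.add_apply]
        cases e.symm I with
        | inl j => simp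
        | inr l => simp only [Sum.elim_inr]; split_ifs <;> ring
      map_smul' := fun r p => by
        ext I
        dsimp only [Pi.smul_apply]
        cases e.symm I with
        | inl j => simp
        | inr l => simp only [Sum.elim_inr, smul_eq_mul, RingHom.id_apply]; split_ifs <;> ring }
  π :=
    { toFun := fun x j => x (e (Sum.inl j))
      map_add' := fun _ _ => rfl
      map_smul' := fun _ _ => rfl }
  α := fun i =>
    { toFun := fun x c => σ i c * x (e (Sum.inr (i, c)))
      map_add' := fun x y => by ext c; exact mul_add _ _ _
      map_smul' := fun r x => by ext c; exact mul_left_comm _ _ _ }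
  π_δ p := by ext j; simp
  α_δ i p := by ext j; simp
  π_ι i a := by ext j; simp
  α_ι j i a := by
    ext c
    by_cases h : j = i
    · subst h; simp [← mul_assoc, hσ]
    · simp [h]
  eq_add x := by
    ext I
    obtain ⟨l, rfl⟩ := e.surjective I
    rcases l with j | ⟨i, c⟩
    · simp
    · simp [← mul_assoc, hσ]
  δ_dot p x := by
    simp only [dotProduct, LinearMap.coe_mk, AddHom.coe_mk]
    rw [← e.sum_comp]
    simp
  ι_dot i a x := by
    simp only [dotProduct, LinearMap.coe_mk, AddHom.coe_mk]
    rw [← e.sum_comp]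
    simp only [Equiv.symm_apply_apply, Fintype.sum_sum_type, Sum.elim_inl, Sum.elim_inr,
      Fintype.sum_prod_type]
    rw [Finset.sum_eq_single i (fun j _ hj => by simp [hj]) (by simp)]
    simp only [Pi.zero_apply, zero_mul, Finset.sum_const_zero, zero_add, if_true]
    exact Finset.sum_congr rfl fun c _ => by ring

/-- A symmetric trilinear form is recovered from its cubic form by polarization. -/
theorem upsilon_eq (t : (Fin n → ℝ) →ₗ[ℝ] (Fin n → ℝ) →ₗ[ℝ] (Fin n → ℝ) →ₗ[ℝ] ℝ)
    (h1 : ∀ x y z, t x y z = t y x z) (h2 : ∀ x y z, t x y z = t x z y)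
    (h : ∀ x, cubicForm n x = t x x x) (I J K : Fin n) :
    upsilon n I J K = t (Pi.single I 1) (Pi.single J 1) (Pi.single K 1) := by
  simp only [upsilon, h, map_add, LinearMap.add_apply]
  generalize (Pi.single I 1 : Fin n → ℝ) = x
  generalize (Pi.single J 1 : Fin n → ℝ) = y
  generalize (Pi.single K 1 : Fin n → ℝ) = z
  have e1 := h1 y x
  have e2 := h1 z x
  have e3 := h1 z y
  have f1 := fun w => h2 w y x
  have f2 := fun w => h2 w z x
  have f3 := fun w => h2 w z y
  simp only [e1, e2, e3, f1, f2, f3]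
  ring

theorem mulLeft_upsilon_dot (t : (Fin n → ℝ) →ₗ[ℝ] (Fin n → ℝ) →ₗ[ℝ] (Fin n → ℝ) →ₗ[ℝ] ℝ)
    (h1 : ∀ x y z, t x y z = t y x z) (h2 : ∀ x y z, t x y z = t x z y)
    (h : ∀ x, cubicForm n x = t x x x) (x y z : Fin n → ℝ) :
    (mulLeft (upsilon n) x *ᵥ y) ⬝ᵥ z = t x y z := by
  have e : t x y z = t z y x := by rw [h1, h2, h1]
  rw [e]
  conv_rhs => rw [eq_sum_single z]
  simp only [map_sum, LinearMap.sum_apply, map_smul, LinearMap.smul_apply, smul_eq_mul]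
  refine Finset.sum_congr rfl fun I _ => ?_
  conv_rhs => rw [eq_sum_single y]
  simp only [map_sum, LinearMap.sum_apply, map_smul, LinearMap.smul_apply, smul_eq_mul]
  rw [mul_comm]
  change z I * ∑ J, mulLeft (upsilon n) x I J * y J = _
  refine congrArg _ (Finset.sum_congr rfl fun J _ => ?_)
  conv_rhs => rw [eq_sum_single x]
  simp only [map_sum, map_smul, smul_eq_mul]
  simp only [mulLeft, LinearMap.coe_mk, AddHom.coe_mk, Matrix.of_apply, upsilon_eq t h1 h2 h]
  rw [mul_comm]
  exact congrArg _ (Finset.sum_congr rfl fun K _ => mul_comm _ _)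

section frame

variable (c : MatrixCoordinates n k) (m : (Fin k → ℝ) →ₗ[ℝ] (Fin k → ℝ) →ₗ[ℝ] (Fin k → ℝ))

/-- The polarization of the cubic form of trace-free hermitian matrices, up to symmetrization. -/
noncomputable def polarForm (x y z : Fin n → ℝ) : ℝ :=
  planeMul (c.π x) (c.π y) ⬝ᵥ c.π z
    + ∑ i, ((idem i ⬝ᵥ c.π x) * (c.α i y ⬝ᵥ c.α i z) + (idem i ⬝ᵥ c.π y) * (c.α i x ⬝ᵥ c.α i z)
      + (idem i ⬝ᵥ c.π z) * (c.α i x ⬝ᵥ c.α i y))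
    + √3 / 2 * ∑ i, (m (c.α i x) (c.α (i + 1) y) ⬝ᵥ c.α (i + 2) z
      + m (c.α i y) (c.α (i + 1) x) ⬝ᵥ c.α (i + 2) z)

theorem planeMul_add_left (p q r : Fin 2 → ℝ) :
    planeMul (p + q) r = planeMul p r + planeMul q r := by
  ext i; fin_cases i <;> simp [planeMul] <;> ring

theorem planeMul_smul_left (s : ℝ) (p r : Fin 2 → ℝ) :
    planeMul (s • p) r = s • planeMul p r := by
  ext i; fin_cases i <;> simp [planeMul] <;> ring

theorem polarForm_swap (x y z : Fin n → ℝ) : polarForm c m x y z = polarForm c m y x z := by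
  simp only [polarForm, planeMul_comm (c.π x)]
  simp only [Fin.sum_univ_three, dotProduct_comm (c.α _ x)]
  ring

theorem polarForm_rotate (hm : ∀ a b c, m a b ⬝ᵥ c = a ⬝ᵥ m b c) (x y z : Fin n → ℝ) :
    polarForm c m x y z = polarForm c m y z x := by
  have h : ∀ a b c, m a b ⬝ᵥ c = m b c ⬝ᵥ a := fun a b c => by rw [hm, dotProduct_comm]
  have h1 : planeMul (c.π x) (c.π y) ⬝ᵥ c.π z = planeMul (c.π y) (c.π z) ⬝ᵥ c.π x := by
    rw [planeMul_comm, planeMul_dot, dotProduct_comm]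
  simp only [polarForm, h1, Fin.sum_univ_three, show (0 + 1 : Fin 3) = 1 from rfl,
    show (0 + 2 : Fin 3) = 2 from rfl, show (1 + 1 : Fin 3) = 2 from rfl,
    show (1 + 2 : Fin 3) = 0 from rfl, show (2 + 1 : Fin 3) = 0 from rfl,
    show (2 + 2 : Fin 3) = 1 from rfl]
  have s0 := h (c.α 0 x) (c.α 1 y) (c.α 2 z)
  have s1 := h (c.α 1 x) (c.α 2 y) (c.α 0 z)
  have s2 := h (c.α 2 x) (c.α 0 y) (c.α 1 z)
  have t0 := h (c.α 1 z) (c.α 2 y) (c.α 0 x)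
  have t1 := h (c.α 2 z) (c.α 0 y) (c.α 1 x)
  have t2 := h (c.α 0 z) (c.α 1 y) (c.α 2 x)
  have r0 := h (c.α 0 y) (c.α 1 x) (c.α 2 z)
  have r1 := h (c.α 1 y) (c.α 2 x) (c.α 0 z)
  have r2 := h (c.α 2 y) (c.α 0 x) (c.α 1 z)
  simp only [s0, s1, s2, r0, r1, r2, t0, t1, t2, dotProduct_comm (c.α _ x)]
  have t0 := h (c.α 1 x) (c.α 2 z) (c.α 0 y)
  have t1 := h (c.α 2 x) (c.α 0 z) (c.α 1 y)
  have t2 := h (c.α 0 x) (c.α 1 z) (c.α 2 y)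
  simp only [t0, t1, t2]
  ring

/-- The polarization as a trilinear map. -/
noncomputable def polarMap : (Fin n → ℝ) →ₗ[ℝ] (Fin n → ℝ) →ₗ[ℝ] (Fin n → ℝ) →ₗ[ℝ] ℝ :=
  LinearMap.mk₂ ℝ (fun x y =>
    { toFun := polarForm c m x y
      map_add' := fun z w => by
        simp only [polarForm, map_add, dotProduct_add, Fin.sum_univ_three]
        ring
      map_smul' := fun r z => by
        simp only [polarForm, map_smul, dotProduct_smul, Fin.sum_univ_three, smul_eq_mul,
          RingHom.id_apply]
        ring })
    (fun x x' y => by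
      refine LinearMap.ext fun z => ?_
      change polarForm c m _ _ _ = polarForm c m _ _ _ + polarForm c m _ _ _
      simp only [LinearMap.add_apply, polarForm, map_add,
        dotProduct_add, add_dotProduct, Fin.sum_univ_three, planeMul_add_left]
      ring)
    (fun r x y => by
      refine LinearMap.ext fun z => ?_
      change polarForm c m _ _ _ = r * polarForm c m _ _ _
      simp only [LinearMap.smul_apply, polarForm, map_smul,
        dotProduct_smul, smul_dotProduct, Fin.sum_univ_three, smul_eq_mul, planeMul_smul_left]
      ring)
    (fun x y y' => by
      refine LinearMap.ext fun z => ?_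
      change polarForm c m _ _ _ = polarForm c m _ _ _ + polarForm c m _ _ _
      simp only [LinearMap.add_apply, polarForm, map_add,
        dotProduct_add, add_dotProduct, Fin.sum_univ_three, planeMul_comm (c.π x),
        planeMul_add_left]
      ring)
    (fun r x y => by
      refine LinearMap.ext fun z => ?_
      change polarForm c m _ _ _ = r * polarForm c m _ _ _
      simp only [LinearMap.smul_apply, polarForm, map_smul,
        dotProduct_smul, smul_dotProduct, Fin.sum_univ_three, smul_eq_mul, planeMul_comm (c.π x),
        planeMul_smul_left]
      ring)

/-- If the cubic form is that of trace-free hermitian matrices in the given coordinates, these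
provide a Peirce decomposition. -/
noncomputable def Frame.ofCoordinates (m_dot : ∀ a b c, m a b ⬝ᵥ c = a ⬝ᵥ m b c)
    (m_dot_m : ∀ a b, m a b ⬝ᵥ m a b = (a ⬝ᵥ a) * (b ⬝ᵥ b))
    (h : ∀ x, cubicForm n x = planeMul (c.π x) (c.π x) ⬝ᵥ c.π x
      + 3 * ∑ i, (idem i ⬝ᵥ c.π x) * (c.α i x ⬝ᵥ c.α i x)
      + 3 * √3 * (m (c.α 0 x) (c.α 1 x) ⬝ᵥ c.α 2 x)) : Frame (upsilon n) k := by
  have hsymm : ∀ x y z, polarMap c m x y z = polarMap c m y x z := polarForm_swap c m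
  have hrot : ∀ x y z, polarMap c m x y z = polarMap c m y z x := polarForm_rotate c m m_dot
  have hright : ∀ x y z, polarMap c m x y z = polarMap c m x z y := fun x y z => by
    rw [hrot, hsymm, ← hrot]
  have hcub : ∀ x, cubicForm n x = polarMap c m x x x := by
    intro x
    rw [h]
    change _ = polarForm c m x x x
    have h' : ∀ a b c, m a b ⬝ᵥ c = m b c ⬝ᵥ a := fun a b c => by rw [m_dot, dotProduct_comm]
    simp only [polarForm, Fin.sum_univ_three, show (0 + 1 : Fin 3) = 1 from rfl,
      show (0 + 2 : Fin 3) = 2 from rfl, show (1 + 1 : Fin 3) = 2 from rfl,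
      show (1 + 2 : Fin 3) = 0 from rfl, show (2 + 1 : Fin 3) = 0 from rfl,
      show (2 + 2 : Fin 3) = 1 from rfl]
    rw [h' (c.α 2 x), h' (c.α 0 x), h' (c.α 1 x)]
    ring
  have hmul := mulLeft_upsilon_dot (polarMap c m) hsymm hright hcub
  exact
  { m := m
    m_dot := m_dot
    m_dot_m := m_dot_m
    δ := c.δ
    ι := c.ι
    δ_dot_δ := fun p q => by rw [c.δ_dot, c.π_δ]
    ι_dot_ι := fun i a b => by rw [c.ι_dot, c.α_ι, if_pos rfl]
    ι_dot_ι_of_ne := fun i j a b hij => by rw [c.ι_dot, c.α_ι, if_neg hij, dotProduct_zero]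
    δ_dot_ι := fun p i a => by rw [c.δ_dot, c.π_ι, dotProduct_zero]
    exists_eq := fun x => ⟨_, _, c.eq_add x⟩
    symm_left := fun I J K => by simp only [upsilon_eq _ hsymm hright hcub]; exact hsymm _ _ _
    symm_right := fun I J K => by simp only [upsilon_eq _ hsymm hright hcub]; exact hright _ _ _
    δ_mul_δ := fun p q => dotProduct_eq _ _ fun z => by
      rw [hmul, c.δ_dot]
      change polarForm c m _ _ _ = _
      simp [polarForm, c.π_δ, c.α_δ]
    δ_mul_ι := fun p i a => dotProduct_eq _ _ fun z => by
      rw [hmul, smul_dotProduct, c.ι_dot]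
      change polarForm c m _ _ _ = _
      simp only [polarForm, c.π_δ, c.α_δ, c.π_ι, c.α_ι]
      fin_cases i <;> simp [planeMul, Fin.sum_univ_three]
    ι_mul_ι := fun i a b => dotProduct_eq _ _ fun z => by
      rw [hmul, smul_dotProduct, c.δ_dot]
      change polarForm c m _ _ _ = _
      simp only [polarForm, c.π_ι, c.α_ι]
      fin_cases i <;> simp [planeMul, Fin.sum_univ_three] <;> ring
    ι_mul_ι_succ := fun i a b => dotProduct_eq _ _ fun z => by
      rw [hmul, smul_dotProduct, c.ι_dot]
      change polarForm c m _ _ _ = _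
      simp only [polarForm, c.π_ι, c.α_ι]
      fin_cases i <;> simp [planeMul, Fin.sum_univ_three] }

end frame

end CubicTensor

/-! ### Peirce decompositions of the four cubic forms -/

namespace CubicTensor

section octonion

theorem octonion_add_re (x y : Octonion) : (x + y).re = x.re + y.re := rfl
theorem octonion_sub_re (x y : Octonion) : (x - y).re = x.re - y.re := rfl
theorem octonion_star_re (x : Octonion) : (star x).re = x.re := rfl
theorem octonion_star_im (x : Octonion) : (star x).im = -x.im := rfl
theorem octonion_smul_re (r : ℝ) (x : Octonion) : (r • x).re = r * x.re := rfl
theorem octonion_smul_im (r : ℝ) (x : Octonion) : (r • x).im = r • x.im := rfl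
theorem octonion_one_re : (1 : Octonion).re = 1 := rfl
theorem octonion_one_im : (1 : Octonion).im = 0 := rfl
theorem octonion_mul_re (x y : Octonion) :
    (x * y).re = x.re * y.re - ∑ i, x.im i * y.im i := rfl
theorem octonion_mul_im (x y : Octonion) (c : Fin 7) : (x * y).im c = x.re * y.im c + x.im c * y.re
      + (x.im (c + 1) * y.im (c + 3) - x.im (c + 3) * y.im (c + 1))
      + (x.im (c + 2) * y.im (c + 6) - x.im (c + 6) * y.im (c + 2))
      + (x.im (c + 4) * y.im (c + 5) - x.im (c + 5) * y.im (c + 4)) := rfl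

theorem octonion_smul_mul (r : ℝ) (x y : Octonion) : (r • x) * y = r • (x * y) := by
  ext
  · simp only [octonion_mul_re, octonion_smul_re, octonion_smul_im, Pi.smul_apply, smul_eq_mul,
      mul_sub, Finset.mul_sum, mul_assoc]
  · simp only [octonion_mul_im, octonion_smul_re, octonion_smul_im, Pi.smul_apply, smul_eq_mul]
    ring

theorem octonion_mul_smul (r : ℝ) (x y : Octonion) : x * (r • y) = r • (x * y) := by
  ext
  · simp only [octonion_mul_re, octonion_smul_re, octonion_smul_im, Pi.smul_apply, smul_eq_mul,
      mul_sub, Finset.mul_sum, mul_left_comm]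
  · simp only [octonion_mul_im, octonion_smul_re, octonion_smul_im, Pi.smul_apply, smul_eq_mul]
    ring

theorem octonion_mul_one (x : Octonion) : x * 1 = x := by
  ext
  · simp [octonion_mul_re, octonion_one_re, octonion_one_im]
  · simp [octonion_mul_im, octonion_one_re, octonion_one_im]

theorem octonion_one_mul (x : Octonion) : 1 * x = x := by
  ext
  · simp [octonion_mul_re, octonion_one_re, octonion_one_im]
  · simp [octonion_mul_im, octonion_one_re, octonion_one_im]

theorem octonion_smul_smul (r s : ℝ) (x : Octonion) : r • (s • x) = (r * s) • x := by
  ext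
  · simp only [octonion_smul_re, mul_assoc]
  · simp only [octonion_smul_im, Pi.smul_apply, smul_eq_mul, mul_assoc]

/-- The real part of `(x y*) z` for octonions. -/
def octonionTriple (x y z : Octonion) : ℝ := ((x * star y) * z).re

theorem octonion_re_mul_assoc (x y z : Octonion) : ((x * y) * z).re = (x * (y * z)).re := by
  simp only [octonion_mul_re, octonion_mul_im, Fin.sum_univ_seven, Fin.isValue, Fin.reduceAdd]
  ring

theorem octonion_re_mul_comm (x y : Octonion) : (x * y).re = (y * x).re := by
  simp only [octonion_mul_re]
  congr 1
  · ring
  · exact Finset.sum_congr rfl fun _ _ => by ring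

theorem octonion_mul_star_re (x : Octonion) :
    (x * star x).re = x.re * x.re + ∑ i, x.im i * x.im i := by
  simp [octonion_mul_re, octonion_star_re, octonion_star_im]

theorem detOne_hermitianMatrix (s t : ℝ) (x y z : Octonion) :
    (detOne (hermitianMatrix s t x y z)).re / 2 =
      3 * s ^ 2 * t - t ^ 3 + 3 * ((√3 / 2 * s - t / 2) * (x.re * x.re + ∑ i, x.im i * x.im i)
        + (-(√3 / 2) * s - t / 2) * (y.re * y.re + ∑ i, y.im i * y.im i)
        + t * (z.re * z.re + ∑ i, z.im i * z.im i)) + 3 * √3 * octonionTriple x y z := by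
  have h3 := sqrt_three_sq
  have e1 : (y * (star x * star z)).re = octonionTriple x y z := by
    rw [octonionTriple, octonion_re_mul_comm, octonion_re_mul_assoc, octonion_re_mul_comm]
    simp only [octonion_mul_re, octonion_mul_im, octonion_star_re, octonion_star_im, Pi.neg_apply,
      Fin.sum_univ_seven, Fin.isValue, Fin.reduceAdd]
    ring
  have e2 : ((z * x) * star y).re = octonionTriple x y z := by
    rw [octonionTriple, octonion_re_mul_assoc, octonion_re_mul_comm]
  simp only [detOne, hermitianMatrix, Matrix.of_apply, Matrix.cons_val, octonion_smul_mul,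
    octonion_mul_smul, octonion_mul_one, octonion_one_mul, octonion_smul_smul, octonion_add_re,
    octonion_sub_re, octonion_smul_re, octonion_one_re, e1, e2, octonion_mul_star_re]
  linear_combination (s ^ 2 * t + t * (z.re * z.re + ∑ i, z.im i * z.im i)
    - (t + √3 * s) / 2 * (y.re * y.re + ∑ i, y.im i * y.im i)
    - (t - √3 * s) / 2 * (x.re * x.re + ∑ i, x.im i * x.im i) + √3 * octonionTriple x y z) * h3

end octonion

/-- The product `(a, b) ↦ conj (a b)` of the octonions, as vectors of `ℝ⁸`. -/
def octonionConjMul : (Fin 8 → ℝ) →ₗ[ℝ] (Fin 8 → ℝ) →ₗ[ℝ] (Fin 8 → ℝ) :=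
  LinearMap.mk₂ ℝ (fun a b =>
      let x : Octonion := ⟨a 0, Fin.tail a⟩
      let y : Octonion := ⟨b 0, Fin.tail b⟩
      Fin.cons (x * y).re (-(x * y).im))
    (fun a a' b => by
      ext c
      refine Fin.cases ?_ (fun c => ?_) c
      · simp [octonion_mul_re, Fin.tail, Fin.sum_univ_seven]; ring
      · simp [octonion_mul_im, Fin.tail]; ring)
    (fun r a b => by
      ext c
      refine Fin.cases ?_ (fun c => ?_) c
      · simp [octonion_mul_re, Fin.tail, Fin.sum_univ_seven]; ring
      · simp [octonion_mul_im, Fin.tail]; ring)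
    (fun a b b' => by
      ext c
      refine Fin.cases ?_ (fun c => ?_) c
      · simp [octonion_mul_re, Fin.tail, Fin.sum_univ_seven]; ring
      · simp [octonion_mul_im, Fin.tail]; ring)
    (fun r a b => by
      ext c
      refine Fin.cases ?_ (fun c => ?_) c
      · simp [octonion_mul_re, Fin.tail, Fin.sum_univ_seven]; ring
      · simp [octonion_mul_im, Fin.tail]; ring)

theorem octonionConjMul_zero (a b : Fin 8 → ℝ) : octonionConjMul a b 0 = a 0 * b 0
    - (a 1 * b 1 + a 2 * b 2 + a 3 * b 3 + a 4 * b 4 + a 5 * b 5 + a 6 * b 6 + a 7 * b 7) := by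
  change a 0 * b 0 - ∑ i : Fin 7, a i.succ * b i.succ = _
  rw [Fin.sum_univ_seven]
  rfl

theorem octonionConjMul_succ (a b : Fin 8 → ℝ) (c : Fin 7) : octonionConjMul a b c.succ =
    -(a 0 * b c.succ + a c.succ * b 0
      + (a (c + 1).succ * b (c + 3).succ - a (c + 3).succ * b (c + 1).succ)
      + (a (c + 2).succ * b (c + 6).succ - a (c + 6).succ * b (c + 2).succ)
      + (a (c + 4).succ * b (c + 5).succ - a (c + 5).succ * b (c + 4).succ)) := rfl

theorem octonionConjMul_dot (a b c : Fin 8 → ℝ) :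
    octonionConjMul a b ⬝ᵥ c = a ⬝ᵥ octonionConjMul b c := by
  simp only [dotProduct, Fin.sum_univ_succ, octonionConjMul_zero, octonionConjMul_succ]
  simp
  ring

theorem octonionConjMul_dot_self (a b : Fin 8 → ℝ) :
    octonionConjMul a b ⬝ᵥ octonionConjMul a b = (a ⬝ᵥ a) * (b ⬝ᵥ b) := by
  simp only [dotProduct, Fin.sum_univ_succ, octonionConjMul_zero, octonionConjMul_succ]
  simp
  ring

/-- The numbering of the matrix entries by the coordinates, for the octonions. -/
def octonionIndex : Fin 2 ⊕ Fin 3 × Fin 8 → Fin 26 :=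
  Sum.elim ![3, 4] fun l => (![![0, 5, 8, 14, 9, 15, 16, 17], ![1, 6, 10, 18, 11, 19, 20, 21],
    ![2, 7, 12, 22, 13, 23, 24, 25]] : Fin 3 → Fin 8 → Fin 26) l.1 l.2

/-- The sign `-1` for the coordinates of the entry with index `1` that are changed by conjugation:
the three entries in cyclic order are `X¹`, `conj X²`, `X³`. -/
def conjSign {k : ℕ} (i : Fin 3) (c : Fin k) : ℝ := if i = 1 ∧ c.val ≠ 0 then -1 else 1

theorem conjSign_mul_self {k : ℕ} (i : Fin 3) (c : Fin k) : conjSign i c * conjSign i c = 1 := by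
  rw [conjSign]
  split_ifs <;> norm_num

/-- The entries of the octonionic matrix `A(x)` as coordinates of `ℝ²⁶`. -/
noncomputable def octonionCoordinates : MatrixCoordinates 26 8 :=
  .ofEquiv (Equiv.ofBijective octonionIndex
    ((Fintype.bijective_iff_injective_and_card _).2 ⟨by decide +kernel, rfl⟩)) conjSign
    conjSign_mul_self

/-- The Peirce decomposition of `ℝ²⁶` given by the entries of the matrix `A(x)`. -/
noncomputable def octonionFrame : Frame (upsilon 26) 8 :=
  .ofCoordinates octonionCoordinates octonionConjMul octonionConjMul_dot octonionConjMul_dot_self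
    fun x => by
      rw [cubicForm, octonionMatrix, detOne_hermitianMatrix]
      have hπ : octonionCoordinates.π x = ![x 3, x 4] := by
        ext j; fin_cases j <;> rfl
      have h0 : octonionCoordinates.α 0 x = ![x 0, x 5, x 8, x 14, x 9, x 15, x 16, x 17] := by
        ext j
        change conjSign 0 j * x (octonionIndex (Sum.inr (0, j))) = _
        fin_cases j <;> simp [conjSign, octonionIndex]
      have h1 : octonionCoordinates.α 1 x =
          ![x 1, -x 6, -x 10, -x 18, -x 11, -x 19, -x 20, -x 21] := by
        ext j
        change conjSign 1 j * x (octonionIndex (Sum.inr (1, j))) = _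
        fin_cases j <;> simp [conjSign, octonionIndex]
      have h2 : octonionCoordinates.α 2 x = ![x 2, x 7, x 12, x 22, x 13, x 23, x 24, x 25] := by
        ext j
        change conjSign 2 j * x (octonionIndex (Sum.inr (2, j))) = _
        fin_cases j <;> simp [conjSign, octonionIndex]
      have ht : octonionTriple
          ⟨coordinate x 1, ![coordinate x 6, coordinate x 9, coordinate x 15, coordinate x 10,
            coordinate x 16, coordinate x 17, coordinate x 18]⟩
          ⟨coordinate x 2, ![coordinate x 7, coordinate x 11, coordinate x 19, coordinate x 12,
            coordinate x 20, coordinate x 21, coordinate x 22]⟩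
          ⟨coordinate x 3, ![coordinate x 8, coordinate x 13, coordinate x 23, coordinate x 14,
            coordinate x 24, coordinate x 25, coordinate x 26]⟩ =
          octonionConjMul (octonionCoordinates.α 0 x) (octonionCoordinates.α 1 x) ⬝ᵥ
            octonionCoordinates.α 2 x := by
        rw [h0, h1, h2, octonionTriple, octonion_mul_re, octonion_mul_re, Fin.sum_univ_seven,
          Fin.sum_univ_seven]
        simp only [octonion_mul_im]
        simp only [dotProduct, Fin.sum_univ_succ, octonionConjMul_zero, octonionConjMul_succ]
        simp [octonion_star_re, octonion_star_im, coordinate]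
        ring
      rw [ht, Fin.sum_univ_three, hπ, h0, h1, h2]
      simp [coordinate, Fin.sum_univ_succ, dotProduct, planeMul, idem]
      ring

/-- The product `(a, b) ↦ conj (a b)` of the quaternions, as vectors of `ℝ⁴`. -/
def quaternionConjMul : (Fin 4 → ℝ) →ₗ[ℝ] (Fin 4 → ℝ) →ₗ[ℝ] (Fin 4 → ℝ) :=
  LinearMap.mk₂ ℝ (fun a b =>
      ![a 0 * b 0 - a 1 * b 1 - a 2 * b 2 - a 3 * b 3,
        -(a 0 * b 1 + a 1 * b 0 + a 2 * b 3 - a 3 * b 2),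
        -(a 0 * b 2 - a 1 * b 3 + a 2 * b 0 + a 3 * b 1),
        -(a 0 * b 3 + a 1 * b 2 - a 2 * b 1 + a 3 * b 0)])
    (fun a a' b => by ext c; fin_cases c <;> simp <;> ring)
    (fun r a b => by ext c; fin_cases c <;> simp <;> ring)
    (fun a b b' => by ext c; fin_cases c <;> simp <;> ring)
    (fun r a b => by ext c; fin_cases c <;> simp <;> ring)

theorem quaternionConjMul_apply (a b : Fin 4 → ℝ) : quaternionConjMul a b =
    ![a 0 * b 0 - a 1 * b 1 - a 2 * b 2 - a 3 * b 3,
      -(a 0 * b 1 + a 1 * b 0 + a 2 * b 3 - a 3 * b 2),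
      -(a 0 * b 2 - a 1 * b 3 + a 2 * b 0 + a 3 * b 1),
      -(a 0 * b 3 + a 1 * b 2 - a 2 * b 1 + a 3 * b 0)] := rfl

/-- The numbering of the matrix entries by the coordinates, for the quaternions. -/
def quaternionIndex : Fin 2 ⊕ Fin 3 × Fin 4 → Fin 14 :=
  Sum.elim ![3, 4] fun l => (![![0, 5, 8, 9], ![1, 6, 10, 11],
    ![2, 7, 12, 13]] : Fin 3 → Fin 4 → Fin 14) l.1 l.2

/-- The entries of the quaternionic matrix `A(x)` as coordinates of `ℝ¹⁴`. -/
noncomputable def quaternionCoordinates : MatrixCoordinates 14 4 :=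
  .ofEquiv (Equiv.ofBijective quaternionIndex
    ((Fintype.bijective_iff_injective_and_card _).2 ⟨by decide +kernel, rfl⟩)) conjSign
    conjSign_mul_self

theorem quaternionCoordinates_π (x : Fin 14 → ℝ) : quaternionCoordinates.π x = ![x 3, x 4] := by
  ext j; fin_cases j <;> rfl

theorem quaternionCoordinates_α_zero (x : Fin 14 → ℝ) :
    quaternionCoordinates.α 0 x = ![x 0, x 5, x 8, x 9] := by
  ext j
  change conjSign 0 j * x (quaternionIndex (Sum.inr (0, j))) = _
  fin_cases j <;> simp [conjSign, quaternionIndex]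

theorem quaternionCoordinates_α_one (x : Fin 14 → ℝ) :
    quaternionCoordinates.α 1 x = ![x 1, -x 6, -x 10, -x 11] := by
  ext j
  change conjSign 1 j * x (quaternionIndex (Sum.inr (1, j))) = _
  fin_cases j <;> simp [conjSign, quaternionIndex]

theorem quaternionCoordinates_α_two (x : Fin 14 → ℝ) :
    quaternionCoordinates.α 2 x = ![x 2, x 7, x 12, x 13] := by
  ext j
  change conjSign 2 j * x (quaternionIndex (Sum.inr (2, j))) = _
  fin_cases j <;> simp [conjSign, quaternionIndex]

/-- The Peirce decomposition of `ℝ¹⁴` given by the entries of the matrix `A(x)`. -/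
noncomputable def quaternionFrame : Frame (upsilon 14) 4 :=
  .ofCoordinates quaternionCoordinates quaternionConjMul
    (fun a b c => by simp [quaternionConjMul_apply, dotProduct, Fin.sum_univ_succ]; ring)
    (fun a b => by simp [quaternionConjMul_apply, dotProduct, Fin.sum_univ_succ]; ring)
    fun x => by
      rw [cubicForm, octonionMatrix, detOne_hermitianMatrix, octonionTriple, octonion_mul_re,
        octonion_mul_re, Fin.sum_univ_seven, Fin.sum_univ_seven, quaternionCoordinates_α_zero,
        quaternionCoordinates_α_one, quaternionCoordinates_α_two, quaternionCoordinates_π,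
        Fin.sum_univ_three, quaternionCoordinates_α_zero, quaternionCoordinates_α_one,
        quaternionCoordinates_α_two]
      simp only [octonion_mul_im]
      simp [quaternionConjMul_apply, octonion_star_re, octonion_star_im, coordinate,
        Fin.sum_univ_succ, dotProduct, planeMul, idem]
      ring

/-- The product `(a, b) ↦ conj (a b)` of the complex numbers, as vectors of `ℝ²`. -/
def complexConjMul : (Fin 2 → ℝ) →ₗ[ℝ] (Fin 2 → ℝ) →ₗ[ℝ] (Fin 2 → ℝ) :=
  LinearMap.mk₂ ℝ (fun a b => ![a 0 * b 0 - a 1 * b 1, -(a 0 * b 1 + a 1 * b 0)])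
    (fun a a' b => by ext c; fin_cases c <;> simp <;> ring)
    (fun r a b => by ext c; fin_cases c <;> simp <;> ring)
    (fun a b b' => by ext c; fin_cases c <;> simp <;> ring)
    (fun r a b => by ext c; fin_cases c <;> simp <;> ring)

theorem complexConjMul_apply (a b : Fin 2 → ℝ) : complexConjMul a b =
    ![a 0 * b 0 - a 1 * b 1, -(a 0 * b 1 + a 1 * b 0)] := rfl

/-- The numbering of the matrix entries by the coordinates, for the complex numbers. -/
def complexIndex : Fin 2 ⊕ Fin 3 × Fin 2 → Fin 8 :=
  Sum.elim ![3, 4] fun l => (![![0, 5], ![1, 6], ![2, 7]] : Fin 3 → Fin 2 → Fin 8) l.1 l.2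

/-- The entries of the complex matrix `A(x)` as coordinates of `ℝ⁸`. -/
noncomputable def complexCoordinates : MatrixCoordinates 8 2 :=
  .ofEquiv (Equiv.ofBijective complexIndex
    ((Fintype.bijective_iff_injective_and_card _).2 ⟨by decide +kernel, rfl⟩)) conjSign
    conjSign_mul_self

theorem complexCoordinates_π (x : Fin 8 → ℝ) : complexCoordinates.π x = ![x 3, x 4] := by
  ext j; fin_cases j <;> rfl

theorem complexCoordinates_α_zero (x : Fin 8 → ℝ) : complexCoordinates.α 0 x = ![x 0, x 5] := by
  ext j
  change conjSign 0 j * x (complexIndex (Sum.inr (0, j))) = _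
  fin_cases j <;> simp [conjSign, complexIndex]

theorem complexCoordinates_α_one (x : Fin 8 → ℝ) : complexCoordinates.α 1 x = ![x 1, -x 6] := by
  ext j
  change conjSign 1 j * x (complexIndex (Sum.inr (1, j))) = _
  fin_cases j <;> simp [conjSign, complexIndex]

theorem complexCoordinates_α_two (x : Fin 8 → ℝ) : complexCoordinates.α 2 x = ![x 2, x 7] := by
  ext j
  change conjSign 2 j * x (complexIndex (Sum.inr (2, j))) = _
  fin_cases j <;> simp [conjSign, complexIndex]

/-- The Peirce decomposition of `ℝ⁸` given by the entries of the matrix `A(x)`. -/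
noncomputable def complexFrame : Frame (upsilon 8) 2 :=
  .ofCoordinates complexCoordinates complexConjMul
    (fun a b c => by simp [complexConjMul_apply, dotProduct, Fin.sum_univ_succ]; ring)
    (fun a b => by simp [complexConjMul_apply, dotProduct, Fin.sum_univ_succ]; ring)
    fun x => by
      rw [cubicForm, octonionMatrix, detOne_hermitianMatrix, octonionTriple, octonion_mul_re,
        octonion_mul_re, Fin.sum_univ_seven, Fin.sum_univ_seven, complexCoordinates_α_zero,
        complexCoordinates_α_one, complexCoordinates_α_two, complexCoordinates_π,
        Fin.sum_univ_three, complexCoordinates_α_zero, complexCoordinates_α_one,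
        complexCoordinates_α_two]
      simp only [octonion_mul_im]
      simp [complexConjMul_apply, octonion_star_re, octonion_star_im, coordinate,
        Fin.sum_univ_succ, dotProduct, planeMul, idem]
      ring

/-- The product of the real numbers, as vectors of `ℝ¹`. -/
def realConjMul : (Fin 1 → ℝ) →ₗ[ℝ] (Fin 1 → ℝ) →ₗ[ℝ] (Fin 1 → ℝ) :=
  LinearMap.mk₂ ℝ (fun a b => a * b) add_mul (fun r a b => smul_mul_assoc r a b) mul_add
    (fun r a b => mul_smul_comm r a b)

theorem realConjMul_apply (a b : Fin 1 → ℝ) : realConjMul a b = a * b := rfl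

/-- The numbering of the matrix entries by the coordinates, for the real numbers. -/
def realIndex : Fin 2 ⊕ Fin 3 × Fin 1 → Fin 5 :=
  Sum.elim ![3, 4] fun l => (![0, 1, 2] : Fin 3 → Fin 5) l.1

/-- The entries of the real matrix `A(x)` as coordinates of `ℝ⁵`. -/
noncomputable def realCoordinates : MatrixCoordinates 5 1 :=
  .ofEquiv (Equiv.ofBijective realIndex
    ((Fintype.bijective_iff_injective_and_card _).2 ⟨by decide +kernel, rfl⟩)) conjSign
    conjSign_mul_self

theorem realCoordinates_π (x : Fin 5 → ℝ) : realCoordinates.π x = ![x 3, x 4] := by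
  ext j; fin_cases j <;> rfl

theorem realCoordinates_α (i : Fin 3) (x : Fin 5 → ℝ) :
    realCoordinates.α i x = ![![x 0, x 1, x 2] i] := by
  ext j
  change conjSign i j * x (realIndex (Sum.inr (i, j))) = _
  fin_cases j; fin_cases i <;> simp [conjSign, realIndex]

/-- The Peirce decomposition of `ℝ⁵` given by the entries of the matrix `A(x)`. -/
noncomputable def realFrame : Frame (upsilon 5) 1 :=
  .ofCoordinates realCoordinates realConjMul
    (fun a b c => by simp [realConjMul_apply, dotProduct]; ring)
    (fun a b => by simp [realConjMul_apply, dotProduct]; ring)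
    fun x => by
      rw [cubicForm, octonionMatrix, detOne_hermitianMatrix, octonionTriple, octonion_mul_re,
        octonion_mul_re, Fin.sum_univ_seven, Fin.sum_univ_seven, realCoordinates_π,
        Fin.sum_univ_three]
      simp only [octonion_mul_im, realCoordinates_α]
      simp [realConjMul_apply, octonion_star_re, octonion_star_im, coordinate,
        Fin.sum_univ_succ, dotProduct, planeMul, idem]
      ring

end CubicTensor

/-! ### Hermitian matrices over the real, complex and quaternionic numbers -/

namespace CubicTensor

variable {n k : ℕ} {T : Fin n → Fin n → Fin n → ℝ} {D : Type} [Ring D] [Algebra ℝ D] [StarRing D]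

/-- A real part on a star algebra over `ℝ`: a trace form for which the hermitian form
`(a, b) ↦ re (a b*)` is positive definite, and for which the self-adjoint elements are real. The
algebras `ℝ`, `ℂ` and `ℍ` have such a real part. -/
structure RealPart (D : Type) [Ring D] [Algebra ℝ D] [StarRing D] where
  re : D →ₗ[ℝ] ℝ
  re_one : re 1 = 1
  re_mul_comm : ∀ a b, re (a * b) = re (b * a)
  re_star : ∀ a, re (star a) = re a
  re_mul_star_nonneg : ∀ a, 0 ≤ re (a * star a)
  eq_zero_of_re_mul_star : ∀ a, re (a * star a) = 0 → a = 0
  eq_of_star_eq : ∀ a, star a = a → a = re a • 1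

namespace RealPart

variable (R : RealPart D)

/-- The real part of the trace of a matrix. -/
def tr : Matrix (Fin 3) (Fin 3) D →ₗ[ℝ] ℝ where
  toFun B := R.re B.trace
  map_add' B C := by rw [Matrix.trace_add, map_add]
  map_smul' r B := by rw [Matrix.trace_smul, map_smul]; rfl

theorem tr_apply (B : Matrix (Fin 3) (Fin 3) D) :
    R.tr B = R.re (B 0 0) + R.re (B 1 1) + R.re (B 2 2) := by
  change R.re B.trace = _
  rw [Matrix.trace_fin_three, map_add, map_add]

theorem tr_mul (B C : Matrix (Fin 3) (Fin 3) D) :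
    R.tr (B * C) = ∑ i, ∑ j, R.re (B i j * C j i) := by
  change R.re (Matrix.trace _) = _
  simp [Matrix.trace, Matrix.mul_apply]

theorem tr_mul_comm (B C : Matrix (Fin 3) (Fin 3) D) : R.tr (B * C) = R.tr (C * B) := by
  rw [tr_mul, tr_mul, Finset.sum_comm]
  exact Finset.sum_congr rfl fun i _ => Finset.sum_congr rfl fun j _ => R.re_mul_comm _ _

theorem tr_conjTranspose (B : Matrix (Fin 3) (Fin 3) D) : R.tr Bᴴ = R.tr B := by
  simp only [tr_apply, Matrix.conjTranspose_apply, R.re_star]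

theorem tr_mul_conjTranspose_nonneg (B : Matrix (Fin 3) (Fin 3) D) : 0 ≤ R.tr (B * Bᴴ) := by
  rw [tr_mul]
  exact Finset.sum_nonneg fun i _ => Finset.sum_nonneg fun j _ => R.re_mul_star_nonneg _

theorem eq_zero_of_tr_mul_conjTranspose {B : Matrix (Fin 3) (Fin 3) D} (h : R.tr (B * Bᴴ) = 0) :
    B = 0 := by
  rw [tr_mul] at h
  have h1 := (Finset.sum_eq_zero_iff_of_nonneg fun i _ =>
    Finset.sum_nonneg fun j _ => R.re_mul_star_nonneg (B i j)).1 h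
  ext i j
  have h2 := (Finset.sum_eq_zero_iff_of_nonneg fun j _ => R.re_mul_star_nonneg (B i j)).1
    (h1 i (Finset.mem_univ _))
  exact R.eq_zero_of_re_mul_star _ (h2 j (Finset.mem_univ _))

theorem mul_star_eq (a : D) : a * star a = R.re (a * star a) • 1 :=
  R.eq_of_star_eq _ (by rw [star_mul, star_star])

theorem star_mul_eq (a : D) : star a * a = R.re (a * star a) • 1 := by
  rw [R.re_mul_comm]
  exact R.eq_of_star_eq _ (by rw [star_mul, star_star])

end RealPart

theorem hermitianMatrix_mul_self [StarModule ℝ D] (s t : ℝ) (x y z : D) :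
    hermitianMatrix s t x y z * hermitianMatrix s t x y z =
      !![((t - √3 * s) * (t - √3 * s)) • 1 + (√3 * √3) • (z * star z) + (√3 * √3) • (y * star y),
          (2 * √3 * t) • z + (√3 * √3) • (y * star x),
          (-√3 * t - √3 * √3 * s) • y + (√3 * √3) • (z * x);
        (2 * √3 * t) • star z + (√3 * √3) • (x * star y),
          ((t + √3 * s) * (t + √3 * s)) • 1 + (√3 * √3) • (star z * z) + (√3 * √3) • (x * star x),
          (-√3 * t + √3 * √3 * s) • x + (√3 * √3) • (star z * y);
        (-√3 * t - √3 * √3 * s) • star y + (√3 * √3) • (star x * star z),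
          (-√3 * t + √3 * √3 * s) • star x + (√3 * √3) • (star y * z),
          (4 * t * t) • 1 + (√3 * √3) • (star y * y) + (√3 * √3) • (star x * x)] := by
  ext i j
  rw [Matrix.mul_apply, Fin.sum_univ_three]
  fin_cases i <;> fin_cases j <;>
    simp only [hermitianMatrix, Fin.zero_eta, Fin.mk_one, Fin.reduceFinMk, Matrix.of_apply,
      Fin.isValue, Matrix.cons_val, smul_mul_smul_comm, mul_one, one_mul] <;> module

/-- A realization of a cubic form by trace-free hermitian matrices over `D`: an isometry `τ` of
`ℝᵏ` with `D` that takes the product of the Peirce decomposition to `(a, b) ↦ (a b)*`, and a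
parametrization `M` of the matrices. -/
structure MatrixModel (A : Frame T k) (R : RealPart D) where
  τ : (Fin k → ℝ) ≃ₗ[ℝ] D
  re_τ : ∀ a b, R.re (τ a * star (τ b)) = a ⬝ᵥ b
  τ_m : ∀ a b, τ (A.m a b) = star (τ a * τ b)
  M : (Fin n → ℝ) → Matrix (Fin 3) (Fin 3) D
  M_eq : ∀ (p : Fin 2 → ℝ) (a : Fin 3 → Fin k → ℝ), M (A.δ p + ∑ i, A.ι i (a i)) =
    hermitianMatrix (p 0) (p 1) (τ (a 0)) (star (τ (a 1))) (τ (a 2))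

namespace MatrixModel

variable [StarModule ℝ D] {A : Frame T k} {R : RealPart D} (S : MatrixModel A R)

theorem M_add (x y : Fin n → ℝ) : S.M (x + y) = S.M x + S.M y := by
  obtain ⟨p, a, rfl⟩ := A.exists_eq x
  obtain ⟨q, b, rfl⟩ := A.exists_eq y
  have h : A.δ p + ∑ i, A.ι i (a i) + (A.δ q + ∑ i, A.ι i (b i)) =
      A.δ (p + q) + ∑ i, A.ι i ((a + b) i) := by
    simp only [map_add, Pi.add_apply, Finset.sum_add_distrib]
    abel
  rw [h, S.M_eq, S.M_eq, S.M_eq]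
  ext i j
  fin_cases i <;> fin_cases j <;> simp [hermitianMatrix] <;> module

theorem M_smul (r : ℝ) (x : Fin n → ℝ) : S.M (r • x) = r • S.M x := by
  obtain ⟨p, a, rfl⟩ := A.exists_eq x
  have h : r • (A.δ p + ∑ i, A.ι i (a i)) = A.δ (r • p) + ∑ i, A.ι i ((r • a) i) := by
    simp only [map_smul, Pi.smul_apply, ← Finset.smul_sum, smul_add]
  rw [h, S.M_eq, S.M_eq]
  ext i j
  fin_cases i <;> fin_cases j <;> simp [hermitianMatrix] <;> module

/-- The parametrization as a linear map. -/
def toMatrix : (Fin n → ℝ) →ₗ[ℝ] Matrix (Fin 3) (Fin 3) D where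
  toFun := S.M
  map_add' := S.M_add
  map_smul' := S.M_smul

theorem toMatrix_eq (p : Fin 2 → ℝ) (a : Fin 3 → Fin k → ℝ) :
    S.toMatrix (A.δ p + ∑ i, A.ι i (a i)) =
      hermitianMatrix (p 0) (p 1) (S.τ (a 0)) (star (S.τ (a 1))) (S.τ (a 2)) := S.M_eq p a

theorem toMatrix_conjTranspose (x : Fin n → ℝ) : (S.toMatrix x)ᴴ = S.toMatrix x := by
  obtain ⟨p, a, rfl⟩ := A.exists_eq x
  rw [toMatrix_eq]
  ext i j
  fin_cases i <;> fin_cases j <;> simp [hermitianMatrix]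

theorem tr_toMatrix (x : Fin n → ℝ) : R.tr (S.toMatrix x) = 0 := by
  obtain ⟨p, a, rfl⟩ := A.exists_eq x
  rw [toMatrix_eq, RealPart.tr_apply]
  simp [hermitianMatrix, R.re_one]
  ring

/-- The square of the matrix is given by the product of the cubic form. -/
theorem toMatrix_mul_self (x : Fin n → ℝ) : S.toMatrix (mulLeft T x *ᵥ x) =
    S.toMatrix x * S.toMatrix x - (2 * (x ⬝ᵥ x)) • 1 := by
  obtain ⟨p, a, rfl⟩ := A.exists_eq x
  have hdot : (A.δ p + ∑ i, A.ι i (a i)) ⬝ᵥ (A.δ p + ∑ i, A.ι i (a i)) =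
      p 0 * p 0 + p 1 * p 1 + (a 0 ⬝ᵥ a 0 + a 1 ⬝ᵥ a 1 + a 2 ⬝ᵥ a 2) := by
    rw [← Fin.sum_univ_two fun i => p i * p i]
    change _ = p ⬝ᵥ p + _
    simp [Fin.sum_univ_three, A.δ_dot_δ, A.ι_dot_ι, A.δ_dot_ι, A.ι_dot_δ, A.ι_dot_ι_of_ne]
  rw [A.mul_eq, hdot, toMatrix_eq, toMatrix_eq]
  have h3 := sqrt_three_sq
  have e1 : ∀ i, S.τ (a i) * star (S.τ (a i)) = (a i ⬝ᵥ a i) • 1 := fun i => by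
    rw [R.mul_star_eq, S.re_τ]
  have e2 : ∀ i, star (S.τ (a i)) * S.τ (a i) = (a i ⬝ᵥ a i) • 1 := fun i => by
    rw [R.star_mul_eq, S.re_τ]
  have d0 : ∀ p q : Fin 2 → ℝ, p ⬝ᵥ q = p 0 * q 0 + p 1 * q 1 := fun p q => by
    simp [dotProduct]
  simp only [map_add, map_smul, S.τ_m, d0, Fin.isValue, show (0 + 1 : Fin 3) = 1 from rfl,
    show (0 + 2 : Fin 3) = 2 from rfl, show (1 + 1 : Fin 3) = 2 from rfl,
    show (1 + 2 : Fin 3) = 0 from rfl, show (2 + 1 : Fin 3) = 0 from rfl,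
    show (2 + 2 : Fin 3) = 1 from rfl, Fin.sum_univ_three, idem, planeMul, Matrix.cons_val,
    Pi.add_apply, Pi.smul_apply, smul_eq_mul]
  rw [hermitianMatrix_mul_self, star_star, e1, e2, e1, e2, e1, e2]
  generalize S.τ (a 0) = x
  generalize S.τ (a 1) = y
  generalize S.τ (a 2) = z
  ext i j
  have off : ∀ {b c : D} (r : ℝ), b = c → b = c - r • (0 : D) := fun r h => by
    rw [smul_zero, sub_zero, h]
  fin_cases i <;> fin_cases j <;>
    simp only [hermitianMatrix, Fin.zero_eta, Fin.mk_one, Fin.reduceFinMk, Matrix.sub_apply,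
      Matrix.of_apply, Matrix.smul_apply, Matrix.one_apply, Fin.isValue, Matrix.cons_val, star_add,
      star_smul, star_mul, star_star, star_trivial, if_true]
  · simp only [smul_smul, ← add_smul, ← sub_smul]
    congr 1
    linear_combination (-(a 0 ⬝ᵥ a 0) / 2 - (a 1 ⬝ᵥ a 1) / 2 - a 2 ⬝ᵥ a 2 - p 0 * p 0) * h3
  · exact off _ (by module)
  · exact off _ (by module)
  · exact off _ (by module)
  · simp only [smul_smul, ← add_smul, ← sub_smul]
    congr 1
    linear_combination (-(a 0 ⬝ᵥ a 0) / 2 - (a 1 ⬝ᵥ a 1) / 2 - a 2 ⬝ᵥ a 2 - p 0 * p 0) * h3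
  · exact off _ (by module)
  · exact off _ (by module)
  · exact off _ (by module)
  · simp only [smul_smul, ← add_smul, ← sub_smul]
    congr 1
    linear_combination (-(a 0 ⬝ᵥ a 0) - a 1 ⬝ᵥ a 1) * h3

/-- Polarization of `toMatrix_mul_self`. -/
theorem toMatrix_mul (x y : Fin n → ℝ) : S.toMatrix (mulLeft T x *ᵥ y) =
    (1 / 2 : ℝ) • (S.toMatrix x * S.toMatrix y + S.toMatrix y * S.toMatrix x)
      - (2 * (x ⬝ᵥ y)) • 1 := by
  have h := S.toMatrix_mul_self (x + y)
  have hx := S.toMatrix_mul_self x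
  have hy := S.toMatrix_mul_self y
  simp only [map_add, Matrix.add_mulVec, Matrix.mulVec_add, add_dotProduct, dotProduct_add,
    A.mul_comm y x, dotProduct_comm y x, hx, hy, add_mul, mul_add] at h
  linear_combination (norm := module) (1 / 2 : ℝ) • h

theorem tr_toMatrix_mul (x y : Fin n → ℝ) :
    R.tr (S.toMatrix x * S.toMatrix y) = 6 * (x ⬝ᵥ y) := by
  have h := congrArg R.tr (S.toMatrix_mul x y)
  rw [tr_toMatrix, map_sub, map_smul, map_smul, map_add, R.tr_mul_comm (S.toMatrix y),
    R.tr_apply 1] at h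
  simp [R.re_one] at h
  linarith

/-- The vector of a trace-free hermitian matrix; on other matrices, that of its orthogonal
projection. -/
noncomputable def ofMatrix : Matrix (Fin 3) (Fin 3) D →ₗ[ℝ] (Fin n → ℝ) where
  toFun B I := R.tr (S.toMatrix (Pi.single I 1) * B) / 6
  map_add' B C := by ext I; simp [mul_add, add_div]
  map_smul' r B := by ext I; simp [mul_div_assoc]

theorem ofMatrix_dotProduct (B : Matrix (Fin 3) (Fin 3) D) (x : Fin n → ℝ) :
    x ⬝ᵥ S.ofMatrix B = R.tr (S.toMatrix x * B) / 6 := by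
  conv_rhs => rw [eq_sum_single x]
  simp only [map_sum, Finset.sum_mul, map_smul, Matrix.smul_mul, Finset.sum_div, smul_eq_mul,
    mul_div_assoc]
  rfl

theorem ofMatrix_toMatrix (x : Fin n → ℝ) : S.ofMatrix (S.toMatrix x) = x := by
  refine (dotProduct_eq _ _ fun y => ?_)
  rw [dotProduct_comm, ofMatrix_dotProduct, tr_toMatrix_mul, dotProduct_comm x]
  ring

theorem toMatrix_injective : Function.Injective S.toMatrix :=
  Function.LeftInverse.injective S.ofMatrix_toMatrix

/-- The matrices of the parametrization are all the trace-free hermitian ones. -/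
theorem exists_toMatrix_eq {B : Matrix (Fin 3) (Fin 3) D} (h1 : Bᴴ = B) (h2 : R.tr B = 0) :
    ∃ x, S.toMatrix x = B := by
  have hs : ∀ i j, star (B j i) = B i j := fun i j => congrFun (congrFun h1 i) j
  have h0 := R.eq_of_star_eq _ (hs 0 0)
  have h1 := R.eq_of_star_eq _ (hs 1 1)
  have h2' := R.eq_of_star_eq _ (hs 2 2)
  rw [R.tr_apply] at h2
  have h3 := sqrt_three_sq
  have h3' : (√3)⁻¹ * √3 = 1 := inv_mul_cancel₀ (by positivity)
  set a : Fin 3 → Fin k → ℝ := fun i =>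
    (√3)⁻¹ • S.τ.symm ((![B 1 2, B 2 0, B 0 1] : Fin 3 → D) i) with ha
  have ha' : ∀ i, √3 • S.τ (a i) = (![B 1 2, B 2 0, B 0 1] : Fin 3 → D) i := fun i => by
    rw [ha, map_smul, LinearEquiv.apply_symm_apply, smul_smul, mul_comm, h3', one_smul]
  have ha'' : ∀ i, √3 • star (S.τ (a i)) =
      star ((![B 1 2, B 2 0, B 0 1] : Fin 3 → D) i) := fun i => by
    rw [← ha', star_smul, star_trivial √3]
  refine ⟨A.δ ![(R.re (B 1 1) - R.re (B 0 0)) * √3 / 6, -R.re (B 2 2) / 2] + ∑ i, A.ι i (a i), ?_⟩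
  rw [toMatrix_eq]
  ext i j
  fin_cases i <;> fin_cases j <;>
    simp only [hermitianMatrix, Fin.zero_eta, Fin.mk_one, Fin.reduceFinMk, Matrix.of_apply,
      Fin.isValue, Matrix.cons_val, star_star, ha', ha'', hs]
  · refine Eq.trans ?_ h0.symm
    congr 1
    linear_combination -(R.re (B 1 1) - R.re (B 0 0)) / 6 * h3 - h2 / 2
  · refine Eq.trans ?_ h1.symm
    congr 1
    linear_combination (R.re (B 1 1) - R.re (B 0 0)) / 6 * h3 - h2 / 2
  · refine Eq.trans ?_ h2'.symm
    congr 1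
    ring

end MatrixModel

end CubicTensor

/-! ### The action of unitary matrices by conjugation -/

namespace CubicTensor

variable {n k : ℕ} {T : Fin n → Fin n → Fin n → ℝ} {D : Type}

namespace MatrixModel

section algebra

variable [Ring D] [Algebra ℝ D] [StarRing D] [StarModule ℝ D] {A : Frame T k} {R : RealPart D}
  (S : MatrixModel A R)

/-- The matrix of `x ↦ g A(x) g*` for a unitary matrix `g`. -/
noncomputable def rho (g : Matrix (Fin 3) (Fin 3) D) : Matrix (Fin n) (Fin n) ℝ :=
  Matrix.of fun I J => S.ofMatrix (g * S.toMatrix (Pi.single J 1) * gᴴ) I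

theorem rho_mulVec (g : Matrix (Fin 3) (Fin 3) D) (x : Fin n → ℝ) :
    S.rho g *ᵥ x = S.ofMatrix (g * S.toMatrix x * gᴴ) := by
  conv_rhs => rw [eq_sum_single x]
  simp only [map_sum, map_smul, Finset.mul_sum, Finset.sum_mul, Matrix.mul_smul, Matrix.smul_mul]
  ext I
  simp only [Finset.sum_apply, Pi.smul_apply, smul_eq_mul]
  change ∑ J, S.rho g I J * x J = _
  exact Finset.sum_congr rfl fun J _ => mul_comm _ _

theorem conjTranspose_mul_of_mem {g : Matrix (Fin 3) (Fin 3) D}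
    (hg : g ∈ unitary (Matrix (Fin 3) (Fin 3) D)) : gᴴ * g = 1 := (Unitary.mem_iff.1 hg).1

theorem mul_conjTranspose_of_mem {g : Matrix (Fin 3) (Fin 3) D}
    (hg : g ∈ unitary (Matrix (Fin 3) (Fin 3) D)) : g * gᴴ = 1 := (Unitary.mem_iff.1 hg).2

theorem conjTranspose_mem {g : Matrix (Fin 3) (Fin 3) D}
    (hg : g ∈ unitary (Matrix (Fin 3) (Fin 3) D)) :
    gᴴ ∈ unitary (Matrix (Fin 3) (Fin 3) D) := Unitary.star_mem hg

theorem toMatrix_rho {g : Matrix (Fin 3) (Fin 3) D}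
    (hg : g ∈ unitary (Matrix (Fin 3) (Fin 3) D)) (x : Fin n → ℝ) :
    S.toMatrix (S.rho g *ᵥ x) = g * S.toMatrix x * gᴴ := by
  obtain ⟨y, hy⟩ : ∃ y, S.toMatrix y = g * S.toMatrix x * gᴴ := by
    refine S.exists_toMatrix_eq ?_ ?_
    · simp only [Matrix.conjTranspose_mul, Matrix.conjTranspose_conjTranspose,
        toMatrix_conjTranspose, mul_assoc]
    · rw [R.tr_mul_comm, ← mul_assoc, conjTranspose_mul_of_mem hg, one_mul, tr_toMatrix]
  rw [rho_mulVec, ← hy, ofMatrix_toMatrix]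

/-- A matrix that acts as conjugation by `g` is `rho g`. -/
theorem eq_rho {g : Matrix (Fin 3) (Fin 3) D} {h : Matrix (Fin n) (Fin n) ℝ}
    (hg : g ∈ unitary (Matrix (Fin 3) (Fin 3) D))
    (hh : ∀ x, S.toMatrix (h *ᵥ x) = g * S.toMatrix x * gᴴ) : h = S.rho g :=
  matrix_ext_mulVec fun x => S.toMatrix_injective (by rw [hh, S.toMatrix_rho hg])

theorem rho_mul {g h : Matrix (Fin 3) (Fin 3) D} (hg : g ∈ unitary (Matrix (Fin 3) (Fin 3) D))
    (hh : h ∈ unitary (Matrix (Fin 3) (Fin 3) D)) : S.rho (g * h) = S.rho g * S.rho h := by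
  refine (S.eq_rho (mul_mem hg hh) fun x => ?_).symm
  rw [← Matrix.mulVec_mulVec, S.toMatrix_rho hg, S.toMatrix_rho hh, Matrix.conjTranspose_mul]
  simp only [mul_assoc]

theorem rho_one : S.rho 1 = 1 :=
  (S.eq_rho (one_mem _) fun x => by simp).symm

theorem transpose_rho_mul_rho {g : Matrix (Fin 3) (Fin 3) D}
    (hg : g ∈ unitary (Matrix (Fin 3) (Fin 3) D)) : (S.rho g)ᵀ * S.rho g = 1 := by
  refine matrix_ext_mulVec fun x => dotProduct_eq _ _ fun y => ?_
  have h1 : ((S.rho g)ᵀ *ᵥ (S.rho g *ᵥ x)) ⬝ᵥ y = (S.rho g *ᵥ x) ⬝ᵥ (S.rho g *ᵥ y) := by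
    rw [Matrix.mulVec_transpose, Matrix.dotProduct_mulVec]
  have h2 := S.tr_toMatrix_mul (S.rho g *ᵥ x) (S.rho g *ᵥ y)
  have h3 := S.tr_toMatrix_mul x y
  rw [S.toMatrix_rho hg, S.toMatrix_rho hg] at h2
  have h4 : g * S.toMatrix x * gᴴ * (g * S.toMatrix y * gᴴ) =
      g * (S.toMatrix x * S.toMatrix y * gᴴ) := by
    have e : ∀ B, gᴴ * (g * B) = B := fun B => by
      rw [← mul_assoc, conjTranspose_mul_of_mem hg, one_mul]
    simp only [mul_assoc, e]
  rw [h4, R.tr_mul_comm, mul_assoc, conjTranspose_mul_of_mem hg, mul_one, h3] at h2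
  rw [← Matrix.mulVec_mulVec, h1, Matrix.one_mulVec]
  linarith

theorem rho_mulLeft {g : Matrix (Fin 3) (Fin 3) D}
    (hg : g ∈ unitary (Matrix (Fin 3) (Fin 3) D)) (x y : Fin n → ℝ) :
    S.rho g *ᵥ (mulLeft T x *ᵥ y) = mulLeft T (S.rho g *ᵥ x) *ᵥ (S.rho g *ᵥ y) := by
  apply S.toMatrix_injective
  have e : ∀ B, gᴴ * (g * B) = B := fun B => by
    rw [← mul_assoc, conjTranspose_mul_of_mem hg, one_mul]
  rw [toMatrix_mul, S.toMatrix_rho hg, S.toMatrix_rho hg, S.toMatrix_rho hg, toMatrix_mul,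
    mulVec_dotProduct_mulVec (S.transpose_rho_mul_rho hg)]
  simp only [mul_sub, sub_mul, mul_add, add_mul, Matrix.mul_smul, Matrix.smul_mul, mul_assoc, e,
    mul_one, mul_conjTranspose_of_mem hg]

theorem det_rho_mul_self {g : Matrix (Fin 3) (Fin 3) D}
    (hg : g ∈ unitary (Matrix (Fin 3) (Fin 3) D)) : (S.rho g).det * (S.rho g).det = 1 := by
  have h := congrArg Matrix.det (S.transpose_rho_mul_rho hg)
  rwa [Matrix.det_mul, Matrix.det_transpose, Matrix.det_one] at h

theorem rho_mem {g : Matrix (Fin 3) (Fin 3) D} (hg : g ∈ unitary (Matrix (Fin 3) (Fin 3) D))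
    (hd : (S.rho g).det = 1) : S.rho g ∈ rotationAutomorphisms T :=
  ⟨S.transpose_rho_mul_rho hg, hd, S.rho_mulLeft hg⟩

theorem apply_norm_le_of_mem {g : Matrix (Fin 3) (Fin 3) D}
    (hg : g ∈ unitary (Matrix (Fin 3) (Fin 3) D)) (i j : Fin 3) :
    R.re (g i j * star (g i j)) ≤ 1 := by
  have h := congrArg R.re (congrFun (congrFun (mul_conjTranspose_of_mem hg) i) i)
  rw [Matrix.one_apply_eq, R.re_one, Matrix.mul_apply, map_sum] at h
  rw [← h]
  exact Finset.single_le_sum (f := fun j => R.re (g i j * star (g i j)))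
    (fun j _ => R.re_mul_star_nonneg _) (Finset.mem_univ j)

end algebra

section topology

variable [NormedRing D] [NormedAlgebra ℝ D] [StarRing D] [StarModule ℝ D] [ContinuousStar D]
  [FiniteDimensional ℝ D] {A : Frame T k} {R : RealPart D} (S : MatrixModel A R)

theorem continuous_tr : Continuous R.tr := R.tr.continuous_of_finiteDimensional

theorem continuous_rho : Continuous S.rho := by
  refine continuous_matrix fun I J => ?_
  have h : Continuous fun B : Matrix (Fin 3) (Fin 3) D => S.ofMatrix B I :=
    ((LinearMap.proj I).comp S.ofMatrix).continuous_of_finiteDimensional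
  refine h.comp ?_
  exact (continuous_id.matrix_mul continuous_const).matrix_mul continuous_id.matrix_conjTranspose

include S in
/-- The entries of a unitary matrix are bounded by `1` in the norm given by the real part, which by
finiteness of the dimension is equivalent to the given one. -/
theorem isCompact_unitary :
    IsCompact (unitary (Matrix (Fin 3) (Fin 3) D) : Set (Matrix (Fin 3) (Fin 3) D)) := by
  have hτ : Continuous S.τ := S.τ.toLinearMap.continuous_of_finiteDimensional
  have hball : IsCompact {a : Fin k → ℝ | a ⬝ᵥ a ≤ 1} := by
    refine IsCompact.of_isClosed_subset (isCompact_univ_pi fun _ => isCompact_Icc (a := (-1 : ℝ))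
      (b := 1)) (isClosed_le (by fun_prop) continuous_const) ?_
    intro a ha c _
    refine abs_le.1 (abs_le_one_iff_mul_self_le_one.2 (le_trans ?_ ha))
    exact Finset.single_le_sum (f := fun c => a c * a c) (fun c _ => mul_self_nonneg _)
      (Finset.mem_univ c)
  have hD := hball.image hτ
  refine IsCompact.of_isClosed_subset (isCompact_univ_pi fun _ : Fin 3 =>
    isCompact_univ_pi fun _ : Fin 3 => hD) ?_ ?_
  · have h : (unitary (Matrix (Fin 3) (Fin 3) D) : Set (Matrix (Fin 3) (Fin 3) D)) =
        {g | gᴴ * g = 1} ∩ {g | g * gᴴ = 1} := by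
      ext g
      exact Unitary.mem_iff
    rw [h]
    exact (isClosed_eq (continuous_id.matrix_conjTranspose.matrix_mul continuous_id)
      continuous_const).inter (isClosed_eq (continuous_id.matrix_mul
        continuous_id.matrix_conjTranspose) continuous_const)
  · intro g hg i _ j _
    refine ⟨S.τ.symm (g i j), ?_, LinearEquiv.apply_symm_apply _ _⟩
    change S.τ.symm (g i j) ⬝ᵥ S.τ.symm (g i j) ≤ 1
    rw [← S.re_τ, LinearEquiv.apply_symm_apply]
    exact apply_norm_le_of_mem hg i j

open scoped Matrix.Norms.Operator

theorem exp_mem_unitary {Z : Matrix (Fin 3) (Fin 3) D} (hZ : Zᴴ = -Z) :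
    NormedSpace.exp Z ∈ unitary (Matrix (Fin 3) (Fin 3) D) := by
  have : CompleteSpace D := FiniteDimensional.complete ℝ D
  let : NormedAlgebra ℚ D := NormedAlgebra.restrictScalars ℚ ℝ D
  have h : (NormedSpace.exp Z)ᴴ = NormedSpace.exp (-Z) := by rw [← Matrix.exp_conjTranspose, hZ]
  refine Unitary.mem_iff.2 ⟨?_, ?_⟩
  · rw [Matrix.star_eq_conjTranspose, h, ← Matrix.exp_add_of_commute _ _
      (Commute.neg_left (Commute.refl Z)), neg_add_cancel, NormedSpace.exp_zero]
  · rw [Matrix.star_eq_conjTranspose, h, ← Matrix.exp_add_of_commute _ _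
      (Commute.neg_right (Commute.refl Z)), add_neg_cancel, NormedSpace.exp_zero]

/-- The determinant is a square, since `exp Z` is the square of `exp (Z / 2)`. -/
theorem det_rho_exp {Z : Matrix (Fin 3) (Fin 3) D} (hZ : Zᴴ = -Z) :
    (S.rho (NormedSpace.exp Z)).det = 1 := by
  have : CompleteSpace D := FiniteDimensional.complete ℝ D
  let : NormedAlgebra ℚ D := NormedAlgebra.restrictScalars ℚ ℝ D
  have h : NormedSpace.exp Z =
      NormedSpace.exp ((1 / 2 : ℝ) • Z) * NormedSpace.exp ((1 / 2 : ℝ) • Z) := by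
    rw [← Matrix.exp_add_of_commute _ _ (Commute.refl _), ← add_smul]
    norm_num
  have hZ' : ((1 / 2 : ℝ) • Z)ᴴ = -((1 / 2 : ℝ) • Z) := by
    rw [Matrix.conjTranspose_smul, hZ, star_trivial (1 / 2 : ℝ), smul_neg]
  rw [h, S.rho_mul (exp_mem_unitary hZ') (exp_mem_unitary hZ'), Matrix.det_mul,
    S.det_rho_mul_self (exp_mem_unitary hZ')]

theorem hasDerivAt_tr_exp (B C Z : Matrix (Fin 3) (Fin 3) D) (t : ℝ) :
    HasDerivAt (fun t : ℝ => R.tr (B * NormedSpace.exp (t • Z) * C))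
      (R.tr (B * (NormedSpace.exp (t • Z) * Z) * C)) t := by
  have : CompleteSpace D := FiniteDimensional.complete ℝ D
  have h := ((hasDerivAt_exp_smul_const (𝕂 := ℝ) Z t).const_mul B).mul_const C
  exact (LinearMap.toContinuousLinearMap R.tr).hasFDerivAt.comp_hasDerivAt t h

end topology

end MatrixModel

end CubicTensor

/-! ### Critical points on the unitary group -/

namespace CubicTensor

variable {n k : ℕ} {T : Fin n → Fin n → Fin n → ℝ} {D : Type}

/-- The second derivative is not positive at a maximum. -/
theorem second_deriv_nonpos {f f' : ℝ → ℝ} {c : ℝ} (h : ∀ t, HasDerivAt f (f' t) t)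
    (h' : HasDerivAt f' c 0) (hmax : ∀ t, f t ≤ f 0) : c ≤ 0 := by
  by_contra hc
  have e : deriv f = f' := funext fun t => (h t).deriv
  have h0 : deriv f 0 = 0 := by
    have : IsLocalMax f 0 := Filter.Eventually.of_forall hmax
    exact this.deriv_eq_zero
  have hmin : IsLocalMin f 0 := by
    refine isLocalMin_of_deriv_deriv_pos ?_ h0 (h 0).continuousAt
    rw [e, h'.deriv]
    exact not_le.1 hc
  have hconst : f =ᶠ[nhds 0] fun _ => f 0 := hmin.mono fun t ht => le_antisymm (hmax t) ht
  have h1 : deriv f =ᶠ[nhds 0] deriv fun _ => f 0 := hconst.deriv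
  have h2 := h1.deriv_eq
  rw [e, h'.deriv] at h2
  simp at h2
  exact hc h2.le

namespace MatrixModel

variable [NormedRing D] [NormedAlgebra ℝ D] [StarRing D] [StarModule ℝ D] [ContinuousStar D]
  [FiniteDimensional ℝ D] {A : Frame T k} {R : RealPart D} (S : MatrixModel A R)

open scoped Matrix.Norms.Operator

theorem eq_zero_of_skew_of_tr {Z : Matrix (Fin 3) (Fin 3) D} (hZ : Zᴴ = -Z)
    (h : R.tr (Z * Z) = 0) : Z = 0 :=
  R.eq_zero_of_tr_mul_conjTranspose (by rw [hZ, mul_neg, map_neg, h, neg_zero])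

theorem conjTranspose_smul_of_skew {Z : Matrix (Fin 3) (Fin 3) D} (hZ : Zᴴ = -Z) (t : ℝ) :
    (t • Z)ᴴ = -(t • Z) := by
  rw [Matrix.conjTranspose_smul, hZ, star_trivial t, smul_neg]

/-- The elements of the closed group `G` act with determinant one. Let `g'` range over the elements
of `G` that act with determinant one. The product `k = g' g` with the largest real trace is
hermitian by the condition of first order; the condition of second order is that `P W P = 0` for
all antihermitian `W`, where `P = (1 - k) / 2`. The assumption `hG` says that this is only possible
for `k = 1`. -/
theorem det_rho {G : Set (Matrix (Fin 3) (Fin 3) D)}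
    (hG0 : G ⊆ (unitary (Matrix (Fin 3) (Fin 3) D) : Set (Matrix (Fin 3) (Fin 3) D)))
    (hG1 : IsClosed G) (hG2 : 1 ∈ G) (hG3 : ∀ g ∈ G, ∀ h ∈ G, g * h ∈ G)
    (hG4 : ∀ Z : Matrix (Fin 3) (Fin 3) D, Zᴴ = -Z → NormedSpace.exp Z ∈ G)
    (hG : ∀ k ∈ G, kᴴ = k → (∀ W : Matrix (Fin 3) (Fin 3) D, Wᴴ = -W →
      (1 - k) * W * (1 - k) = 0) → k = 1)
    {g : Matrix (Fin 3) (Fin 3) D} (hg : g ∈ G) : (S.rho g).det = 1 := by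
  have hcomp : IsCompact (G ∩ {g | (S.rho g).det = 1}) := by
    refine S.isCompact_unitary.of_isClosed_subset (hG1.inter ?_) fun g h => hG0 h.1
    exact isClosed_eq S.continuous_rho.matrix_det continuous_const
  have hc : Continuous fun g' : Matrix (Fin 3) (Fin 3) D => R.tr (g' * g) :=
    (continuous_tr (R := R)).comp (continuous_id.matrix_mul continuous_const)
  obtain ⟨g', ⟨hg'G, hg'd⟩, hmax⟩ := hcomp.exists_isMaxOn
    ⟨1, hG2, by change (S.rho 1).det = 1; rw [S.rho_one, Matrix.det_one]⟩ hc.continuousOn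
  set k := g' * g with hk
  have hkG : k ∈ G := hG3 _ hg'G _ hg
  have hkmax : ∀ Z : Matrix (Fin 3) (Fin 3) D, Zᴴ = -Z → ∀ t : ℝ,
      R.tr (NormedSpace.exp (t • Z) * k) ≤ R.tr (NormedSpace.exp ((0 : ℝ) • Z) * k) := by
    intro Z hZ t
    have hZ' := conjTranspose_smul_of_skew hZ t
    have := hmax (a := NormedSpace.exp (t • Z) * g') ⟨hG3 _ (hG4 _ hZ') _ hg'G, by
      change (S.rho _).det = 1
      rw [S.rho_mul (exp_mem_unitary hZ') (hG0 hg'G), Matrix.det_mul, S.det_rho_exp hZ', hg'd,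
        one_mul]⟩
    simpa [mul_assoc, NormedSpace.exp_zero] using this
  have hd : ∀ Z C : Matrix (Fin 3) (Fin 3) D, ∀ t : ℝ,
      HasDerivAt (fun t : ℝ => R.tr (NormedSpace.exp (t • Z) * C))
        (R.tr (NormedSpace.exp (t • Z) * (Z * C))) t := fun Z C t => by
    simpa [mul_assoc] using hasDerivAt_tr_exp (R := R) 1 C Z t
  have hfirst : ∀ Z : Matrix (Fin 3) (Fin 3) D, Zᴴ = -Z → R.tr (Z * k) = 0 := by
    intro Z hZ
    have hm : IsLocalMax (fun t : ℝ => R.tr (NormedSpace.exp (t • Z) * k)) 0 :=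
      Filter.Eventually.of_forall (hkmax Z hZ)
    have := hm.hasDerivAt_eq_zero (hd Z k 0)
    simpa [NormedSpace.exp_zero] using this
  have hsecond : ∀ Z : Matrix (Fin 3) (Fin 3) D, Zᴴ = -Z → R.tr (Z * (Z * k)) ≤ 0 := by
    intro Z hZ
    have := second_deriv_nonpos (hd Z k) (hd Z (Z * k) 0) (hkmax Z hZ)
    simpa [NormedSpace.exp_zero] using this
  have hkk : kᴴ = k := by
    have hZ : (k - kᴴ)ᴴ = -(k - kᴴ) := by
      rw [Matrix.conjTranspose_sub, Matrix.conjTranspose_conjTranspose, neg_sub]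
    have h1 := hfirst _ hZ
    have h2 : R.tr ((k - kᴴ) * kᴴ) = 0 := by
      rw [← R.tr_conjTranspose, Matrix.conjTranspose_mul, Matrix.conjTranspose_conjTranspose, hZ,
        R.tr_mul_comm, neg_mul, map_neg, h1, neg_zero]
    have h3 : k - kᴴ = 0 := eq_zero_of_skew_of_tr (R := R) hZ (by
      rw [mul_sub (k - kᴴ) k kᴴ, map_sub, h1, h2, sub_zero])
    exact (sub_eq_zero.1 h3).symm
  have hk2 : k * k = 1 := by
    nth_rewrite 1 [← hkk]
    exact conjTranspose_mul_of_mem (hG0 hkG)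
  have hk1 : k = 1 := by
    refine hG k hkG hkk fun W hW => ?_
    have hQ : (1 - k)ᴴ = 1 - k := by rw [Matrix.conjTranspose_sub, hkk, Matrix.conjTranspose_one]
    have hZ : ((1 - k) * W * (1 - k))ᴴ = -((1 - k) * W * (1 - k)) := by
      simp only [Matrix.conjTranspose_mul, hQ, hW, mul_neg, neg_mul, mul_assoc]
    have hQk : (1 - k) * k = -(1 - k) := by
      rw [sub_mul, hk2, one_mul, neg_sub]
    have h1 := hsecond _ hZ
    rw [mul_assoc _ (1 - k) k, hQk, mul_neg, mul_neg, map_neg] at h1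
    have h2 := R.tr_mul_conjTranspose_nonneg ((1 - k) * W * (1 - k))
    rw [hZ, mul_neg, map_neg] at h2
    exact eq_zero_of_skew_of_tr (R := R) hZ (by linarith)
  have h := S.rho_mul (hG0 hg'G) (hG0 hg)
  rw [← hk, hk1, S.rho_one] at h
  have h' := congrArg Matrix.det h
  rw [Matrix.det_mul, hg'd, one_mul, Matrix.det_one] at h'
  exact h'.symm

theorem hasDerivAt_tr_exp_conj (Y N Z : Matrix (Fin 3) (Fin 3) D) :
    HasDerivAt (fun t : ℝ => R.tr (NormedSpace.exp (t • Z) * Y * NormedSpace.exp (-(t • Z)) * N))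
      (R.tr (Z * (Y * N - N * Y))) 0 := by
  have : CompleteSpace D := FiniteDimensional.complete ℝ D
  have h1 := hasDerivAt_exp_smul_const' (𝕂 := ℝ) Z 0
  have h2 := hasDerivAt_exp_smul_const' (𝕂 := ℝ) (-Z) 0
  have h := ((h1.mul_const Y).mul h2).mul_const N
  simp only [smul_neg] at h
  refine ((LinearMap.toContinuousLinearMap R.tr).hasFDerivAt.comp_hasDerivAt 0 h).congr_deriv ?_
  simp only [zero_smul, NormedSpace.exp_zero, neg_zero, mul_one, one_mul]
  change R.tr _ = _
  rw [add_mul, map_add, mul_sub, map_sub, mul_neg, neg_mul, map_neg, mul_assoc, ← mul_assoc Z N Y,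
    R.tr_mul_comm (Z * N) Y, sub_eq_add_neg, mul_assoc Y]

/-- Hermitian matrices over `D` can be diagonalized: for the conjugate `Y` of a matrix with the
largest scalar product with a diagonal matrix `N`, the condition of first order is that `Y`
commutes with `N`. -/
theorem exists_rho_mulVec_eq_δ (x : Fin n → ℝ) :
    ∃ g ∈ unitary (Matrix (Fin 3) (Fin 3) D), ∃ p, S.rho g *ᵥ x = A.δ p := by
  set N := S.toMatrix (A.δ ![1, 0]) with hN
  have hN' : N = !![(-√3) • 1, 0, 0; 0, √3 • 1, 0; 0, 0, 0] := by
    have := S.toMatrix_eq ![1, 0] 0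
    simp only [Pi.zero_apply, map_zero, Finset.sum_const_zero, add_zero] at this
    rw [hN, this]
    simp [hermitianMatrix]
  have hc : Continuous fun g : Matrix (Fin 3) (Fin 3) D => R.tr (g * S.toMatrix x * gᴴ * N) :=
    (continuous_tr (R := R)).comp (((continuous_id.matrix_mul continuous_const).matrix_mul
      continuous_id.matrix_conjTranspose).matrix_mul continuous_const)
  obtain ⟨g, hg, hmax⟩ := S.isCompact_unitary.exists_isMaxOn ⟨1, one_mem (unitary _)⟩
    hc.continuousOn
  set Y := g * S.toMatrix x * gᴴ with hY
  have hYh : Yᴴ = Y := by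
    rw [hY, ← S.toMatrix_rho hg, toMatrix_conjTranspose]
  have hNh : Nᴴ = N := S.toMatrix_conjTranspose _
  have hfirst : ∀ Z : Matrix (Fin 3) (Fin 3) D, Zᴴ = -Z → R.tr (Z * (Y * N - N * Y)) = 0 := by
    intro Z hZ
    refine IsLocalMax.hasDerivAt_eq_zero (Filter.Eventually.of_forall fun t => ?_)
      (hasDerivAt_tr_exp_conj (R := R) Y N Z)
    have hZ' := conjTranspose_smul_of_skew hZ t
    have := hmax (a := NormedSpace.exp (t • Z) * g) (mul_mem (exp_mem_unitary hZ') hg)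
    have e : (NormedSpace.exp (t • Z))ᴴ = NormedSpace.exp (-(t • Z)) := by
      rw [← Matrix.exp_conjTranspose, hZ']
    simpa [Matrix.conjTranspose_mul, e, hY, mul_assoc, NormedSpace.exp_zero] using this
  have hcomm : Y * N - N * Y = 0 := by
    have hZ : (Y * N - N * Y)ᴴ = -(Y * N - N * Y) := by
      rw [Matrix.conjTranspose_sub, Matrix.conjTranspose_mul Y N, Matrix.conjTranspose_mul N Y, hYh,
        hNh, neg_sub]
    exact eq_zero_of_skew_of_tr (R := R) hZ (hfirst _ hZ)
  refine ⟨g, hg, ?_⟩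
  obtain ⟨p, a, hp⟩ := A.exists_eq (S.rho g *ᵥ x)
  refine ⟨p, ?_⟩
  have hYp : Y = hermitianMatrix (p 0) (p 1) (S.τ (a 0)) (star (S.τ (a 1))) (S.τ (a 2)) := by
    rw [← S.toMatrix_eq, ← hp, S.toMatrix_rho hg]
  have h3 : √3 ≠ 0 := by positivity
  have ha : ∀ i, a i = 0 := by
    have h01 := congrFun (congrFun hcomm 0) 1
    have h12 := congrFun (congrFun hcomm 1) 2
    have h20 := congrFun (congrFun hcomm 2) 0
    rw [hYp, hN'] at h01 h12 h20
    simp [hermitianMatrix, ← two_smul ℝ, h3] at h01 h12 h20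
    intro i
    fin_cases i
    · exact h12
    · exact h20
    · exact h01
  rw [hp]
  simp [ha]

end MatrixModel

end CubicTensor

/-! ### The automorphisms that fix the diagonal matrices -/

namespace CubicTensor

variable {n k : ℕ} {T : Fin n → Fin n → Fin n → ℝ} {D : Type}

/-- The property of a matrix to be an isometry and an automorphism of the product. -/
def IsAutomorphism (T : Fin n → Fin n → Fin n → ℝ) (h : Matrix (Fin n) (Fin n) ℝ) : Prop :=
  hᵀ * h = 1 ∧ ∀ x y, h *ᵥ (mulLeft T x *ᵥ y) = mulLeft T (h *ᵥ x) *ᵥ (h *ᵥ y)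

theorem IsAutomorphism.mul {g h : Matrix (Fin n) (Fin n) ℝ} (hg : IsAutomorphism T g)
    (hh : IsAutomorphism T h) : IsAutomorphism T (g * h) := by
  refine ⟨?_, fun x y => ?_⟩
  · rw [Matrix.transpose_mul, mul_assoc, ← mul_assoc gᵀ, hg.1, one_mul, hh.1]
  · simp only [← Matrix.mulVec_mulVec, hh.2, hg.2]

theorem Frame.exists_mulVec_ι_eq (A : Frame T k) {h : Matrix (Fin n) (Fin n) ℝ}
    (hh : IsAutomorphism T h) (hδ : ∀ p, h *ᵥ A.δ p = A.δ p) (i : Fin 3) (a : Fin k → ℝ) :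
    ∃ b, h *ᵥ A.ι i a = A.ι i b := by
  obtain ⟨q, b, hx⟩ := A.exists_eq (h *ᵥ A.ι i a)
  have hq : q = 0 := by
    have h1 : (h *ᵥ A.ι i a) ⬝ᵥ A.δ q = 0 := by
      rw [← hδ q, mulVec_dotProduct_mulVec hh.1, A.ι_dot_δ]
    rw [hx] at h1
    simp only [Fin.sum_univ_three, add_dotProduct, A.δ_dot_δ, A.ι_dot_δ, add_zero] at h1
    exact dotProduct_self_eq_zero.1 h1
  have hb : ∀ j, j ≠ i → b j = 0 := by
    intro j hj
    obtain ⟨p, hp⟩ := exists_idem_ne hj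
    have h1 : mulLeft T (A.δ p) *ᵥ (h *ᵥ A.ι i a) = (idem i ⬝ᵥ p) • (h *ᵥ A.ι i a) := by
      rw [← Matrix.mulVec_smul, ← A.δ_mul_ι, hh.2, hδ]
    have h2 := congrArg (· ⬝ᵥ A.ι j (b j)) h1
    simp only [A.isCartan.mulLeft_dotProduct, A.δ_mul_ι, smul_dotProduct, dotProduct_smul,
      smul_eq_mul] at h2
    have h3 : (h *ᵥ A.ι i a) ⬝ᵥ A.ι j (b j) = 0 := by
      by_contra hne
      exact hp (mul_right_cancel₀ hne h2)
    rw [hx, hq, map_zero, zero_add, sum_dotProduct, Finset.sum_eq_single j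
      (fun l _ hl => A.ι_dot_ι_of_ne l j _ _ hl) (by simp), A.ι_dot_ι] at h3
    exact dotProduct_self_eq_zero.1 h3
  refine ⟨b i, ?_⟩
  rw [hx, hq, map_zero, zero_add, Finset.sum_eq_single i (fun j _ hj => by rw [hb j hj, map_zero])
    (by simp)]

namespace MatrixModel

section triality

variable [Ring D] [Algebra ℝ D] [StarRing D] [StarModule ℝ D] {A : Frame T k} {R : RealPart D}
  (S : MatrixModel A R)

/-- An automorphism that fixes the diagonal matrices acts on the off-diagonal entries by three
isometries of `D`. -/
theorem exists_linearMap {h : Matrix (Fin n) (Fin n) ℝ}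
    (hh : IsAutomorphism T h) (hδ : ∀ p, h *ᵥ A.δ p = A.δ p) : ∃ φ : Fin 3 → D →ₗ[ℝ] D,
      (∀ i a, h *ᵥ A.ι i a = A.ι i (S.τ.symm (φ i (S.τ a)))) ∧
      (∀ i d, R.re (φ i d * star (φ i d)) = R.re (d * star d)) ∧
      ∀ i d e, star (φ i d * φ (i + 1) e) = φ (i + 2) (star (d * e)) := by
  choose r hr using A.exists_mulVec_ι_eq hh hδ
  have hadd : ∀ i a b, r i (a + b) = r i a + r i b := fun i a b => by
    apply A.ι_injective i
    rw [← hr, map_add, Matrix.mulVec_add, hr, hr, map_add]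
  have hsmul : ∀ i (c : ℝ) a, r i (c • a) = c • r i a := fun i c a => by
    apply A.ι_injective i
    rw [← hr, map_smul, Matrix.mulVec_smul, hr, map_smul]
  refine ⟨fun i => S.τ.toLinearMap ∘ₗ
    { toFun := r i, map_add' := hadd i, map_smul' := hsmul i } ∘ₗ S.τ.symm.toLinearMap,
    fun i a => ?_, fun i d => ?_, fun i d e => ?_⟩
  · simp [hr]
  · obtain ⟨a, rfl⟩ := S.τ.surjective d
    simp only [LinearMap.comp_apply, LinearEquiv.coe_coe, LinearEquiv.symm_apply_apply,
      LinearMap.coe_mk, AddHom.coe_mk]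
    rw [S.re_τ, S.re_τ, ← A.ι_dot_ι i, ← hr, mulVec_dotProduct_mulVec hh.1, A.ι_dot_ι]
  · obtain ⟨a, rfl⟩ := S.τ.surjective d
    obtain ⟨b, rfl⟩ := S.τ.surjective e
    simp only [LinearMap.comp_apply, LinearEquiv.coe_coe, ← S.τ_m, LinearEquiv.symm_apply_apply,
      LinearMap.coe_mk, AddHom.coe_mk]
    congr 1
    apply A.ι_injective (i + 2)
    have h1 := hh.2 (A.ι i a) (A.ι (i + 1) b)
    rw [A.ι_mul_ι_succ, Matrix.mulVec_smul, hr, hr, hr, A.ι_mul_ι_succ] at h1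
    exact (smul_right_injective _ (by positivity : √3 / 2 ≠ 0) h1).symm

theorem diagonal_mem_unitary {d : Fin 3 → D} (h1 : ∀ i, star (d i) * d i = 1)
    (h2 : ∀ i, d i * star (d i) = 1) :
    Matrix.diagonal d ∈ unitary (Matrix (Fin 3) (Fin 3) D) := by
  refine Unitary.mem_iff.2 ⟨?_, ?_⟩ <;>
    rw [Matrix.star_eq_conjTranspose, Matrix.diagonal_conjTranspose, Matrix.diagonal_mul_diagonal,
      ← Matrix.diagonal_one] <;> congr 1 <;> funext i
  · exact h1 i
  · exact h2 i

/-- The coordinates of the conjugate by a diagonal unitary matrix. -/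
theorem rho_diagonal {d : Fin 3 → D} (h1 : ∀ i, star (d i) * d i = 1)
    (h2 : ∀ i, d i * star (d i) = 1) (p : Fin 2 → ℝ) (a : Fin 3 → Fin k → ℝ) :
    S.rho (Matrix.diagonal d) *ᵥ (A.δ p + ∑ i, A.ι i (a i)) =
      A.δ p + ∑ i, A.ι i (S.τ.symm (d (i + 1) * S.τ (a i) * star (d (i + 2)))) := by
  apply S.toMatrix_injective
  rw [S.toMatrix_rho (diagonal_mem_unitary h1 h2), S.toMatrix_eq,
    S.toMatrix_eq p fun i => S.τ.symm (d (i + 1) * S.τ (a i) * star (d (i + 2)))]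
  simp only [LinearEquiv.apply_symm_apply, Matrix.diagonal_conjTranspose]
  ext i j
  rw [Matrix.mul_diagonal, Matrix.diagonal_mul]
  fin_cases i <;> fin_cases j <;> simp [hermitianMatrix, h2, mul_assoc]

/-- Three isometries of `D` that fix `1` and are related as in `exists_linearMap` coincide and are
multiplicative. -/
theorem eq_of_triality {φ : Fin 3 → D →ₗ[ℝ] D} (h1 : ∀ i, φ i 1 = 1)
    (h : ∀ i d e, star (φ i d * φ (i + 1) e) = φ (i + 2) (star (d * e))) :
    (∀ i d, φ i d = φ 0 d) ∧ (∀ d, φ 0 (star d) = star (φ 0 d)) ∧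
      ∀ d e, φ 0 (d * e) = φ 0 d * φ 0 e := by
  have e1 : ∀ i e, star (φ (i + 1) e) = φ (i + 2) (star e) := fun i e => by
    have := h i 1 e
    rwa [h1, one_mul, one_mul] at this
  have e2 : ∀ i d, star (φ i d) = φ (i + 2) (star d) := fun i d => by
    have := h i d 1
    rwa [h1, mul_one, mul_one] at this
  have e3 : ∀ i d, φ (i + 1) d = φ i d := fun i d => star_injective (by rw [e1, e2])
  have e4 : ∀ i d, φ i d = φ 0 d := fun i d => by
    fin_cases i
    · rfl
    · exact e3 0 d
    · exact (e3 1 d).trans (e3 0 d)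
  have e5 : ∀ d, φ 0 (star d) = star (φ 0 d) := fun d => by
    rw [e2]
    exact (e4 (0 + 2) _).symm
  refine ⟨e4, e5, fun d e => ?_⟩
  have := h 0 d e
  rw [e4 (0 + 1), e4 (0 + 2), e5] at this
  exact (star_injective this).symm

end triality

end MatrixModel

end CubicTensor

/-! ### Automorphisms of the cubic form and unitary matrices -/

namespace CubicTensor

variable {n k : ℕ} {T : Fin n → Fin n → Fin n → ℝ} {D : Type}

namespace MatrixModel

section algebra

variable [Ring D] [Algebra ℝ D] [StarRing D] [StarModule ℝ D] {A : Frame T k} {R : RealPart D}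
  (S : MatrixModel A R)

theorem toMatrix_δ (p : Fin 2 → ℝ) : S.toMatrix (A.δ p) =
    Matrix.diagonal ![(p 1 - √3 * p 0) • 1, (p 1 + √3 * p 0) • 1, (-2 * p 1) • 1] := by
  have h := S.toMatrix_eq p 0
  simp only [Pi.zero_apply, map_zero, Finset.sum_const_zero, add_zero] at h
  rw [h]
  ext i j
  fin_cases i <;> fin_cases j <;> simp [hermitianMatrix]

theorem isAutomorphism_rho {g : Matrix (Fin 3) (Fin 3) D}
    (hg : g ∈ unitary (Matrix (Fin 3) (Fin 3) D)) : IsAutomorphism T (S.rho g) :=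
  ⟨S.transpose_rho_mul_rho hg, S.rho_mulLeft hg⟩

theorem permMatrix_mem_unitary (σ : Equiv.Perm (Fin 3)) :
    σ.permMatrix D ∈ unitary (Matrix (Fin 3) (Fin 3) D) := by
  refine Unitary.mem_iff.2 ⟨?_, ?_⟩ <;>
    rw [Matrix.star_eq_conjTranspose, Matrix.conjTranspose_permMatrix, ← Matrix.permMatrix_mul]
  · simp
  · simp

theorem permMatrix_mul_diagonal_mul (σ : Equiv.Perm (Fin 3)) (d : Fin 3 → D) :
    σ.permMatrix D * Matrix.diagonal d * (σ.permMatrix D)ᴴ = Matrix.diagonal (d ∘ σ) := by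
  rw [Matrix.conjTranspose_permMatrix, Equiv.Perm.permMatrix, Equiv.Perm.permMatrix,
    PEquiv.toMatrix_toPEquiv_mul, PEquiv.mul_toMatrix_toPEquiv]
  exact Matrix.submatrix_diagonal_equiv d σ

theorem rho_swap_zero_one (p : Fin 2 → ℝ) :
    S.rho ((Equiv.swap 0 1 : Equiv.Perm (Fin 3)).permMatrix D) *ᵥ A.δ p = A.δ ![-p 0, p 1] := by
  apply S.toMatrix_injective
  rw [S.toMatrix_rho (permMatrix_mem_unitary _), toMatrix_δ, permMatrix_mul_diagonal_mul,
    toMatrix_δ]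
  congr 1
  funext i
  fin_cases i <;> simp [sub_eq_add_neg, Equiv.swap_apply_of_ne_of_ne]

theorem rho_swap_one_two (p : Fin 2 → ℝ) :
    S.rho ((Equiv.swap 1 2 : Equiv.Perm (Fin 3)).permMatrix D) *ᵥ A.δ p =
      A.δ ![p 0 / 2 - √3 / 2 * p 1, -(p 1 + √3 * p 0) / 2] := by
  apply S.toMatrix_injective
  rw [S.toMatrix_rho (permMatrix_mem_unitary _), toMatrix_δ, permMatrix_mul_diagonal_mul,
    toMatrix_δ]
  have h3 := sqrt_three_sq
  congr 1
  funext i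
  fin_cases i
  · simp only [Fin.zero_eta, Function.comp_apply, Fin.isValue, Matrix.cons_val,
      Equiv.swap_apply_of_ne_of_ne (show (0 : Fin 3) ≠ 1 by decide)
        (show (0 : Fin 3) ≠ 2 by decide)]
    congr 1
    linear_combination -p 1 / 2 * h3
  · simp only [Fin.mk_one, Function.comp_apply, Fin.isValue, Matrix.cons_val,
      Equiv.swap_apply_left]
    congr 1
    linear_combination p 1 / 2 * h3
  · simp only [Fin.reduceFinMk, Function.comp_apply, Fin.isValue, Matrix.cons_val,
      Equiv.swap_apply_right]
    congr 1
    ring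

/-- A diagonal unit vector on which the cubic form vanishes is conjugate to any other one. -/
theorem exists_rho_mulVec_δ_eq {p : Fin 2 → ℝ} (h1 : p ⬝ᵥ p = 1)
    (h2 : planeMul p p ⬝ᵥ p = 0) :
    ∃ g ∈ unitary (Matrix (Fin 3) (Fin 3) D), S.rho g *ᵥ A.δ p = A.δ ![1, 0] := by
  have h3 := sqrt_three_sq
  have h3' : 0 < √3 := by positivity
  set g₀ := (Equiv.swap 0 1 : Equiv.Perm (Fin 3)).permMatrix D
  set g₁ := (Equiv.swap 1 2 : Equiv.Perm (Fin 3)).permMatrix D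
  have u₀ : g₀ ∈ unitary (Matrix (Fin 3) (Fin 3) D) := permMatrix_mem_unitary _
  have u₁ : g₁ ∈ unitary (Matrix (Fin 3) (Fin 3) D) := permMatrix_mem_unitary _
  let P : (Fin 2 → ℝ) → Prop := fun q =>
    ∃ g ∈ unitary (Matrix (Fin 3) (Fin 3) D), S.rho g *ᵥ A.δ q = A.δ ![1, 0]
  have step : ∀ g ∈ unitary (Matrix (Fin 3) (Fin 3) D), ∀ p q : Fin 2 → ℝ,
      S.rho g *ᵥ A.δ p = A.δ q → P q → P p := by
    rintro g hg p q hq ⟨g', hg', h⟩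
    exact ⟨g' * g, mul_mem hg' hg, by rw [S.rho_mul hg' hg, ← Matrix.mulVec_mulVec, hq, h]⟩
  have s₀ : ∀ a b, P ![-a, b] → P ![a, b] := fun a b =>
    step g₀ u₀ _ _ (S.rho_swap_zero_one _)
  have s₁ : ∀ a b, P ![a / 2 - √3 / 2 * b, -(b + √3 * a) / 2] → P ![a, b] := fun a b =>
    step g₁ u₁ _ _ (S.rho_swap_one_two _)
  have base : P ![1, 0] := ⟨1, one_mem _, by rw [S.rho_one, Matrix.one_mulVec]⟩
  have axis : ∀ a : ℝ, a * a = 1 → P ![a, 0] := by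
    intro a ha
    rcases mul_self_eq_one_iff.1 ha with rfl | rfl
    · exact base
    · exact s₀ _ _ (by rwa [neg_neg])
  have line : ∀ a : ℝ, 4 * (a * a) = 1 → P ![a, -(√3 * a)] := by
    intro a ha
    refine s₁ _ _ ?_
    have e1 : a / 2 - √3 / 2 * -(√3 * a) = 2 * a := by linear_combination a / 2 * h3
    have e2 : -(-(√3 * a) + √3 * a) / 2 = 0 := by ring
    rw [e1, e2]
    exact axis _ (by linarith)
  have hp : p = ![p 0, p 1] := by ext i; fin_cases i <;> rfl
  have h1' : p 0 * p 0 + p 1 * p 1 = 1 := by simpa [dotProduct] using h1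
  have h2' : p 1 * ((√3 * p 0 - p 1) * (√3 * p 0 + p 1)) = 0 := by
    simp only [planeMul, dotProduct, Fin.sum_univ_two, Matrix.cons_val] at h2
    linear_combination h2 + p 1 * p 0 * p 0 * h3
  change P p
  rw [hp]
  rcases mul_eq_zero.1 h2' with h | h
  · rw [h] at h1' ⊢
    exact axis _ (by linarith)
  · rcases mul_eq_zero.1 h with h | h
    · have h4 : p 1 = √3 * p 0 := by linarith
      rw [h4] at h1' ⊢
      have := line (-p 0) (by linear_combination h1' - p 0 * p 0 * h3)
      rw [mul_neg, neg_neg] at this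
      exact s₀ _ _ this
    · have h4 : p 1 = -(√3 * p 0) := by linarith
      rw [h4] at h1' ⊢
      exact line _ (by linear_combination h1' - p 0 * p 0 * h3)

end algebra

section topology

variable [NormedRing D] [NormedAlgebra ℝ D] [StarRing D] [StarModule ℝ D] [ContinuousStar D]
  [FiniteDimensional ℝ D] {A : Frame T k} {R : RealPart D} (S : MatrixModel A R)

/-- Up to the action of unitary matrices, an automorphism of the cubic form is given by an
automorphism of the algebra `D`. -/
theorem exists_rho_mul_eq_map {h : Matrix (Fin n) (Fin n) ℝ} (hh : IsAutomorphism T h) :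
    ∃ g ∈ unitary (Matrix (Fin 3) (Fin 3) D), ∃ φ : D →ₐ[ℝ] D, (∀ d, φ (star d) = star (φ d)) ∧
      ∀ x, S.toMatrix ((S.rho g * h) *ᵥ x) = (S.toMatrix x).map φ := by
  set e : Fin 2 → ℝ := ![1, 0] with he
  have hee : e ⬝ᵥ e = 1 := by simp [he]
  have heee : planeMul e e = ![0, 1] := by ext i; fin_cases i <;> simp [he, planeMul]
  -- After conjugation, the automorphism fixes the diagonal matrices.
  obtain ⟨g₁, hg₁, p, hp⟩ := S.exists_rho_mulVec_eq_δ (h *ᵥ A.δ e)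
  have hA₁ := (S.isAutomorphism_rho hg₁).mul hh
  rw [Matrix.mulVec_mulVec] at hp
  have hp1 : p ⬝ᵥ p = 1 := by
    rw [← A.δ_dot_δ, ← hp, mulVec_dotProduct_mulVec hA₁.1, A.δ_dot_δ, hee]
  have hp2 : planeMul p p ⬝ᵥ p = 0 := by
    rw [← A.δ_dot_δ, ← A.δ_mul_δ, ← hp, ← hA₁.2, mulVec_dotProduct_mulVec hA₁.1, A.δ_mul_δ,
      A.δ_dot_δ, heee]
    simp [he]
  obtain ⟨g₂, hg₂, hp3⟩ := S.exists_rho_mulVec_δ_eq hp1 hp2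
  have hA₂ := (S.isAutomorphism_rho hg₂).mul hA₁
  set h₂ := S.rho g₂ * (S.rho g₁ * h) with hh₂
  have hfix0 : h₂ *ᵥ A.δ e = A.δ e := by rw [hh₂, ← Matrix.mulVec_mulVec, hp, hp3]
  have hfix : ∀ q, h₂ *ᵥ A.δ q = A.δ q := by
    intro q
    have hq : q = q 0 • e + q 1 • planeMul e e := by
      ext i; fin_cases i <;> simp [he, planeMul]
    have h1 : h₂ *ᵥ A.δ (planeMul e e) = A.δ (planeMul e e) := by
      rw [← A.δ_mul_δ, hA₂.2, hfix0]
    rw [hq, map_add, map_smul, map_smul, Matrix.mulVec_add, Matrix.mulVec_smul, Matrix.mulVec_smul,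
      hfix0, h1]
  -- A diagonal unitary matrix makes the off-diagonal entries `1` fixed as well.
  obtain ⟨φ, hφ1, hφ2, hφ3⟩ := S.exists_linearMap hA₂ hfix
  have hu1 : ∀ i, φ i 1 * star (φ i 1) = 1 := fun i => by
    rw [R.mul_star_eq, hφ2, star_one, mul_one, R.re_one, one_smul]
  have hu2 : ∀ i, star (φ i 1) * φ i 1 = 1 := fun i => by
    rw [R.star_mul_eq, hφ2, star_one, mul_one, R.re_one, one_smul]
  set d : Fin 3 → D := ![φ 1 1, star (φ 0 1), 1] with hd
  have hd1 : ∀ i, star (d i) * d i = 1 := by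
    intro i; fin_cases i <;> simp [hd, hu1, hu2]
  have hd2 : ∀ i, d i * star (d i) = 1 := by
    intro i; fin_cases i <;> simp [hd, hu1, hu2]
  have hdu := diagonal_mem_unitary hd1 hd2
  have hA₃ := (S.isAutomorphism_rho hdu).mul hA₂
  have hdι : ∀ i a, S.rho (Matrix.diagonal d) *ᵥ A.ι i a =
      A.ι i (S.τ.symm (d (i + 1) * S.τ a * star (d (i + 2)))) := by
    intro i a
    have := S.rho_diagonal hd1 hd2 0 (Pi.single i a)
    rw [map_zero, zero_add, zero_add, Finset.sum_eq_single i (fun j _ hj => by simp [hj]) (by simp),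
      Finset.sum_eq_single i (fun j _ hj => by simp [hj]) (by simp), Pi.single_eq_same] at this
    exact this
  have hdδ : ∀ p, S.rho (Matrix.diagonal d) *ᵥ A.δ p = A.δ p := by
    intro p
    have := S.rho_diagonal hd1 hd2 p 0
    simpa using this
  set h₃ := S.rho (Matrix.diagonal d) * h₂ with hh₃
  have hfix' : ∀ q, h₃ *ᵥ A.δ q = A.δ q := fun q => by
    rw [hh₃, ← Matrix.mulVec_mulVec, hfix, hdδ]
  obtain ⟨ψ, hψ1, -, hψ3⟩ := S.exists_linearMap hA₃ hfix'
  have hψφ : ∀ i c, ψ i c = d (i + 1) * φ i c * star (d (i + 2)) := by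
    intro i c
    obtain ⟨a, rfl⟩ := S.τ.surjective c
    apply S.τ.symm.injective
    apply A.ι_injective i
    rw [← hψ1, hh₃, ← Matrix.mulVec_mulVec, hφ1, hdι, LinearEquiv.apply_symm_apply]
  have hu3 : ∀ i, star (φ (i + 2) 1) = φ i 1 * φ (i + 1) 1 := fun i => by
    apply star_injective
    rw [hφ3, star_star, mul_one, star_one]
  have hψ : ∀ i, ψ i 1 = 1 := by
    intro i
    rw [hψφ]
    fin_cases i
    · simp [hd, hu2]
    · simp [hd, hu1]
    · have h1 := hu3 0
      have h2 := hu1 2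
      have h3 : φ 1 1 * φ 2 1 = star (φ 0 1) := (hu3 1).symm
      simp [hd, h3, hu2]
  obtain ⟨e1, e2, e3⟩ := eq_of_triality hψ hψ3
  refine ⟨Matrix.diagonal d * (g₂ * g₁), mul_mem hdu (mul_mem hg₂ hg₁),
    AlgHom.ofLinearMap (ψ 0) (hψ 0) e3, e2, fun x => ?_⟩
  rw [S.rho_mul hdu (mul_mem hg₂ hg₁), S.rho_mul hg₂ hg₁, mul_assoc, mul_assoc, ← hh₂, ← hh₃]
  obtain ⟨q, a, rfl⟩ := A.exists_eq x
  have hx : h₃ *ᵥ (A.δ q + ∑ i, A.ι i (a i)) =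
      A.δ q + ∑ i, A.ι i (S.τ.symm (ψ 0 (S.τ (a i)))) := by
    simp only [Fin.sum_univ_three, Matrix.mulVec_add, hfix', hψ1, e1 _ (S.τ _)]
  rw [hx, S.toMatrix_eq q fun i => S.τ.symm (ψ 0 (S.τ (a i))), S.toMatrix_eq q a]
  simp only [LinearEquiv.apply_symm_apply]
  ext i j
  fin_cases i <;> fin_cases j <;> simp [hermitianMatrix, e2, hψ]

end topology

end MatrixModel

end CubicTensor

/-! ### Derivations of the cubic form and antihermitian matrices -/

namespace CubicTensor

variable {n k : ℕ} {T : Fin n → Fin n → Fin n → ℝ} {D : Type}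

namespace MatrixModel

variable [Ring D] [Algebra ℝ D] [StarRing D] [StarModule ℝ D] {A : Frame T k} {R : RealPart D}
  (S : MatrixModel A R)

/-- The matrix of `x ↦ Z A(x) - A(x) Z` for an antihermitian matrix `Z`. -/
noncomputable def ad (Z : Matrix (Fin 3) (Fin 3) D) : Matrix (Fin n) (Fin n) ℝ :=
  LinearMap.toMatrix' (S.ofMatrix ∘ₗ
    (LinearMap.mulLeft ℝ Z - LinearMap.mulRight ℝ Z) ∘ₗ S.toMatrix)

theorem toMatrix_ad {Z : Matrix (Fin 3) (Fin 3) D} (hZ : Zᴴ = -Z) (x : Fin n → ℝ) :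
    S.toMatrix (S.ad Z *ᵥ x) = Z * S.toMatrix x - S.toMatrix x * Z := by
  obtain ⟨y, hy⟩ : ∃ y, S.toMatrix y = Z * S.toMatrix x - S.toMatrix x * Z := by
    refine S.exists_toMatrix_eq ?_ ?_
    · rw [Matrix.conjTranspose_sub, Matrix.conjTranspose_mul, Matrix.conjTranspose_mul, hZ,
        toMatrix_conjTranspose]
      noncomm_ring
    · rw [map_sub, R.tr_mul_comm, sub_self]
  rw [ad, LinearMap.toMatrix'_mulVec]
  change S.toMatrix (S.ofMatrix (Z * S.toMatrix x - S.toMatrix x * Z)) = _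
  rw [← hy, ofMatrix_toMatrix]

/-- The image of the antihermitian matrices in the endomorphisms of `ℝⁿ`. -/
def adRange : Submodule ℝ (Matrix (Fin n) (Fin n) ℝ) where
  carrier := commutatorImage S.toMatrix {Z | Zᴴ = -Z}
  zero_mem' := ⟨0, by simp, fun x => by simp⟩
  add_mem' := by
    rintro F G ⟨Z, hZ, hF⟩ ⟨Y, hY, hG⟩
    refine ⟨Z + Y, ?_, fun x => ?_⟩
    · change (Z + Y)ᴴ = -(Z + Y)
      rw [Matrix.conjTranspose_add, hZ, hY, neg_add]
    · rw [Matrix.add_mulVec, map_add, hF, hG]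
      noncomm_ring
  smul_mem' := by
    rintro r F ⟨Z, hZ, hF⟩
    refine ⟨r • Z, ?_, fun x => ?_⟩
    · change (r • Z)ᴴ = -(r • Z)
      rw [Matrix.conjTranspose_smul, hZ, star_trivial r, smul_neg]
    · rw [Matrix.smul_mulVec, map_smul, hF, smul_sub, Matrix.smul_mul, Matrix.mul_smul]

theorem adRange_le : S.adRange ≤ skewDerivations T := by
  rintro F ⟨Z, -, hF⟩
  have hskew : ∀ x y, (F *ᵥ x) ⬝ᵥ y = -(x ⬝ᵥ (F *ᵥ y)) := by
    intro x y
    have h1 := S.tr_toMatrix_mul (F *ᵥ x) y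
    have h2 := S.tr_toMatrix_mul x (F *ᵥ y)
    rw [hF] at h1 h2
    have h3 := R.tr_mul_comm Z (S.toMatrix x * S.toMatrix y)
    have e1 : (Z * S.toMatrix x - S.toMatrix x * Z) * S.toMatrix y =
        Z * (S.toMatrix x * S.toMatrix y) - S.toMatrix x * Z * S.toMatrix y := by noncomm_ring
    have e2 : S.toMatrix x * (Z * S.toMatrix y - S.toMatrix y * Z) =
        S.toMatrix x * Z * S.toMatrix y - S.toMatrix x * S.toMatrix y * Z := by noncomm_ring
    rw [e1, map_sub] at h1
    rw [e2, map_sub] at h2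
    linarith
  refine ⟨?_, fun x y => ?_⟩
  · refine matrix_ext_mulVec fun x => dotProduct_eq _ _ fun y => ?_
    rw [Matrix.mulVec_transpose, ← Matrix.dotProduct_mulVec, Matrix.neg_mulVec, neg_dotProduct,
      hskew, neg_neg]
  · apply S.toMatrix_injective
    rw [hF, map_add, toMatrix_mul, toMatrix_mul, toMatrix_mul, hF, hF, hskew]
    simp only [Matrix.mul_sub, Matrix.sub_mul, Matrix.mul_add, Matrix.add_mul, Matrix.mul_smul,
      Matrix.smul_mul, mul_one, one_mul, ← mul_assoc]
    module

theorem adRange_ne_bot : S.adRange ≠ ⊥ := by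
  intro h
  set Z : Matrix (Fin 3) (Fin 3) D := !![0, 1, 0; -1, 0, 0; 0, 0, 0] with hZdef
  have hZ : Zᴴ = -Z := by
    ext i j
    fin_cases i <;> fin_cases j <;> simp [hZdef]
  have h1 : S.ad Z ∈ S.adRange := ⟨Z, hZ, S.toMatrix_ad hZ⟩
  rw [h, Submodule.mem_bot] at h1
  have h2 := congrFun (congrFun (S.toMatrix_ad hZ (A.δ ![1, 0])) 0) 1
  rw [h1, Matrix.zero_mulVec, map_zero, toMatrix_δ, Matrix.sub_apply, Matrix.mul_diagonal,
    Matrix.diagonal_mul] at h2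
  have h3 := congrArg R.re h2
  simp [hZdef, R.re_one] at h3
  have : 0 < √3 := by positivity
  linarith

/-- If every element of the stabilizer is given by a unitary matrix, then every derivation is given
by an antihermitian matrix: the derivations of this kind form an invariant subspace of all
derivations, and these are irreducible. -/
theorem adRange_eq (hk : 0 < k) (hn : 3 ≤ n) (hT : ∀ h ∈ rotationAutomorphisms T,
    ∃ g ∈ unitary (Matrix (Fin 3) (Fin 3) D), h = S.rho g) :
    S.adRange = skewDerivations T := by
  have hinv : Invariant T S.adRange := by
    rintro h hh F ⟨Z, hZ, hF⟩
    obtain ⟨g, hg, rfl⟩ := hT h hh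
    have e : ∀ B, gᴴ * (g * B) = B := fun B => by
      rw [← mul_assoc, conjTranspose_mul_of_mem hg, one_mul]
    have e' : ∀ B, g * (gᴴ * B) = B := fun B => by
      rw [← mul_assoc, mul_conjTranspose_of_mem hg, one_mul]
    refine ⟨g * Z * gᴴ, ?_, fun x => ?_⟩
    · change (g * Z * gᴴ)ᴴ = -(g * Z * gᴴ)
      rw [Matrix.conjTranspose_mul, Matrix.conjTranspose_mul, Matrix.conjTranspose_conjTranspose,
        hZ]
      noncomm_ring
    · obtain ⟨y, rfl⟩ : ∃ y, x = S.rho g *ᵥ y := ⟨(S.rho g)ᵀ *ᵥ x, by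
        rw [Matrix.mulVec_mulVec, mul_eq_one_comm.1 hh.1, Matrix.one_mulVec]⟩
      have h1 : (S.rho g * F * (S.rho g)ᵀ) *ᵥ (S.rho g *ᵥ y) = S.rho g *ᵥ (F *ᵥ y) := by
        rw [Matrix.mulVec_mulVec, mul_assoc, hh.1, mul_one, Matrix.mulVec_mulVec]
      rw [h1, S.toMatrix_rho hg, S.toMatrix_rho hg, hF]
      simp only [mul_sub, sub_mul, mul_assoc, e]
  have hDer : Invariant T (skewDerivations T) := by
    rw [← A.isCartan.eigenspace_skewDerivations hn]
    exact invariant_eigenspace A.isCartan _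
  obtain ⟨V, hV⟩ := invariant_orthogonal hDer hinv S.adRange_le
  rcases A.eq_bot_of_split_skewDerivations hk hV with h | h
  · exact absurd h S.adRange_ne_bot
  · have := hV.sup_eq
    rwa [h, sup_bot_eq] at this

section topology

variable {D : Type} [NormedRing D] [NormedAlgebra ℝ D] [StarRing D] [StarModule ℝ D]
  [ContinuousStar D] [FiniteDimensional ℝ D] {R : RealPart D} {A : Frame T k}
  (S : MatrixModel A R)

/-- If the automorphisms of `D` that act with determinant one are inner, then every element of the
stabilizer is given by a unitary matrix. -/
theorem exists_eq_rho
    (hdet : ∀ g ∈ unitary (Matrix (Fin 3) (Fin 3) D), (S.rho g).det = 1)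
    (hφ : ∀ φ : D →ₐ[ℝ] D, (∀ h : Matrix (Fin n) (Fin n) ℝ,
      (∀ x, S.toMatrix (h *ᵥ x) = (S.toMatrix x).map φ) → h.det = 1) →
      ∃ q : D, star q * q = 1 ∧ q * star q = 1 ∧ ∀ d, φ d = q * d * star q)
    {h : Matrix (Fin n) (Fin n) ℝ} (hh : h ∈ rotationAutomorphisms T) :
    ∃ g ∈ unitary (Matrix (Fin 3) (Fin 3) D), h = S.rho g := by
  obtain ⟨g, hg, φ, -, hφ'⟩ := S.exists_rho_mul_eq_map ⟨hh.1, hh.2.2⟩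
  obtain ⟨q, hq1, hq2, hq⟩ := hφ φ fun h' hh' => by
    have : h' = S.rho g * h := matrix_ext_mulVec fun x => S.toMatrix_injective (by rw [hh', hφ'])
    rw [this, Matrix.det_mul, hdet g hg, hh.2.1, one_mul]
  have hu := diagonal_mem_unitary (d := fun _ => q) (fun _ => hq1) fun _ => hq2
  have h1 : S.rho g * h = S.rho (Matrix.diagonal fun _ => q) := by
    refine S.eq_rho hu fun x => ?_
    rw [hφ']
    ext i j
    rw [Matrix.diagonal_conjTranspose, Matrix.mul_diagonal, Matrix.diagonal_mul, Matrix.map_apply,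
      hq]
    rfl
  refine ⟨gᴴ * Matrix.diagonal fun _ => q, mul_mem (conjTranspose_mem hg) hu, ?_⟩
  rw [S.rho_mul (conjTranspose_mem hg) hu, ← h1, ← mul_assoc, ← S.rho_mul (conjTranspose_mem hg) hg,
    conjTranspose_mul_of_mem hg, rho_one, one_mul]

/-- In the presence of an imaginary unit, unitary matrices act with determinant one: if `Q W Q = 0`
for all antihermitian `W`, the diagonal matrices `W` with one imaginary entry show that `Q = 0`. -/
theorem det_rho_of_imaginary [NoZeroDivisors D] {q : D} (hq : star q = -q) (hq0 : q ≠ 0)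
    {g : Matrix (Fin 3) (Fin 3) D} (hg : g ∈ unitary (Matrix (Fin 3) (Fin 3) D)) :
    (S.rho g).det = 1 := by
  refine S.det_rho (G := (unitary (Matrix (Fin 3) (Fin 3) D) : Set (Matrix (Fin 3) (Fin 3) D)))
    subset_rfl S.isCompact_unitary.isClosed (one_mem _) (fun g hg h hh => mul_mem hg hh)
    (fun Z hZ => exp_mem_unitary hZ) (fun k _ hk hW => ?_) hg
  rw [eq_comm, ← sub_eq_zero]
  have hQ : (1 - k)ᴴ = 1 - k := by rw [Matrix.conjTranspose_sub, hk, Matrix.conjTranspose_one]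
  ext a i
  have h1 := congrFun (congrFun (hW (Matrix.single i i q)
    (by rw [Matrix.conjTranspose_single, hq, Matrix.single_neg])) a) a
  have h2 : (1 - k) i a = star ((1 - k) a i) := by
    conv_lhs => rw [← hQ]
    rfl
  rw [Matrix.mul_apply, Finset.sum_eq_single i
    (fun j _ hj => by rw [Matrix.mul_single_apply_of_ne _ _ _ _ _ hj, zero_mul]) (by simp),
    Matrix.mul_single_apply_same, h2] at h1
  rcases mul_eq_zero.1 h1 with h3 | h3
  · exact (mul_eq_zero.1 h3).resolve_right hq0
  · exact star_eq_zero.1 h3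

end topology

section stabilizer

variable {A : Frame (upsilon n) k} (S : MatrixModel A R)

theorem groupHMatrices_eq
    (hdet : ∀ g ∈ unitary (Matrix (Fin 3) (Fin 3) D), (S.rho g).det = 1)
    (hT : ∀ h ∈ rotationAutomorphisms (upsilon n),
      ∃ g ∈ unitary (Matrix (Fin 3) (Fin 3) D), h = S.rho g) :
    groupHMatrices n = conjugationImage S.M (unitary (Matrix (Fin 3) (Fin 3) D)) := by
  ext h
  refine (A.isCartan.mem_rotationAutomorphisms (h := h)).symm.trans ⟨fun hh => ?_, ?_⟩
  · obtain ⟨g, hg, rfl⟩ := hT h hh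
    exact ⟨g, hg, S.toMatrix_rho hg⟩
  · rintro ⟨g, hg, hh⟩
    rw [S.eq_rho hg hh]
    exact S.rho_mem hg (hdet g hg)

theorem eigenspaceUpsilon_eq (hk : 0 < k) (hn : 3 ≤ n)
    (hT : ∀ h ∈ rotationAutomorphisms (upsilon n),
      ∃ g ∈ unitary (Matrix (Fin 3) (Fin 3) D), h = S.rho g) :
    (eigenspaceUpsilon n (n + 2) : Set (Matrix (Fin n) (Fin n) ℝ)) =
      commutatorImage S.M {Z | Zᴴ = -Z} := by
  change (((hatEndomorphism (upsilon n)).eigenspace (n + 2) : Submodule ℝ _) :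
    Set (Matrix (Fin n) (Fin n) ℝ)) = _
  rw [A.isCartan.eigenspace_skewDerivations hn, ← S.adRange_eq hk hn hT]
  rfl

end stabilizer

end MatrixModel

end CubicTensor

/-! ### The models over the real, complex and quaternionic numbers -/

namespace CubicTensor

/-- The real part on `ℝ`. -/
def realPart : RealPart ℝ where
  re := LinearMap.id
  re_one := rfl
  re_mul_comm a b := mul_comm a b
  re_star _ := rfl
  re_mul_star_nonneg a := mul_self_nonneg a
  eq_zero_of_re_mul_star _ h := mul_self_eq_zero.1 h
  eq_of_star_eq a _ := (mul_one a).symm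

/-- The real part on `ℂ`. -/
noncomputable def complexPart : RealPart ℂ where
  re := Complex.reLm
  re_one := rfl
  re_mul_comm a b := by rw [mul_comm]
  re_star _ := rfl
  re_mul_star_nonneg a := by
    change 0 ≤ (a * star a).re
    simp only [Complex.star_def, Complex.mul_conj, Complex.ofReal_re]
    exact Complex.normSq_nonneg a
  eq_zero_of_re_mul_star a h := by
    change (a * star a).re = 0 at h
    simp only [Complex.star_def, Complex.mul_conj, Complex.ofReal_re] at h
    exact Complex.normSq_eq_zero.1 h
  eq_of_star_eq a h := by
    have h1 := Complex.conj_eq_iff_re.1 h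
    rw [← h1]
    simp

instance : StarModule ℝ ℍ[ℝ] := ⟨fun r q => by simp⟩

/-- The real part on `ℍ`. -/
noncomputable def quaternionPart : RealPart ℍ[ℝ] where
  re := QuaternionAlgebra.reₗ _ _ _
  re_one := rfl
  re_mul_comm a b := by
    change (a * b).re = (b * a).re
    simp only [Quaternion.re_mul]
    ring
  re_star a := Quaternion.re_star a
  re_mul_star_nonneg a := by
    change 0 ≤ (a * star a).re
    rw [Quaternion.self_mul_star]
    exact Quaternion.normSq_nonneg
  eq_zero_of_re_mul_star a h := by
    change (a * star a).re = 0 at h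
    rw [Quaternion.self_mul_star] at h
    exact Quaternion.normSq_eq_zero.1 h
  eq_of_star_eq a h := by
    have h1 := Quaternion.star_eq_self.1 h
    change a = a.re • 1
    conv_lhs => rw [h1]
    ext <;> simp

theorem MatrixCoordinates.π_add {n k : ℕ} (c : MatrixCoordinates n k) (p : Fin 2 → ℝ)
    (a : Fin 3 → Fin k → ℝ) : c.π (c.δ p + ∑ i, c.ι i (a i)) = p := by
  simp [c.π_δ, c.π_ι]

theorem MatrixCoordinates.α_add {n k : ℕ} (c : MatrixCoordinates n k) (p : Fin 2 → ℝ)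
    (a : Fin 3 → Fin k → ℝ) (i : Fin 3) : c.α i (c.δ p + ∑ i, c.ι i (a i)) = a i := by
  simp [c.α_δ, c.α_ι]

theorem realMatrix_eq (x : Fin 5 → ℝ) :
    realMatrix x = hermitianMatrix (x 3) (x 4) (x 0) (x 1) (x 2) := by
  simp [realMatrix, coordinate]

/-- The model of the cubic form on `ℝ⁵` by real symmetric matrices. -/
noncomputable def realModel : MatrixModel realFrame realPart where
  τ := LinearEquiv.funUnique (Fin 1) ℝ ℝ
  re_τ a b := by
    change a 0 * b 0 = _
    simp [dotProduct]
  τ_m a b := rfl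
  M := realMatrix
  M_eq p a := by
    change realMatrix (realCoordinates.δ p + ∑ i, realCoordinates.ι i (a i)) = _
    set x := realCoordinates.δ p + ∑ i, realCoordinates.ι i (a i) with hx
    have hp : ![x 3, x 4] = p := by rw [← realCoordinates_π, hx, realCoordinates.π_add]
    have ha : ∀ i, ![![x 0, x 1, x 2] i] = a i := fun i => by
      rw [← realCoordinates_α, hx, realCoordinates.α_add]
    rw [realMatrix_eq, ← hp, ← ha, ← ha, ← ha]
    rfl

theorem complexMatrix_eq (x : Fin 8 → ℝ) : complexMatrix x =
    hermitianMatrix (x 3) (x 4) (⟨x 0, x 5⟩ : ℂ) ⟨x 1, x 6⟩ ⟨x 2, x 7⟩ := by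
  simp [complexMatrix, coordinate]

/-- The model of the cubic form on `ℝ⁸` by complex hermitian matrices. -/
noncomputable def complexModel : MatrixModel complexFrame complexPart where
  τ := (LinearEquiv.finTwoArrow ℝ ℝ).trans Complex.equivRealProdLm.symm
  re_τ a b := by
    change a 0 * b 0 - a 1 * -b 1 = _
    simp [dotProduct]
  τ_m a b := by
    apply Complex.ext
    · change complexConjMul a b 0 = a 0 * b 0 - a 1 * b 1
      simp [complexConjMul_apply]
    · change complexConjMul a b 1 = -(a 0 * b 1 + a 1 * b 0)
      simp [complexConjMul_apply]
  M := complexMatrix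
  M_eq p a := by
    change complexMatrix (complexCoordinates.δ p + ∑ i, complexCoordinates.ι i (a i)) = _
    set x := complexCoordinates.δ p + ∑ i, complexCoordinates.ι i (a i) with hx
    have hp : ![x 3, x 4] = p := by rw [← complexCoordinates_π, hx, complexCoordinates.π_add]
    have h0 : ![x 0, x 5] = a 0 := by
      rw [← complexCoordinates_α_zero, hx, complexCoordinates.α_add]
    have h1 : ![x 1, -x 6] = a 1 := by
      rw [← complexCoordinates_α_one, hx, complexCoordinates.α_add]
    have h2 : ![x 2, x 7] = a 2 := by
      rw [← complexCoordinates_α_two, hx, complexCoordinates.α_add]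
    have hs : star (⟨x 1, -x 6⟩ : ℂ) = ⟨x 1, x 6⟩ := Complex.ext rfl (neg_neg _)
    rw [complexMatrix_eq, ← hp, ← h0, ← h1, ← h2, ← hs]
    rfl

theorem quaternionMatrix_eq (x : Fin 14 → ℝ) : quaternionMatrix x =
    hermitianMatrix (x 3) (x 4) (⟨x 0, x 5, x 8, x 9⟩ : ℍ[ℝ]) ⟨x 1, x 6, x 10, x 11⟩
      ⟨x 2, x 7, x 12, x 13⟩ := by
  simp [quaternionMatrix, coordinate]
  rfl

/-- The model of the cubic form on `ℝ¹⁴` by quaternionic hermitian matrices. -/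
noncomputable def quaternionModel : MatrixModel quaternionFrame quaternionPart where
  τ :=
    { toFun := fun a => ⟨a 0, a 1, a 2, a 3⟩
      map_add' := fun a b => Quaternion.ext _ _ rfl rfl rfl rfl
      map_smul' := fun r a => Quaternion.ext _ _ rfl rfl rfl rfl
      invFun := fun q => ![q.re, q.imI, q.imJ, q.imK]
      left_inv := fun a => by ext c; fin_cases c <;> rfl
      right_inv := fun q => by ext <;> rfl }
  re_τ a b := by
    change ((⟨a 0, a 1, a 2, a 3⟩ : ℍ[ℝ]) * star (⟨b 0, b 1, b 2, b 3⟩ : ℍ[ℝ])).re = _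
    simp [dotProduct, Fin.sum_univ_four]
  τ_m a b := by
    change (⟨quaternionConjMul a b 0, quaternionConjMul a b 1, quaternionConjMul a b 2,
      quaternionConjMul a b 3⟩ : ℍ[ℝ]) =
      star ((⟨a 0, a 1, a 2, a 3⟩ : ℍ[ℝ]) * (⟨b 0, b 1, b 2, b 3⟩ : ℍ[ℝ]))
    ext <;> simp [quaternionConjMul_apply] <;> ring
  M := quaternionMatrix
  M_eq p a := by
    change quaternionMatrix (quaternionCoordinates.δ p + ∑ i, quaternionCoordinates.ι i (a i)) = _
    set x := quaternionCoordinates.δ p + ∑ i, quaternionCoordinates.ι i (a i) with hx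
    have hp : ![x 3, x 4] = p := by
      rw [← quaternionCoordinates_π, hx, quaternionCoordinates.π_add]
    have h0 : ![x 0, x 5, x 8, x 9] = a 0 := by
      rw [← quaternionCoordinates_α_zero, hx, quaternionCoordinates.α_add]
    have h1 : ![x 1, -x 6, -x 10, -x 11] = a 1 := by
      rw [← quaternionCoordinates_α_one, hx, quaternionCoordinates.α_add]
    have h2 : ![x 2, x 7, x 12, x 13] = a 2 := by
      rw [← quaternionCoordinates_α_two, hx, quaternionCoordinates.α_add]
    have hs : star (⟨x 1, -x 6, -x 10, -x 11⟩ : ℍ[ℝ]) = ⟨x 1, x 6, x 10, x 11⟩ := by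
      ext <;> simp
    rw [quaternionMatrix_eq, ← hp, ← h0, ← h1, ← h2, ← hs]
    rfl

end CubicTensor

/-! ### The stabilizers as groups of unitary matrices -/

namespace CubicTensor

section real

/-- A symmetric rotation `k` of `ℝ³` with `(1 - k) W (1 - k) = 0` for all skew-symmetric `W` is the
identity: all minors of `1 - k` vanish, so that `det k = 1 - tr (1 - k)`. -/
theorem eq_one_of_skew_compression {k : Matrix (Fin 3) (Fin 3) ℝ} (hk : k * k = 1) (hk' : kᵀ = k)
    (hd : k.det = 1)
    (h : ∀ W : Matrix (Fin 3) (Fin 3) ℝ, Wᴴ = -W → (1 - k) * W * (1 - k) = 0) : k = 1 := by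
  obtain ⟨Q, hQ⟩ : ∃ Q, Q = 1 - k := ⟨_, rfl⟩
  rw [← hQ] at h
  have hkQ : k = 1 - Q := by rw [hQ, sub_sub_cancel]
  have hQt : Qᵀ = Q := by rw [hQ, Matrix.transpose_sub, hk', Matrix.transpose_one]
  have hs : ∀ i j, Q j i = Q i j := fun i j => congrFun (congrFun hQt i) j
  have hminor : ∀ i j a b, Q a i * Q j b = Q a j * Q i b := by
    intro i j a b
    have h1 := congrFun (congrFun (h (Matrix.single i j 1 - Matrix.single j i 1) (by
      rw [Matrix.conjTranspose_sub, Matrix.conjTranspose_single, Matrix.conjTranspose_single,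
        star_one, neg_sub])) a) b
    rw [mul_sub, sub_mul, Matrix.sub_apply, Matrix.mul_apply, Matrix.mul_apply,
      Finset.sum_eq_single j (fun l _ hl => by
        rw [Matrix.mul_single_apply_of_ne _ _ _ _ _ hl, zero_mul]) (by simp),
      Finset.sum_eq_single i (fun l _ hl => by
        rw [Matrix.mul_single_apply_of_ne _ _ _ _ _ hl, zero_mul]) (by simp),
      Matrix.mul_single_apply_same, Matrix.mul_single_apply_same, mul_one, mul_one,
      Matrix.zero_apply] at h1
    linarith
  have htr : Q 0 0 + Q 1 1 + Q 2 2 = 0 := by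
    rw [hkQ, Matrix.det_fin_three] at hd
    have e01 : (1 : Matrix (Fin 3) (Fin 3) ℝ) 0 1 = 0 := rfl
    have e02 : (1 : Matrix (Fin 3) (Fin 3) ℝ) 0 2 = 0 := rfl
    have e12 : (1 : Matrix (Fin 3) (Fin 3) ℝ) 1 2 = 0 := rfl
    have e10 : (1 : Matrix (Fin 3) (Fin 3) ℝ) 1 0 = 0 := rfl
    have e20 : (1 : Matrix (Fin 3) (Fin 3) ℝ) 2 0 = 0 := rfl
    have e21 : (1 : Matrix (Fin 3) (Fin 3) ℝ) 2 1 = 0 := rfl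
    simp only [Matrix.sub_apply, Matrix.one_apply_eq, e01, e02, e12, e10, e20, e21, hs 0 1, hs 0 2,
      hs 1 2] at hd
    have m01 := hminor 0 1 0 1
    have m02 := hminor 0 2 0 2
    have m12 := hminor 1 2 1 2
    have n1 := hminor 1 2 0 2
    have n2 := hminor 2 1 0 1
    rw [hs 1 2] at n2
    linear_combination -hd + m01 + m02 + m12 - Q 0 0 * m12 + Q 0 1 * n1 + Q 0 2 * n2
  have hQQ : Q * Q = (2 : ℝ) • Q := by
    rw [hQ, two_smul]
    have : (1 - k) * (1 - k) = 1 - k - k + k * k := by noncomm_ring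
    rw [this, hk]
    abel
  have hnorm : ∀ i, ∑ j, Q i j * Q i j = 2 * Q i i := fun i => by
    have := congrFun (congrFun hQQ i) i
    rw [Matrix.mul_apply] at this
    simpa only [hs i, Matrix.smul_apply, smul_eq_mul] using this
  have hzero : ∀ i j, Q i j = 0 := by
    have h0 : ∑ i, ∑ j, Q i j * Q i j = 0 := by
      simp only [hnorm, Fin.sum_univ_three]
      linarith
    have h1 := (Finset.sum_eq_zero_iff_of_nonneg fun i _ =>
      Finset.sum_nonneg fun j _ => mul_self_nonneg (Q i j)).1 h0
    intro i j
    have h2 := (Finset.sum_eq_zero_iff_of_nonneg fun j _ => mul_self_nonneg (Q i j)).1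
      (h1 i (Finset.mem_univ _))
    exact mul_self_eq_zero.1 (h2 j (Finset.mem_univ _))
  rw [hkQ, show Q = 0 from Matrix.ext hzero, sub_zero]

theorem rotation_or_neg {g : Matrix (Fin 3) (Fin 3) ℝ}
    (hg : g ∈ unitary (Matrix (Fin 3) (Fin 3) ℝ)) :
    g ∈ Matrix.specialOrthogonalGroup (Fin 3) ℝ ∨
      -g ∈ Matrix.specialOrthogonalGroup (Fin 3) ℝ := by
  have h1 : g.det * g.det = 1 := by
    have h := congrArg Matrix.det (MatrixModel.conjTranspose_mul_of_mem hg)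
    rwa [Matrix.conjTranspose_eq_transpose_of_trivial, Matrix.det_mul, Matrix.det_transpose,
      Matrix.det_one] at h
  rcases mul_self_eq_one_iff.1 h1 with h | h
  · exact Or.inl (Matrix.mem_specialOrthogonalGroup_iff.2 ⟨hg, h⟩)
  · refine Or.inr (Matrix.mem_specialOrthogonalGroup_iff.2 ⟨?_, ?_⟩)
    · refine Unitary.mem_iff.2 ⟨?_, ?_⟩
      · rw [star_neg, neg_mul_neg, Unitary.star_mul_self_of_mem hg]
      · rw [star_neg, neg_mul_neg, Unitary.mul_star_self_of_mem hg]
    · rw [Matrix.det_neg, h]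
      norm_num

theorem rho_neg (g : Matrix (Fin 3) (Fin 3) ℝ) : realModel.rho (-g) = realModel.rho g := by
  simp [MatrixModel.rho]

theorem det_rho_real {g : Matrix (Fin 3) (Fin 3) ℝ}
    (hg : g ∈ unitary (Matrix (Fin 3) (Fin 3) ℝ)) : (realModel.rho g).det = 1 := by
  have key : ∀ g ∈ (Matrix.specialOrthogonalGroup (Fin 3) ℝ : Set (Matrix (Fin 3) (Fin 3) ℝ)),
      (realModel.rho g).det = 1 := by
    intro g hg
    refine realModel.det_rho (fun g hg => (Matrix.mem_specialOrthogonalGroup_iff.1 hg).1) ?_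
      (one_mem _) (fun g hg h hh => mul_mem hg hh) (fun Z hZ => ?_) (fun k hk hk' hW => ?_) hg
    · have h : (Matrix.specialOrthogonalGroup (Fin 3) ℝ : Set (Matrix (Fin 3) (Fin 3) ℝ)) =
          (unitary (Matrix (Fin 3) (Fin 3) ℝ) : Set (Matrix (Fin 3) (Fin 3) ℝ)) ∩
            {g | g.det = 1} := by
        ext g
        exact Matrix.mem_specialOrthogonalGroup_iff
      rw [h]
      exact realModel.isCompact_unitary.isClosed.inter
        (isClosed_eq continuous_id.matrix_det continuous_const)
    · refine Matrix.mem_specialOrthogonalGroup_iff.2 ⟨MatrixModel.exp_mem_unitary hZ, ?_⟩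
      rw [Matrix.conjTranspose_eq_transpose_of_trivial] at hZ
      exact det_exp_of_skew hZ
    · obtain ⟨h1, h2⟩ := Matrix.mem_specialOrthogonalGroup_iff.1 hk
      have h3 := MatrixModel.conjTranspose_mul_of_mem h1
      rw [hk'] at h3
      rw [Matrix.conjTranspose_eq_transpose_of_trivial] at hk'
      exact eq_one_of_skew_compression h3 hk' h2 hW
  rcases rotation_or_neg hg with h | h
  · exact key g h
  · rw [← rho_neg]
    exact key _ h

theorem exists_eq_rho_real {h : Matrix (Fin 5) (Fin 5) ℝ}
    (hh : h ∈ rotationAutomorphisms (upsilon 5)) :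
    ∃ g ∈ unitary (Matrix (Fin 3) (Fin 3) ℝ), h = realModel.rho g :=
  realModel.exists_eq_rho (fun _ hg => det_rho_real hg)
    (fun φ _ => ⟨1, by simp, by simp, fun d => by simp⟩) hh

theorem groupHMatrices_five : groupHMatrices 5 =
    conjugationImage realMatrix (Matrix.specialOrthogonalGroup (Fin 3) ℝ) := by
  refine (realModel.groupHMatrices_eq (fun _ hg => det_rho_real hg)
    fun _ hh => exists_eq_rho_real hh).trans ?_
  ext h
  constructor
  · rintro ⟨g, hg, hh⟩
    rcases rotation_or_neg hg with h' | h'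
    · exact ⟨g, h', hh⟩
    · exact ⟨-g, h', fun x => by rw [Matrix.conjTranspose_neg, neg_mul, neg_mul_neg]; exact hh x⟩
  · rintro ⟨g, hg, hh⟩
    exact ⟨g, (Matrix.mem_specialOrthogonalGroup_iff.1 hg).1, hh⟩

theorem eigenspaceUpsilon_five : (eigenspaceUpsilon 5 7 : Set (Matrix (Fin 5) (Fin 5) ℝ)) =
    commutatorImage realMatrix {Z | Zᵀ = -Z} := by
  have h := realModel.eigenspaceUpsilon_eq (by norm_num) (by norm_num)
    fun _ hh => exists_eq_rho_real hh
  norm_num at h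
  exact h

end real

section complex

theorem exists_eq_rho_complex {h : Matrix (Fin 8) (Fin 8) ℝ}
    (hh : h ∈ rotationAutomorphisms (upsilon 8)) :
    ∃ g ∈ unitary (Matrix (Fin 3) (Fin 3) ℂ), h = complexModel.rho g := by
  refine complexModel.exists_eq_rho
    (fun _ hg => complexModel.det_rho_of_imaginary (q := Complex.I) (by simp) Complex.I_ne_zero hg)
    (fun φ hφ => ?_) hh
  rcases Complex.real_algHom_eq_id_or_conj φ with rfl | rfl
  · exact ⟨1, by simp, by simp, fun d => by simp⟩
  · -- Complex conjugation changes the sign of three coordinates.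
    have h1 := hφ (Matrix.diagonal ![1, 1, 1, 1, 1, -1, -1, -1]) fun x => by
      change complexMatrix _ = (complexMatrix x).map _
      rw [complexMatrix_eq, complexMatrix_eq]
      simp only [Matrix.mulVec_diagonal]
      ext i j
      fin_cases i <;> fin_cases j <;>
        simp [hermitianMatrix, Complex.ext_iff]
    rw [Matrix.det_diagonal, Fin.prod_univ_eight] at h1
    simp at h1
    norm_num at h1

theorem groupHMatrices_eight : groupHMatrices 8 =
    conjugationImage complexMatrix (Matrix.specialUnitaryGroup (Fin 3) ℂ) := by
  refine (complexModel.groupHMatrices_eq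
    (fun _ hg => complexModel.det_rho_of_imaginary (q := Complex.I) (by simp) Complex.I_ne_zero hg)
    fun _ hh => exists_eq_rho_complex hh).trans ?_
  ext h
  constructor
  · rintro ⟨g, hg, hh⟩
    have hdet : star g.det * g.det = 1 := by
      have h := congrArg Matrix.det (MatrixModel.conjTranspose_mul_of_mem hg)
      rwa [Matrix.det_mul, Matrix.det_conjTranspose, Matrix.det_one] at h
    have hdet0 : g.det ≠ 0 := fun h0 => by simp [h0] at hdet
    -- Multiplication by a cube root of the inverse determinant does not change the action.
    obtain ⟨c, hc⟩ := IsAlgClosed.exists_pow_nat_eq (g.det)⁻¹ (show 0 < 3 by norm_num)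
    have hc3 : star c * c = 1 := by
      have hn : ‖g.det‖ = 1 := by
        have h := congrArg norm hdet
        rw [norm_mul, norm_star, norm_one] at h
        nlinarith [norm_nonneg g.det]
      have h1 : ‖c‖ ^ 3 = 1 := by rw [← norm_pow, hc, norm_inv, hn, inv_one]
      have h2 : ‖c‖ = 1 := (pow_eq_one_iff_of_nonneg (norm_nonneg c) (by norm_num)).1 h1
      rw [Complex.star_def, Complex.conj_mul', h2]
      norm_num
    have hc3' : c * star c = 1 := by rw [mul_comm, hc3]
    refine ⟨c • g, Matrix.mem_specialUnitaryGroup_iff.2 ⟨Unitary.mem_iff.2 ⟨?_, ?_⟩, ?_⟩,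
      fun x => ?_⟩
    · rw [star_smul, smul_mul_smul_comm, hc3, one_smul, Unitary.star_mul_self_of_mem hg]
    · rw [star_smul, smul_mul_smul_comm, hc3', one_smul, Unitary.mul_star_self_of_mem hg]
    · rw [Matrix.det_smul, Fintype.card_fin, hc, inv_mul_cancel₀ hdet0]
    · rw [Matrix.conjTranspose_smul, Matrix.smul_mul, smul_mul_smul_comm, hc3', one_smul]
      exact hh x
  · rintro ⟨g, hg, hh⟩
    exact ⟨g, (Matrix.mem_specialUnitaryGroup_iff.1 hg).1, hh⟩

theorem eigenspaceUpsilon_eight : (eigenspaceUpsilon 8 10 : Set (Matrix (Fin 8) (Fin 8) ℝ)) =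
    commutatorImage complexMatrix {Z | Zᴴ = -Z ∧ Z.trace = 0} := by
  have h := complexModel.eigenspaceUpsilon_eq (by norm_num) (by norm_num)
    fun _ hh => exists_eq_rho_complex hh
  norm_num at h
  refine h.trans ?_
  ext F
  constructor
  · rintro ⟨Z, hZ, hF⟩
    have hZ' : Zᴴ = -Z := hZ
    have ht : star (Z.trace / 3) = -(Z.trace / 3) := by
      rw [star_div₀, ← Matrix.trace_conjTranspose, hZ', Matrix.trace_neg, neg_div]
      simp
    refine ⟨Z - (Z.trace / 3) • 1, ⟨?_, ?_⟩, fun x => ?_⟩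
    · rw [Matrix.conjTranspose_sub, Matrix.conjTranspose_smul, ht, hZ', Matrix.conjTranspose_one]
      module
    · rw [Matrix.trace_sub, Matrix.trace_smul, Matrix.trace_one, Fintype.card_fin, smul_eq_mul]
      norm_num
    · have : complexMatrix (F *ᵥ x) = Z * complexMatrix x - complexMatrix x * Z := hF x
      rw [this, sub_mul, mul_sub, Matrix.smul_mul, Matrix.mul_smul, one_mul, mul_one]
      abel
  · rintro ⟨Z, ⟨hZ, -⟩, hF⟩
    exact ⟨Z, hZ, hF⟩

end complex

section quaternion

/-- Every automorphism of the quaternions is inner: for `x` one of the units, the element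
`x - φ(i) x i - φ(j) x j - φ(k) x k` is not zero, and it intertwines `φ` with the identity. -/
theorem exists_quaternion_conj (φ : ℍ[ℝ] →ₐ[ℝ] ℍ[ℝ]) :
    ∃ q : ℍ[ℝ], star q * q = 1 ∧ q * star q = 1 ∧ ∀ d, φ d = q * d * star q := by
  obtain ⟨I, i0, i1, i2, i3⟩ : ∃ I : ℍ[ℝ], I.re = 0 ∧ I.imI = 1 ∧ I.imJ = 0 ∧ I.imK = 0 :=
    ⟨⟨0, 1, 0, 0⟩, rfl, rfl, rfl, rfl⟩
  obtain ⟨J, j0, j1, j2, j3⟩ : ∃ J : ℍ[ℝ], J.re = 0 ∧ J.imI = 0 ∧ J.imJ = 1 ∧ J.imK = 0 :=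
    ⟨⟨0, 0, 1, 0⟩, rfl, rfl, rfl, rfl⟩
  obtain ⟨K, k0, k1, k2, k3⟩ : ∃ K : ℍ[ℝ], K.re = 0 ∧ K.imI = 0 ∧ K.imJ = 0 ∧ K.imK = 1 :=
    ⟨⟨0, 0, 0, 1⟩, rfl, rfl, rfl, rfl⟩
  have hII : I * I = -1 := by ext <;> simp [i0, i1, i2, i3]
  have hJJ : J * J = -1 := by ext <;> simp [j0, j1, j2, j3]
  have hKK : K * K = -1 := by ext <;> simp [k0, k1, k2, k3]
  have hIJ : I * J = K := by ext <;> simp [i0, i1, i2, i3, j0, j1, j2, j3, k0, k1, k2, k3]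
  have hJI : J * I = -K := by ext <;> simp [i0, i1, i2, i3, j0, j1, j2, j3, k0, k1, k2, k3]
  have hJK : J * K = I := by ext <;> simp [i0, i1, i2, i3, j0, j1, j2, j3, k0, k1, k2, k3]
  have hKJ : K * J = -I := by ext <;> simp [i0, i1, i2, i3, j0, j1, j2, j3, k0, k1, k2, k3]
  have hKI : K * I = J := by ext <;> simp [i0, i1, i2, i3, j0, j1, j2, j3, k0, k1, k2, k3]
  have hIK : I * K = -J := by ext <;> simp [i0, i1, i2, i3, j0, j1, j2, j3, k0, k1, k2, k3]
  have hd : ∀ d : ℍ[ℝ], d = d.re • 1 + d.imI • I + d.imJ • J + d.imK • K := fun d => by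
    ext <;> simp [i0, i1, i2, i3, j0, j1, j2, j3, k0, k1, k2, k3]
  have e : ∀ {a b c : ℍ[ℝ]}, a * b = c → ∀ y, φ a * (φ b * y) = φ c * y := fun h y => by
    rw [← mul_assoc, ← map_mul, h]
  set p : ℍ[ℝ] → ℍ[ℝ] := fun x => x - φ I * (x * I) - φ J * (x * J) - φ K * (x * K) with hp
  have hpI : ∀ x, φ I * p x = p x * I := fun x => by
    simp only [hp, mul_sub, sub_mul, mul_assoc, hII, hJI, hKI, e hII, e hIJ, e hIK,
      map_neg, map_one]
    noncomm_ring
  have hpJ : ∀ x, φ J * p x = p x * J := fun x => by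
    simp only [hp, mul_sub, sub_mul, mul_assoc, hIJ, hJJ, hKJ, e hJI, e hJJ, e hJK,
      map_neg, map_one]
    noncomm_ring
  have hpK : ∀ x, φ K * p x = p x * K := fun x => by
    rw [← hIJ, map_mul, mul_assoc, hpJ, ← mul_assoc, hpI, mul_assoc]
  have hsum : p 1 - p I * I - p J * J - p K * K = (4 : ℝ) • (1 : ℍ[ℝ]) := by
    simp only [hp, sub_mul, mul_assoc, one_mul, mul_one, mul_neg, neg_mul, hII, hJJ, hKK, hIJ, hJI,
      hJK, hKJ, hKI, hIK]
    module
  obtain ⟨x, hx⟩ : ∃ x, p x ≠ 0 := by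
    by_contra! h
    rw [h, h, h, h] at hsum
    simp only [zero_mul, sub_zero] at hsum
    exact smul_ne_zero four_ne_zero one_ne_zero hsum.symm
  have hcomm : ∀ d, φ d * p x = p x * d := fun d => by
    rw [hd d]
    simp only [map_add, map_smul, map_one, add_mul, mul_add, smul_mul_assoc, mul_smul_comm, hpI,
      hpJ, hpK, one_mul, mul_one]
  have hn : ‖p x‖ ≠ 0 := norm_ne_zero_iff.2 hx
  have h1 : star (‖p x‖⁻¹ • p x) * (‖p x‖⁻¹ • p x) = 1 := by
    rw [Quaternion.star_mul_self, Quaternion.normSq_eq_norm_mul_self, norm_smul, norm_inv,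
      norm_norm, inv_mul_cancel₀ hn]
    simp
  have h2 : (‖p x‖⁻¹ • p x) * star (‖p x‖⁻¹ • p x) = 1 := by
    rw [Quaternion.self_mul_star, Quaternion.normSq_eq_norm_mul_self, norm_smul, norm_inv,
      norm_norm, inv_mul_cancel₀ hn]
    simp
  refine ⟨‖p x‖⁻¹ • p x, h1, h2, fun d => ?_⟩
  rw [smul_mul_assoc, ← hcomm, ← mul_smul_comm, mul_assoc, h2, mul_one]

theorem det_rho_quaternion {g : Matrix (Fin 3) (Fin 3) ℍ[ℝ]}
    (hg : g ∈ unitary (Matrix (Fin 3) (Fin 3) ℍ[ℝ])) : (quaternionModel.rho g).det = 1 := by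
  obtain ⟨I, i0, i1, i2, i3⟩ : ∃ I : ℍ[ℝ], I.re = 0 ∧ I.imI = 1 ∧ I.imJ = 0 ∧ I.imK = 0 :=
    ⟨⟨0, 1, 0, 0⟩, rfl, rfl, rfl, rfl⟩
  refine quaternionModel.det_rho_of_imaginary (q := I) ?_ (fun h => ?_) hg
  · ext <;> simp [i0, i1, i2, i3]
  · have := congrArg (fun q : ℍ[ℝ] => q.imI) h
    norm_num [i1] at this

theorem exists_eq_rho_quaternion {h : Matrix (Fin 14) (Fin 14) ℝ}
    (hh : h ∈ rotationAutomorphisms (upsilon 14)) :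
    ∃ g ∈ unitary (Matrix (Fin 3) (Fin 3) ℍ[ℝ]), h = quaternionModel.rho g :=
  quaternionModel.exists_eq_rho (fun _ hg => det_rho_quaternion hg)
    (fun φ _ => exists_quaternion_conj φ) hh

theorem groupHMatrices_fourteen : groupHMatrices 14 =
    conjugationImage quaternionMatrix (unitary (Matrix (Fin 3) (Fin 3) ℍ[ℝ])) :=
  quaternionModel.groupHMatrices_eq (fun _ hg => det_rho_quaternion hg)
    fun _ hh => exists_eq_rho_quaternion hh

theorem eigenspaceUpsilon_fourteen :
    (eigenspaceUpsilon 14 16 : Set (Matrix (Fin 14) (Fin 14) ℝ)) =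
      commutatorImage quaternionMatrix {Z | Zᴴ = -Z} := by
  have h := quaternionModel.eigenspaceUpsilon_eq (by norm_num) (by norm_num)
    fun _ hh => exists_eq_rho_quaternion hh
  norm_num at h
  exact h

end quaternion

end CubicTensor

/-! ### The equivalence of the two eight-dimensional eigenspaces -/

namespace CubicTensor

/-- Two eigenspaces that are images of `ℝⁿ` under equivariant linear maps, and have dimension `n`,
are equivalent. -/
theorem nonempty_equiv_of_equivariant {n : ℕ} {μ ν : ℝ} (hT : IsCartan (upsilon n))
    (α β : (Fin n → ℝ) →ₗ[ℝ] Matrix (Fin n) (Fin n) ℝ)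
    (hα : LinearMap.range α = eigenspaceUpsilon n μ)
    (hβ : LinearMap.range β = eigenspaceUpsilon n ν)
    (dμ : Module.finrank ℝ (eigenspaceUpsilon n μ) = n)
    (dν : Module.finrank ℝ (eigenspaceUpsilon n ν) = n)
    (eα : ∀ h ∈ rotationAutomorphisms (upsilon n), ∀ x, α (h *ᵥ x) = h * α x * hᵀ)
    (eβ : ∀ h ∈ rotationAutomorphisms (upsilon n), ∀ x, β (h *ᵥ x) = h * β x * hᵀ) :
    Nonempty ((eigenRep n μ).Equiv (eigenRep n ν)) := by
  have inj : ∀ (γ : (Fin n → ℝ) →ₗ[ℝ] Matrix (Fin n) (Fin n) ℝ),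
      Module.finrank ℝ (LinearMap.range γ) = n → Function.Injective γ := fun γ h => by
    have h1 := γ.finrank_range_add_finrank_ker
    rw [h, Module.finrank_fin_fun] at h1
    exact LinearMap.ker_eq_bot.1 (Submodule.finrank_eq_zero.1 (by omega))
  obtain ⟨a, ha⟩ : ∃ a : (Fin n → ℝ) ≃ₗ[ℝ] eigenspaceUpsilon n μ, ∀ x, (a x).1 = α x :=
    ⟨(LinearEquiv.ofInjective α (inj α (by rw [hα, dμ]))).trans (LinearEquiv.ofEq _ _ hα),
      fun x => rfl⟩
  obtain ⟨b, hb⟩ : ∃ b : (Fin n → ℝ) ≃ₗ[ℝ] eigenspaceUpsilon n ν, ∀ x, (b x).1 = β x :=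
    ⟨(LinearEquiv.ofInjective β (inj β (by rw [hβ, dν]))).trans (LinearEquiv.ofEq _ _ hβ),
      fun x => rfl⟩
  refine ⟨.mk (a.symm.trans b) fun h => LinearMap.ext fun W => ?_⟩
  have hh : h.1.1 ∈ rotationAutomorphisms (upsilon n) :=
    hT.mem_rotationAutomorphisms.2 ⟨h.1, h.2, rfl⟩
  obtain ⟨x, rfl⟩ := a.surjective W
  have h1 : eigenRep n μ h (a x) = a (h.1.1 *ᵥ x) :=
    Subtype.ext (by rw [ha, eα _ hh, ← ha]; rfl)
  have h2 : eigenRep n ν h (b x) = b (h.1.1 *ᵥ x) :=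
    Subtype.ext (by rw [hb, eβ _ hh, ← hb]; rfl)
  change b (a.symm (eigenRep n μ h (a x))) = eigenRep n ν h (b (a.symm (a x)))
  rw [h1, LinearEquiv.symm_apply_apply, LinearEquiv.symm_apply_apply, h2]

theorem conjTranspose_I_smul (x : Fin 8 → ℝ) :
    (Complex.I • complexModel.toMatrix x)ᴴ = -(Complex.I • complexModel.toMatrix x) := by
  rw [Matrix.conjTranspose_smul, complexModel.toMatrix_conjTranspose, Complex.star_def,
    Complex.conj_I, neg_smul]

/-- The derivation `y ↦ i [A(x), A(y)]` attached to `x ∈ ℝ⁸`. -/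
noncomputable def complexDerivation : (Fin 8 → ℝ) →ₗ[ℝ] Matrix (Fin 8) (Fin 8) ℝ where
  toFun x := complexModel.ad (Complex.I • complexModel.toMatrix x)
  map_add' x y := by
    refine matrix_ext_mulVec fun z => complexModel.toMatrix_injective ?_
    rw [complexModel.toMatrix_ad (conjTranspose_I_smul _), Matrix.add_mulVec,
      map_add complexModel.toMatrix (_ *ᵥ z), complexModel.toMatrix_ad (conjTranspose_I_smul _),
      complexModel.toMatrix_ad (conjTranspose_I_smul _), map_add, smul_add]
    noncomm_ring
  map_smul' r x := by
    refine matrix_ext_mulVec fun z => complexModel.toMatrix_injective ?_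
    rw [complexModel.toMatrix_ad (conjTranspose_I_smul _), RingHom.id_apply, Matrix.smul_mulVec,
      map_smul complexModel.toMatrix r (_ *ᵥ z),
      complexModel.toMatrix_ad (conjTranspose_I_smul _), map_smul, smul_comm, smul_sub,
      Matrix.smul_mul, Matrix.mul_smul]

theorem toMatrix_complexDerivation (x y : Fin 8 → ℝ) :
    complexModel.toMatrix (complexDerivation x *ᵥ y) =
      Complex.I • complexModel.toMatrix x * complexModel.toMatrix y -
        complexModel.toMatrix y * Complex.I • complexModel.toMatrix x :=
  complexModel.toMatrix_ad (conjTranspose_I_smul x) y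

theorem complexDerivation_mulVec {h : Matrix (Fin 8) (Fin 8) ℝ}
    (hh : h ∈ rotationAutomorphisms (upsilon 8)) (x : Fin 8 → ℝ) :
    complexDerivation (h *ᵥ x) = h * complexDerivation x * hᵀ := by
  obtain ⟨g, hg, rfl⟩ := exists_eq_rho_complex hh
  refine matrix_ext_mulVec fun z => complexModel.toMatrix_injective ?_
  obtain ⟨y, rfl⟩ : ∃ y, z = complexModel.rho g *ᵥ y := ⟨(complexModel.rho g)ᵀ *ᵥ z, by
    rw [Matrix.mulVec_mulVec, mul_eq_one_comm.1 hh.1, Matrix.one_mulVec]⟩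
  have h1 : (complexModel.rho g * complexDerivation x * (complexModel.rho g)ᵀ) *ᵥ
      (complexModel.rho g *ᵥ y) = complexModel.rho g *ᵥ (complexDerivation x *ᵥ y) := by
    rw [Matrix.mulVec_mulVec, mul_assoc, hh.1, mul_one, Matrix.mulVec_mulVec]
  have e : ∀ B, gᴴ * (g * B) = B := fun B => by
    rw [← mul_assoc, MatrixModel.conjTranspose_mul_of_mem hg, one_mul]
  rw [h1, complexModel.toMatrix_rho hg, toMatrix_complexDerivation, toMatrix_complexDerivation,
    complexModel.toMatrix_rho hg, complexModel.toMatrix_rho hg]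
  simp only [mul_sub, sub_mul, Matrix.smul_mul, Matrix.mul_smul, mul_assoc, e]

theorem range_complexDerivation : LinearMap.range complexDerivation = eigenspaceUpsilon 8 10 := by
  refine le_antisymm ?_ fun F hF => ?_
  · rintro _ ⟨x, rfl⟩
    have h := complexModel.eigenspaceUpsilon_eq (by norm_num) (by norm_num)
      fun _ hh => exists_eq_rho_complex hh
    norm_num at h
    rw [← SetLike.mem_coe, h]
    exact ⟨_, conjTranspose_I_smul x, toMatrix_complexDerivation x⟩
  · rw [← SetLike.mem_coe, eigenspaceUpsilon_eight] at hF
    obtain ⟨Z, ⟨hZ, ht⟩, hF⟩ := hF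
    obtain ⟨x, hx⟩ := complexModel.exists_toMatrix_eq (B := -(Complex.I • Z))
      (by rw [Matrix.conjTranspose_neg, Matrix.conjTranspose_smul, hZ, Complex.star_def,
        Complex.conj_I]; simp)
      (by
        have : complexPart.tr (-(Complex.I • Z)) = (-(Complex.I • Z)).trace.re := by
          simp [RealPart.tr, complexPart, Matrix.trace]
        rw [this, Matrix.trace_neg, Matrix.trace_smul, ht]; simp)
    have hx' : Complex.I • complexModel.toMatrix x = Z := by
      rw [hx, smul_neg, smul_smul, Complex.I_mul_I]; simp
    refine ⟨x, matrix_ext_mulVec fun y => complexModel.toMatrix_injective ?_⟩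
    rw [toMatrix_complexDerivation, hx']
    exact (hF y).symm

/-- The stabilizer in dimension eight acts on the derivations as it acts on `ℝ⁸`. -/
theorem nonempty_equiv_eight : Nonempty ((eigenRep 8 10).Equiv (eigenRep 8 (-6))) := by
  have hT := complexFrame.isCartan
  have hd := hT.finrank_eigenspace (by norm_num) (by norm_num) ![1, 8, 8, 20, 27] rfl rfl rfl rfl
    rfl
  have e1 : eigenvalue 8 1 = 10 := by norm_num [eigenvalue]
  have e2 : eigenvalue 8 2 = -6 := by
    change (2 - (8 : ℕ) : ℝ) = -6
    norm_num
  have h1 := hd 1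
  have h2 := hd 2
  rw [e1] at h1
  rw [e2] at h2
  refine nonempty_equiv_of_equivariant hT complexDerivation (mulLeft (upsilon 8))
    range_complexDerivation ?_ h1 h2 (fun _ hh x => complexDerivation_mulVec hh x)
    fun _ hh x => mulLeft_mulVec_of_mem hh x
  have h := hT.eigenspace_mulLeft (by norm_num) (by norm_num)
  norm_num at h
  exact h.symm

end CubicTensor

theorem mainTheorem5 :
    -- `n = 5`, `H_1 = SO(3)`
    (TensorSquareDecomposition 5 ![14, 7, -3, -8, 4] ![1, 3, 5, 7, 9] ∧
      groupHMatrices 5 =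
        conjugationImage realMatrix (Matrix.specialOrthogonalGroup (Fin 3) ℝ) ∧
      (eigenspaceUpsilon 5 7 : Set (Matrix (Fin 5) (Fin 5) ℝ)) =
        commutatorImage realMatrix {Z | Zᵀ = -Z}) ∧
    -- `n = 8`, `H_2` the image of `SU(3)`
    (TensorSquareDecomposition 8 ![20, 10, -6, -8, 4] ![1, 8, 8, 20, 27] ∧
      groupHMatrices 8 =
        conjugationImage complexMatrix (Matrix.specialUnitaryGroup (Fin 3) ℂ) ∧
      (eigenspaceUpsilon 8 10 : Set (Matrix (Fin 8) (Fin 8) ℝ)) =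
        commutatorImage complexMatrix {Z | Zᴴ = -Z ∧ Z.trace = 0} ∧
      Nonempty ((eigenRep 8 10).Equiv (eigenRep 8 (-6)))) ∧
    -- `n = 14`, `H_4` the image of `Sp(3)`
    (TensorSquareDecomposition 14 ![32, 16, -12, -8, 4] ![1, 21, 14, 70, 90] ∧
      groupHMatrices 14 =
        conjugationImage quaternionMatrix (unitary (Matrix (Fin 3) (Fin 3) ℍ[ℝ])) ∧
      (eigenspaceUpsilon 14 16 : Set (Matrix (Fin 14) (Fin 14) ℝ)) =
        commutatorImage quaternionMatrix {Z | Zᴴ = -Z}) ∧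
    -- `n = 26`, `H_8 = F_4`
    TensorSquareDecomposition 26 ![56, 28, -24, -8, 4] ![1, 52, 26, 273, 324] := by
  have e5 : CubicTensor.eigenvalue 5 = ![14, 7, -3, -8, 4] := by
    norm_num [CubicTensor.eigenvalue]
  have e8 : CubicTensor.eigenvalue 8 = ![20, 10, -6, -8, 4] := by
    norm_num [CubicTensor.eigenvalue]
  have e14 : CubicTensor.eigenvalue 14 = ![32, 16, -12, -8, 4] := by
    norm_num [CubicTensor.eigenvalue]
  have e26 : CubicTensor.eigenvalue 26 = ![56, 28, -24, -8, 4] := by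
    norm_num [CubicTensor.eigenvalue]
  refine ⟨⟨?_, CubicTensor.groupHMatrices_five, CubicTensor.eigenspaceUpsilon_five⟩,
    ⟨?_, CubicTensor.groupHMatrices_eight, CubicTensor.eigenspaceUpsilon_eight,
      CubicTensor.nonempty_equiv_eight⟩,
    ⟨?_, CubicTensor.groupHMatrices_fourteen, CubicTensor.eigenspaceUpsilon_fourteen⟩, ?_⟩
  · rw [← e5]
    exact CubicTensor.realFrame.tensorSquareDecomposition (by norm_num) (by norm_num) (by norm_num)
      _ rfl rfl rfl rfl rfl (by decide)
  · rw [← e8]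
    exact CubicTensor.complexFrame.tensorSquareDecomposition (by norm_num) (by norm_num)
      (by norm_num) _ rfl rfl rfl rfl rfl (by decide)
  · rw [← e14]
    exact CubicTensor.quaternionFrame.tensorSquareDecomposition (by norm_num) (by norm_num)
      (by norm_num) _ rfl rfl rfl rfl rfl (by decide)
  · rw [← e26]
    exact CubicTensor.octonionFrame.tensorSquareDecomposition (by norm_num) (by norm_num)
      (by norm_num) _ rfl rfl rfl rfl rfl (by decide)
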